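/- Let $f\in\mathbb{C}[[x_0,x_1]]$ be an irreducible power series and let $\Gamma=\{\dim_{\mathbb{C}}\mathbb{C}[[x_0,x_1]]/(f,h) : h\in\mathbb{C}[[x_0,x_1]],\ f\nmid h\}\subset\mathbb{N}$ be the semigroup of the plane branch $\{f=0\}$, with minimal system of generators $\bar\beta_0<\bar\beta_1<\cdots<\bar\beta_g$, where $g\ge 1$. Put $e_i=\gcd(\bar\beta_0,\ldots,\bar\beta_i)$ for $0\le i\le g$ and $n_i=e_{i-1}/e_i$ for $1\le i\le g$, let $b_{ij}$ $(1\le i\le g,\ 0\le j<i)$ be the non-negative integers with $n_i\bar\beta_i=\sum_{j<i}b_{ij}\bar\beta_j$ and $b_{ij}<n_j$ for $j\neq 0$, and put $n_0=b_{10}$. Let $Y\subset\mathbb{C}^{g+1}$ be the space monomial curve defined by $$x_i^{n_i}-x_0^{b_{i0}}x_1^{b_{i1}}\cdots x_{i-1}^{b_{i(i-1)}}=0,\qquad i=1,\ldots,g.$$ For $m\in\mathbb{N}$ let $Y_m$ be the $m$-th jet scheme of $Y$, with coordinates $x_i^{(j)}$ $(0\le i\le g,\ 0\le j\le m)$ given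 by the universal jet $x_i(t)=\sum_{j=0}^m x_i^{(j)}t^j$ modulo $t^{m+1}$; for $p\le m$ let $\pi_{m,p}:Y_m\to Y_p$ be the truncation map, and let $\pi_m=\pi_{m,0}:Y_m\to Y_0=Y$. For $k\ge 1$ let $j(k)$ be the largest integer $r$ with $2\le r\le g+1$ such that $n_2\cdots n_{r-1}$ divides $k$ (the empty product being $1$), and put $\bar\beta_{g+1}=+\infty$, so that the inequality $m<k\,n_{j(k)}\bar\beta_{j(k)}/e_1$ holds by convention when $j(k)=g+1$. Let $m\ge 1$ and let $l\in\mathbb{N}$ be such that $l\,n_0n_1<m\le (l+1)n_0n_1$. Put $$D_{m,k}=\pi_{m,kn_0n_1}^{-1}\bigl(\{x_0^{(0)}=\cdots=x_0^{(kn_1-1)}=0\}\cap\{x_0^{(kn_1)}\neq 0\}\bigr)_{red}\quad(k=1,\ldots,l),$$ $$B_m=\pi_{m,ln_0n_1}^{-1}\bigl(\{x_0^{(0)}=\cdots=x_0^{(ln_1)}=0\}\bigr)_{red}.$$ Then the irreducible components of $\pi_m^{-1}(0)_{red}$ are the Zariski closures $\mathcal{C}_{m,k}=\overline{D_{m,k}}$,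 for those $k\in\{1,\ldots,l\}$ such that $m<k\,n_{j(k)}\bar\beta_{j(k)}/e_1$, together with $B_m$; these sets are pairwise distinct. Moreover, $B_m$ is a component of maximal dimension. -/

import Mathlib

noncomputable section

namespace SpaceMonomialCurve

/-! ### The semigroup of a plane branch -/

/-- The valuation `h ↦ dim_ℂ ℂ⟦x₀, x₁⟧ / (f, h)` of the plane curve germ `f = 0`
(the local intersection multiplicity at the origin of `f = 0` and `h = 0`). -/
def intersectionNumber (f h : MvPowerSeries (Fin 2) ℂ) : ℕ :=
  Module.finrank ℂ (MvPowerSeries (Fin 2) ℂ ⧸ Ideal.span {f, h})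

/-- The semigroup of the germ `f = 0`: the values of the valuation on the series `h` that do not
vanish identically on the germ. -/
def branchSemigroup (f : MvPowerSeries (Fin 2) ℂ) : Set ℕ :=
  {v | ∃ h : MvPowerSeries (Fin 2) ℂ, h ∉ Ideal.span {f} ∧ v = intersectionNumber f h}

/-- `β 0 < β 1 < ⋯ < β g` is the minimal system of generators of `Γ ⊆ ℕ`
(the values `β i` with `g < i` are irrelevant). -/
structure IsMinimalGenerators (Γ : Set ℕ) (g : ℕ) (β : ℕ → ℕ) : Prop where
  strictMono : StrictMonoOn β (Set.Iic g)
  generates : (AddSubmonoid.closure (β '' Set.Iic g) : Set ℕ) = Γ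
  minimal : ∀ i ≤ g, β i ∉ AddSubmonoid.closure (β '' (Set.Iic g \ {i}))

/-- `e i = gcd (β 0, …, β i)`. -/
def e (β : ℕ → ℕ) (i : ℕ) : ℕ := (Finset.range (i + 1)).gcd β

/-- `n i = e (i - 1) / e i` for `i ≥ 1` and `n 0 = b 1 0`. -/
def n (β : ℕ → ℕ) (b : ℕ → ℕ → ℕ) : ℕ → ℕ
  | 0 => b 1 0
  | i + 1 => e β i / e β (i + 1)

/-- `b i j`, for `1 ≤ i ≤ g` and `j < i`, is the system of non-negative integers with
`n i * β i = b i 0 * β 0 + ⋯ + b i (i - 1) * β (i - 1)` and `b i j < n j` for `j ≠ 0`. -/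
def IsExponentSystem (g : ℕ) (β : ℕ → ℕ) (b : ℕ → ℕ → ℕ) : Prop :=
  ∀ i, 1 ≤ i → i ≤ g →
    (∀ j, 1 ≤ j → j < i → b i j < n β b j) ∧
      n β b i * β i = ∑ j ∈ Finset.range i, b i j * β j

/-- `j(k)`: the largest `l` with `2 ≤ l ≤ g + 1` such that `n 2 ⋯ n (l - 1)` divides `k`
(the empty product for `l = 2` being `1`). -/
def jIndex (g : ℕ) (β : ℕ → ℕ) (b : ℕ → ℕ → ℕ) (k : ℕ) : ℕ :=
  Nat.findGreatest (fun l => 2 ≤ l ∧ ∏ i ∈ Finset.Ico 2 l, n β b i ∣ k) (g + 1)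

/-- The condition `m < k * n_{j(k)} * β_{j(k)} / e_1`, with the convention `β_{g+1} = +∞`. -/
def BelowBound (g : ℕ) (β : ℕ → ℕ) (b : ℕ → ℕ → ℕ) (m k : ℕ) : Prop :=
  jIndex g β b k = g + 1 ∨
    (m : ℚ) < (k * n β b (jIndex g β b k) * β (jIndex g β b k) : ℚ) / e β 1

/-! ### The monomial curve -/

/-- The defining equations of the curve in `ℂ ^ (g + 1)`: with `i = h + 1` running from `1` to `g`,
`f_i = x_i ^ n_i - x_0 ^ b_{i0} ⋯ x_{i-1} ^ b_{i(i-1)}`. -/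
def curveEq (g : ℕ) (β : ℕ → ℕ) (b : ℕ → ℕ → ℕ) (h : Fin g) : MvPolynomial (Fin (g + 1)) ℂ :=
  MvPolynomial.X h.succ ^ n β b (h + 1) -
    ∏ j : Fin (h + 1), MvPolynomial.X (Fin.castLE (by omega) j) ^ b (h + 1) j

/-! ### Jet schemes of affine schemes -/

section Jets

variable {σ ι : Type} (F : ι → MvPolynomial σ ℂ)

/-- The universal jet `x_i(t) = x_i^{(0)} + x_i^{(1)} t + ⋯ + x_i^{(m)} t ^ m`. -/
def genericJet (σ : Type) (m : ℕ) (i : σ) : Polynomial (MvPolynomial (σ × Fin (m + 1)) ℂ) :=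
  ∑ j : Fin (m + 1), Polynomial.C (MvPolynomial.X (i, j)) * Polynomial.X ^ (j : ℕ)

/-- The coefficient of `t ^ l` in `P(x(t))`. -/
def jetCoeff (m : ℕ) (P : MvPolynomial σ ℂ) (l : ℕ) : MvPolynomial (σ × Fin (m + 1)) ℂ :=
  (MvPolynomial.aeval (genericJet σ m) P).coeff l

/-- The ideal of the `m`-th jet scheme of `{F = 0}`. -/
def jetIdeal (m : ℕ) : Ideal (MvPolynomial (σ × Fin (m + 1)) ℂ) :=
  Ideal.span {Q | ∃ k : ι, ∃ l ≤ m, Q = jetCoeff m (F k) l}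

/-- The coordinate ring of the `m`-th jet scheme. -/
abbrev JetRing (m : ℕ) : Type := MvPolynomial (σ × Fin (m + 1)) ℂ ⧸ jetIdeal F m

/-- The underlying topological space of the `m`-th jet scheme. -/
abbrev JetSpace (m : ℕ) : Type := PrimeSpectrum (JetRing F m)

/-- The coordinate function `x_i^{(j)}` on the `m`-th jet scheme, for `j ≤ m`. -/
def coord (m : ℕ) (i : σ) (j : ℕ) : JetRing F m :=
  Ideal.Quotient.mk (jetIdeal F m) ((genericJet σ m i).coeff j)

/-- The map `x_i^{(j)} ↦ x_i^{(j)}` of polynomial rings inducing the truncation of jets. -/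
def polyTrunc (σ : Type) {p m : ℕ} (h : p ≤ m) :
    MvPolynomial (σ × Fin (p + 1)) ℂ →ₐ[ℂ] MvPolynomial (σ × Fin (m + 1)) ℂ :=
  MvPolynomial.rename (Prod.map id (Fin.castLE (by omega)))

theorem coeff_genericJet (m : ℕ) (i : σ) (j : ℕ) :
    (genericJet σ m i).coeff j =
      if hj : j < m + 1 then MvPolynomial.X (i, (⟨j, hj⟩ : Fin (m + 1))) else 0 := by
  classical
  unfold genericJet
  rw [Polynomial.finsetSum_coeff]
  simp only [Polynomial.coeff_C_mul_X_pow]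
  split_ifs with hj
  · rw [Finset.sum_eq_single (⟨j, hj⟩ : Fin (m + 1))]
    · simp
    · intro c _ hc
      rw [if_neg]
      rintro rfl
      exact hc rfl
    · simp
  · refine Finset.sum_eq_zero fun c _ => ?_
    rw [if_neg]
    rintro rfl
    exact hj c.2

theorem polyTrunc_jetCoeff {p m : ℕ} (h : p ≤ m) (P : MvPolynomial σ ℂ) {l : ℕ} (hl : l ≤ p) :
    polyTrunc σ h (jetCoeff p P l) = jetCoeff m P l := by
  let I : Ideal (Polynomial (MvPolynomial (σ × Fin (m + 1)) ℂ)) :=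
    Ideal.span {Polynomial.X ^ (p + 1)}
  have key : ((Ideal.Quotient.mkₐ ℂ I).comp (Polynomial.mapAlgHom (polyTrunc σ h))).comp
      (MvPolynomial.aeval (genericJet σ p)) =
      (Ideal.Quotient.mkₐ ℂ I).comp (MvPolynomial.aeval (genericJet σ m)) := by
    refine MvPolynomial.algHom_ext fun i => ?_
    simp only [AlgHom.comp_apply, MvPolynomial.aeval_X, Ideal.Quotient.mkₐ_eq_mk]
    rw [Ideal.Quotient.eq, Ideal.mem_span_singleton, Polynomial.X_pow_dvd_iff]
    intro d hd
    have hd' : d < m + 1 := by omega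
    rw [Polynomial.coeff_sub, Polynomial.coe_mapAlgHom, Polynomial.coeff_map,
      coeff_genericJet, coeff_genericJet, dif_pos hd, dif_pos hd']
    simp [polyTrunc]
  have h2 := DFunLike.congr_fun key P
  simp only [AlgHom.comp_apply, Ideal.Quotient.mkₐ_eq_mk] at h2
  rw [Ideal.Quotient.eq, Ideal.mem_span_singleton, Polynomial.X_pow_dvd_iff] at h2
  have h3 := h2 l (by omega)
  rw [Polynomial.coeff_sub, Polynomial.coe_mapAlgHom, Polynomial.coeff_map, sub_eq_zero] at h3
  exact h3

/-- The homomorphism of coordinate rings inducing the truncation of `m`-jets to `p`-jets. -/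
def truncHom {p m : ℕ} (h : p ≤ m) : JetRing F p →+* JetRing F m :=
  Ideal.quotientMap (jetIdeal F m) (polyTrunc σ h).toRingHom (by
    rw [jetIdeal, Ideal.span_le]
    rintro _ ⟨k, l, hl, rfl⟩
    exact Ideal.subset_span ⟨k, l, hl.trans h, polyTrunc_jetCoeff h (F k) hl⟩)

/-- The truncation map `π_{m,p}` from the `m`-th to the `p`-th jet scheme. -/
def truncMap {p m : ℕ} (h : p ≤ m) : JetSpace F m → JetSpace F p :=
  PrimeSpectrum.comap (truncHom F h)

/-- The fiber `π_m⁻¹(0)`; the origin is the point of the scheme `{F = 0}` (its own `0`-th jet scheme)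
where all coordinates vanish. -/
def fiberZero (m : ℕ) : Set (JetSpace F m) :=
  truncMap F (Nat.zero_le m) ⁻¹' PrimeSpectrum.zeroLocus (Set.range fun i => coord F 0 i 0)

end Jets

/-! ### Strata of the fiber over the origin of the jet schemes of the curve -/

section Strata

variable (g : ℕ) (β : ℕ → ℕ) (b : ℕ → ℕ → ℕ)

/-- `D_{m,k}`: the inverse image under `π_{m, k n_0 n_1}` of
`{x_0^{(0)} = ⋯ = x_0^{(k n_1 - 1)} = 0} ∩ {x_0^{(k n_1)} ≠ 0}`. -/
def D (m k : ℕ) (h : k * n β b 0 * n β b 1 ≤ m) : Set (JetSpace (curveEq g β b) m) :=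
  truncMap (curveEq g β b) h ⁻¹'
    (PrimeSpectrum.zeroLocus {x | ∃ j < k * n β b 1, x = coord (curveEq g β b) _ 0 j} ∩
      (PrimeSpectrum.zeroLocus {coord (curveEq g β b) _ 0 (k * n β b 1)})ᶜ)

/-- `B_m`: the inverse image under `π_{m, l n_0 n_1}` of
`{x_0^{(0)} = ⋯ = x_0^{(l n_1)} = 0}`, where `l n_0 n_1 < m ≤ (l + 1) n_0 n_1`. -/
def B (m l : ℕ) (h : l * n β b 0 * n β b 1 ≤ m) : Set (JetSpace (curveEq g β b) m) :=
  truncMap (curveEq g β b) h ⁻¹'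
    PrimeSpectrum.zeroLocus {x | ∃ j ≤ l * n β b 1, x = coord (curveEq g β b) _ 0 j}

end Strata

/-- The irreducible components of a subset `S` of a topological space (with the induced topology),
as subsets of the ambient space. -/
def componentsOf {X : Type} [TopologicalSpace X] (S : Set X) : Set (Set X) :=
  (fun Z : Set S => (Subtype.val '' Z : Set X)) '' irreducibleComponents S

end SpaceMonomialCurve

end

/-! The plane branch enters only through arithmetic, collected in `IsBranchData`: `n_i ≥ 2` and `n_i
β_i < β_{i+1}`. The first is minimality of the generators. For the second, intersection multiplicity
with `f` is realised as a discrete valuation with residue field `ℂ`, by passing to the normalization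
of the branch (`exists_branchValuation`). Elements `h_0, …, h_g` of values `β_0, …, β_g` are then
built, each from a binomial relation between its predecessors. Giving the new element the largest
weight known a priori, which exceeds `n_i β_i`, a weight filtration shows that no element of value
`β_{i+1}` could exist unless this weight is `β_{i+1}` itself (`next_generator`).

Every point of a jet scheme is the kernel of a jet with coefficients in an algebraically closed
field, so the geometry is read off tuples of power series satisfying the equations modulo `t ^ (m +
1)`. If such a jet over the origin is not in `B_m`, then `n_1 ord x_1 = n_0 ord x_0` and coprimality
give `ord x_0 = k n_1` for some `k ≤ l`. The equations force `ord x_i = k β_i / e_1` as long as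
`n_i` times this number is at most `m`, and integrality of these orders is exactly the bound on `k`.
Hence the closed sets in question cover the fiber.

For irreducibility of the closure of `D_{m,k}`, divide each `x_i` by its leading power of `t`. The
resulting units satisfy the equations to decreasing precisions, and are to these precisions the
powers of one unit `s` (`IsBranchData.exists_common_root`); beyond them the coefficients are free.
So one jet with polynomial coefficients specializes to all of `D_{m,k}`. The set `B_m` is a linear
space, times the curve `u ^ n_1 = v ^ n_0` when `m = (l + 1) n_0 n_1`.

It remains to exclude inclusions. `x_0^{(k n_1)}` is nonzero on `D_{m,k}` but vanishes on `B_m` and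
on `D_{m,k'}` for `k' > k`. A parameter count shows that `D_{m,k}` has dimension at most that of a
linear space inside `B_m`, which keeps `B_m` out of its closure and makes `B_m` of maximal
dimension. Finally, for `k < k'`, a coefficient of the Wronskian `n_1 t x_1' x_0 - n_0 t x_0' x_1`
vanishes on `D_{m,k}` but not on `D_{m,k'}`: differentiating the first equation shows the vanishing
order to be governed by `k (n_0 + n_1 - n_0 n_1)`, which strictly decreases with `k`. -/

namespace SpaceMonomialCurve

/-! ### Intersection multiplicity with a branch as a discrete valuation -/

open Polynomial in
/-- An element of an integral extension domain of a complete local domain is a unit, or its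
complement to `1` is. -/
theorem isUnit_or_isUnit_one_sub_of_isIntegral {A B : Type*} [CommRing A] [IsDomain A]
    [IsLocalRing A] [IsAdicComplete (IsLocalRing.maximalIdeal A) A] [CommRing B] [IsDomain B]
    [Algebra A B] [Algebra.IsIntegral A B] (z : B) : IsUnit z ∨ IsUnit (1 - z) := by
  set p := minpoly A z with hp
  have hz : IsIntegral A z := Algebra.IsIntegral.isIntegral z
  have hmon : p.Monic := minpoly.monic hz
  have hirr : Irreducible p := minpoly.irreducible hz
  -- Since `p(z) = 0`, the element `a - z` divides `p(a)`. It is applied at `a = 0` and `a = 1`.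
  have key : ∀ a : A, IsUnit (p.eval a) → IsUnit (algebraMap A B a - z) := by
    intro a ha
    have h1 : (X - C a) ∣ p - C (p.eval a) := by
      rw [dvd_iff_isRoot]; simp
    obtain ⟨q, hq⟩ := h1
    have h2 : aeval z (p - C (p.eval a)) = aeval z ((X - C a) * q) := by rw [hq]
    have h3 : aeval z p = 0 := minpoly.aeval A z
    simp only [map_sub, map_mul, aeval_X, aeval_C, h3] at h2
    refine isUnit_of_mul_isUnit_left (y := aeval z q) ?_
    have : (algebraMap A B a - z) * aeval z q = algebraMap A B (p.eval a) := by
      linear_combination h2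
    rw [this]
    exact ha.map _
  by_cases h0 : IsUnit (p.eval 0)
  · left
    have := key 0 h0
    simpa using this
  right
  have hmap : (p : PowerSeries A).map (IsLocalRing.residue A) ≠ 0 := by
    rw [← Polynomial.polynomial_map_coe, ne_eq, Polynomial.coe_eq_zero_iff]
    exact p.map_monic_ne_zero hmon
  obtain ⟨P, h, H⟩ := PowerSeries.exists_isWeierstrassFactorization hmap
  have hPmon : P.Monic := H.isDistinguishedAt.monic
  have hdiv : P * (p /ₘ P) + p %ₘ P = p := by
    rw [add_comm]; exact modByMonic_add_div p P
  have hPmap : (P : PowerSeries A).map (IsLocalRing.residue A) ≠ 0 := by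
    rw [← Polynomial.polynomial_map_coe, ne_eq, Polynomial.coe_eq_zero_iff]
    exact P.map_monic_ne_zero hPmon
  have hPdeg : P.degree = (((P : PowerSeries A).map (IsLocalRing.residue A)).order.toNat : ℕ) := by
    have hF : (P : PowerSeries A).IsWeierstrassFactorization P 1 :=
      ⟨H.isDistinguishedAt, isUnit_one, by simp⟩
    rw [degree_eq_natDegree hPmon.ne_zero]
    have := PowerSeries.IsWeierstrassFactorization.natDegree_eq_toNat_order_map hF
    rw [this]
  -- Uniqueness of Weierstrass division turns the factorization of `p` by power series into
  -- divisibility by `P` among polynomials. Irreducibility then leaves `P = 1`, which makes `p(0)` a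
  -- unit, or `P = p`.
  have hr0 := (PowerSeries.IsWeierstrassDivisor.of_map_ne_zero hPmap).eq_zero_of_mul_eq
    (q := h - ((p /ₘ P : A[X]) : PowerSeries A)) (r := p %ₘ P)
    (by
      have := degree_modByMonic_lt p hPmon
      rw [hPdeg] at this
      exact this)
    (by
      have h1 : (p : PowerSeries A) = P * h := H.eq_mul
      have h2 : (P : PowerSeries A) * ((p /ₘ P : A[X]) : PowerSeries A) +
          ((p %ₘ P : A[X]) : PowerSeries A) = p := by
        exact_mod_cast congrArg (fun q : A[X] => (q : PowerSeries A)) hdiv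
      rw [mul_sub, ← h1]
      linear_combination -h2)
  have hp' : p = P * (p /ₘ P) := by rw [hr0.2, add_zero] at hdiv; exact hdiv.symm
  have hdist : p.IsDistinguishedAt (IsLocalRing.maximalIdeal A) := by
    rcases hirr.isUnit_or_isUnit hp' with hu | hu
    · exfalso
      have hP1 : P = 1 := hPmon.eq_one_of_isUnit hu
      apply h0
      have h1 : (p : PowerSeries A) = P * h := H.eq_mul
      rw [hP1, Polynomial.coe_one, one_mul] at h1
      have h2 := PowerSeries.isUnit_iff_constantCoeff.1 H.isUnit
      rw [← h1, Polynomial.constantCoeff_coe, coeff_zero_eq_eval_zero] at h2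
      exact h2
    · have hmq : (p /ₘ P).Monic := hPmon.of_mul_monic_left (hp' ▸ hmon)
      rw [hmq.eq_one_of_isUnit hu, mul_one] at hp'
      rw [hp']; exact H.isDistinguishedAt
  have h1 : p.map (IsLocalRing.residue A) = X ^ p.natDegree :=
    Polynomial.IsDistinguishedAt.map_eq_X_pow hdist
  have h2 : IsLocalRing.residue A (p.eval 1) = 1 := by
    have := congrArg (eval 1) h1
    rwa [← map_one (IsLocalRing.residue A), eval_map_apply, map_one, eval_pow, eval_X, one_pow]
      at this
  have h3 : IsUnit (p.eval 1) := by
    rw [← IsLocalRing.residue_ne_zero_iff_isUnit, h2]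
    exact one_ne_zero
  simpa using key 1 h3

section Length

variable {k U V W : Type*} [CommRing k] [AddCommGroup U] [Module k U] [AddCommGroup V] [Module k V]
  [AddCommGroup W] [Module k W]

theorem length_coker_comp (f : U →ₗ[k] V) (t : V →ₗ[k] W) (ht : Function.Injective t) :
    Module.length k (W ⧸ LinearMap.range (t ∘ₗ f)) =
      Module.length k (V ⧸ LinearMap.range f) + Module.length k (W ⧸ LinearMap.range t) := by
  refine Module.length_eq_add_of_exact
    ((LinearMap.range f).mapQ (LinearMap.range (t ∘ₗ f)) t ?_)
    (Submodule.factor (LinearMap.range_comp_le_range f t)) ?_ ?_ ?_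
  · rintro _ ⟨x, rfl⟩
    exact ⟨x, rfl⟩
  · rw [← LinearMap.ker_eq_bot, LinearMap.ker_eq_bot']
    intro x hx
    obtain ⟨x, rfl⟩ := Submodule.Quotient.mk_surjective _ x
    rw [Submodule.mapQ_apply, Submodule.Quotient.mk_eq_zero] at hx
    obtain ⟨y, hy⟩ := hx
    rw [Submodule.Quotient.mk_eq_zero]
    exact ⟨y, ht hy⟩
  · exact Submodule.factor_surjective _
  · intro x
    obtain ⟨x, rfl⟩ := Submodule.Quotient.mk_surjective _ x
    constructor
    · intro hx
      have hx : (Submodule.Quotient.mk x : W ⧸ LinearMap.range t) = 0 := hx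
      rw [Submodule.Quotient.mk_eq_zero] at hx
      obtain ⟨y, rfl⟩ := hx
      exact ⟨Submodule.Quotient.mk y, rfl⟩
    · rintro ⟨y, hy⟩
      obtain ⟨y, rfl⟩ := Submodule.Quotient.mk_surjective _ y
      rw [Submodule.mapQ_apply] at hy
      rw [← hy]
      change (Submodule.Quotient.mk (t y) : W ⧸ LinearMap.range t) = 0
      rw [Submodule.Quotient.mk_eq_zero]
      exact ⟨y, rfl⟩

/-- The cokernel of the common composite has two computations by `length_coker_comp`; the finite
length of the cokernel of `i` cancels. This carries colengths of principal ideals from an order to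
its normalization. -/
theorem length_coker_eq_of_comm (i : U →ₗ[k] V) (hi : Function.Injective i)
    (hfin : Module.length k (V ⧸ LinearMap.range i) ≠ ⊤) (s : U →ₗ[k] U) (t : V →ₗ[k] V)
    (ht : Function.Injective t) (h : i ∘ₗ s = t ∘ₗ i) :
    Module.length k (U ⧸ LinearMap.range s) = Module.length k (V ⧸ LinearMap.range t) := by
  have h1 := length_coker_comp s i hi
  have h2 := length_coker_comp i t ht
  rw [h, h2, add_comm] at h1
  exact ((ENat.add_left_injective_of_ne_top hfin) h1).symm

end Length

/-- The length over `k` of `B / (x)`. -/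
theorem length_quotient_span_eq (k : Type*) {B : Type*} [CommRing k] [CommRing B] [Algebra k B]
    (x : B) : Module.length k (B ⧸ Ideal.span {x}) =
      Module.length k (B ⧸ LinearMap.range (LinearMap.mulLeft k x)) := by
  have h : LinearMap.range (LinearMap.mulLeft k x) = (Ideal.span {x}).restrictScalars k := by
    ext y
    rw [LinearMap.mem_range, Submodule.restrictScalars_mem, Ideal.mem_span_singleton']
    constructor
    · rintro ⟨z, rfl⟩
      exact ⟨z, mul_comm _ _⟩
    · rintro ⟨z, rfl⟩
      exact ⟨z, mul_comm _ _⟩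
  rw [h]
  exact (Submodule.Quotient.restrictScalarsEquiv k (Ideal.span {x})).length_eq.symm

/-- Both sides are additive in products and vanish on units, and the residue field has length one
over `k` because `k` surjects onto it. -/
theorem length_quotient_eq_addVal (k : Type*) {B : Type*} [Field k] [CommRing B] [IsDomain B]
    [IsDiscreteValuationRing B] [Algebra k B]
    (hres : Function.Surjective (algebraMap k (IsLocalRing.ResidueField B))) (x : B) (hx : x ≠ 0) :
    Module.length k (B ⧸ Ideal.span {x}) = IsDiscreteValuationRing.addVal B x := by
  have hmul : ∀ a b : B, a ≠ 0 → Module.length k (B ⧸ Ideal.span {a * b}) =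
      Module.length k (B ⧸ Ideal.span {a}) + Module.length k (B ⧸ Ideal.span {b}) := by
    intro a b ha
    rw [length_quotient_span_eq, length_quotient_span_eq, length_quotient_span_eq,
      LinearMap.mulLeft_mul, length_coker_comp _ _ (by
        intro y z hyz
        exact mul_left_cancel₀ ha hyz), add_comm]
  obtain ⟨ϖ, hϖ⟩ := IsDiscreteValuationRing.exists_irreducible B
  have h1 : Module.length k (B ⧸ Ideal.span {ϖ}) = 1 := by
    rw [← hϖ.maximalIdeal_eq]
    have e : k ≃ₗ[k] IsLocalRing.ResidueField B :=
      LinearEquiv.ofBijective (Algebra.linearMap k _) ⟨(algebraMap k _).injective, hres⟩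
    have := e.length_eq
    rw [Module.length_eq_one_iff.2 inferInstance] at this
    exact this.symm
  have hunit : ∀ u : B, IsUnit u → Module.length k (B ⧸ Ideal.span {u}) = 0 := by
    intro u hu
    rw [Ideal.span_singleton_eq_top.2 hu]
    exact Module.length_eq_zero_iff.2 inferInstance
  have hpow : ∀ j : ℕ, Module.length k (B ⧸ Ideal.span {ϖ ^ j}) = j := by
    intro j
    induction j with
    | zero => rw [pow_zero, hunit _ isUnit_one]; simp
    | succ j ih => rw [pow_succ, hmul _ _ (pow_ne_zero _ hϖ.ne_zero), ih, h1]; simp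
  obtain ⟨j, u, rfl⟩ := IsDiscreteValuationRing.eq_unit_mul_pow_irreducible hx hϖ
  rw [hmul _ _ u.ne_zero, hunit _ u.isUnit, hpow, zero_add,
    IsDiscreteValuationRing.addVal_def' u hϖ j]

open nonZeroDivisors

/-- A discrete valuation with residue field `ℂ` computing the colength of principal ideals. -/
structure IsColengthValuation {R : Type*} [CommRing R] [Algebra ℂ R] (v : R → ℕ∞) : Prop where
  map_mul : ∀ x y, v (x * y) = v x + v y
  min_le_add : ∀ x y, min (v x) (v y) ≤ v (x + y)
  exists_lt_sub : ∀ x y, v x ≠ ⊤ → v x = v y → ∃ c : ℂ, v x < v (x - c • y)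
  map_zero : v 0 = ⊤

/-- The normalization `B` of `O` is finite over the complete ring `ℂ⟦X⟧`, hence local and a discrete
valuation ring; its residue field is algebraic over `ℂ`, hence equal to `ℂ`. Restrict its valuation
to `O`: as `O` has finite colength in `B`, `xO` and `xB` have the same colength. -/
theorem exists_colengthValuation (O : Type) [CommRing O] [IsDomain O] [Algebra ℂ O]
    [Algebra (PowerSeries ℂ) O] [IsScalarTower ℂ (PowerSeries ℂ) O]
    [Module.Finite (PowerSeries ℂ) O] [FaithfulSMul (PowerSeries ℂ) O] :
    ∃ v : O → ℕ∞, IsColengthValuation v ∧ (∀ x, v x = ⊤ ↔ x = 0) ∧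
      ∀ x, x ≠ 0 → v x = Module.finrank ℂ (O ⧸ Ideal.span {x}) := by
  classical
  let A := PowerSeries ℂ
  let F := FractionRing A
  let K := FractionRing O
  let : Algebra F K := FractionRing.liftAlgebra A K
  have : IsScalarTower A F K := FractionRing.isScalarTower_liftAlgebra A K
  have : Algebra.IsIntegral A O := inferInstance
  have : Algebra.IsAlgebraic F K := isAlgebraic_of_isFractionRing A O F K
  have : IsLocalization (Algebra.algebraMapSubmonoid O A⁰) K := by
    refine ⟨⟨?_, fun z => ?_, fun {x y} h => ⟨1, by rw [IsFractionRing.injective O K h]⟩⟩⟩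
    · rintro ⟨_, a, ha, rfl⟩
      rw [isUnit_iff_ne_zero, map_ne_zero_iff _ (IsFractionRing.injective O K),
        map_ne_zero_iff _ (FaithfulSMul.algebraMap_injective A O)]
      exact nonZeroDivisors.ne_zero ha
    · obtain ⟨⟨x, y⟩, hxy⟩ := IsLocalization.surj O⁰ z
      obtain ⟨a, ha, w, hw⟩ :=
        (Algebra.IsIntegral.isIntegral (R := A) (y : O)).isAlgebraic.exists_nonzero_dvd y.2
      refine ⟨⟨x * w, ⟨_, a, mem_nonZeroDivisors_of_ne_zero ha, rfl⟩⟩, ?_⟩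
      simp only [hw, map_mul]
      rw [← mul_assoc]
      exact congrArg (· * algebraMap O K w) hxy
  have : FiniteDimensional F K := .of_isLocalization A O A⁰
  have : CharZero F := charZero_of_injective_algebraMap (R := ℂ)
    ((IsFractionRing.injective A F).comp PowerSeries.C_injective : Function.Injective
      ((algebraMap A F).comp (PowerSeries.C (R := ℂ))))
  have : Algebra.IsSeparable F K := inferInstance
  let B := integralClosure A K
  have : IsDedekindDomain B := integralClosure.isDedekindDomain A F K
  have : Module.Finite A B := IsIntegralClosure.finite A F K B
  have : IsAdicComplete (IsLocalRing.maximalIdeal A) A := by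
    rw [PowerSeries.maximalIdeal_eq_span_X]; infer_instance
  have : IsLocalRing B := IsLocalRing.of_isUnit_or_isUnit_one_sub_self fun a =>
    isUnit_or_isUnit_one_sub_of_isIntegral (A := A) a
  have hinjAB : Function.Injective (algebraMap A B) := by
    have : Function.Injective (algebraMap A K) := by
      rw [IsScalarTower.algebraMap_eq A O K]
      exact (IsFractionRing.injective O K).comp (FaithfulSMul.algebraMap_injective A O)
    rw [IsScalarTower.algebraMap_eq A B K] at this
    exact Function.Injective.of_comp (f := algebraMap B K) this
  have hnf : ¬ IsField B := by
    intro h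
    have : IsField A := isField_of_isIntegral_of_isField hinjAB h
    exact IsDiscreteValuationRing.not_isField A this
  have : IsDiscreteValuationRing B := by
    have h : IsDiscreteValuationRing B ↔ IsDedekindDomain B :=
      (IsDiscreteValuationRing.TFAE B hnf).out 0 2
    exact h.2 inferInstance
  have hres : Function.Surjective (algebraMap ℂ (IsLocalRing.ResidueField B)) := by
    have : IsLocalHom (algebraMap A B) := RingHom.IsIntegral.isLocalHom
      (f := algebraMap A B) (fun x => Algebra.IsIntegral.isIntegral x) hinjAB
    have : Algebra.IsIntegral ℂ (IsLocalRing.ResidueField B) := by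
      constructor
      intro z
      obtain ⟨z, rfl⟩ := IsLocalRing.residue_surjective z
      obtain ⟨p, hp, hz⟩ := Algebra.IsIntegral.isIntegral (R := A) z
      refine ⟨p.map (PowerSeries.constantCoeff (R := ℂ)), hp.map _, ?_⟩
      rw [Polynomial.eval₂_map]
      have : (algebraMap ℂ (IsLocalRing.ResidueField B)).comp (PowerSeries.constantCoeff (R := ℂ)) =
          (IsLocalRing.residue B).comp (algebraMap A B) := by
        ext a
        change algebraMap ℂ (IsLocalRing.ResidueField B) (PowerSeries.constantCoeff a) =
          IsLocalRing.residue B (algebraMap A B a)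
        rw [IsScalarTower.algebraMap_apply ℂ B, IsLocalRing.ResidueField.algebraMap_eq,
          ← sub_eq_zero, ← map_sub, IsLocalRing.residue_eq_zero_iff,
          IsScalarTower.algebraMap_apply ℂ A B, ← map_sub, IsLocalRing.mem_maximalIdeal,
          map_mem_nonunits_iff, ← IsLocalRing.mem_maximalIdeal, PowerSeries.maximalIdeal_eq_span_X,
          Ideal.mem_span_singleton, PowerSeries.X_dvd_iff]
        change PowerSeries.constantCoeff (PowerSeries.C (PowerSeries.constantCoeff a) - a) = 0
        simp
      rw [this, ← Polynomial.hom_eval₂, hz, map_zero]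
    exact (IsAlgClosed.algebraMap_bijective_of_isIntegral).2
  let ι : O →ₐ[A] B := (IsScalarTower.toAlgHom A O K).codRestrict B (fun x =>
    (Algebra.IsIntegral.isIntegral (R := A) x).map (IsScalarTower.toAlgHom A O K))
  have hι : Function.Injective ι := by
    intro x y h
    exact IsFractionRing.injective O K (congrArg Subtype.val h)
  have hlen : ∀ x : B, x ≠ 0 → Module.length ℂ (B ⧸ Ideal.span {x}) =
      IsDiscreteValuationRing.addVal B x := length_quotient_eq_addVal ℂ hres
  let ιC : O →ₗ[ℂ] B := ι.toLinearMap.restrictScalars ℂ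
  -- A common denominator `d` of generators of `B` gives `dB ⊆ O`, and `B / dB` has finite length.
  have hcofin : Module.length ℂ (B ⧸ LinearMap.range ιC) ≠ ⊤ := by
    obtain ⟨s, hs⟩ := Module.Finite.fg_top (R := A) (M := B)
    obtain ⟨d, hd⟩ := IsLocalization.exist_integer_multiples_of_finset O⁰
      (s.image (algebraMap B K))
    have hd0 : (d : O) ≠ 0 := nonZeroDivisors.ne_zero d.2
    have hdB : ∀ z : B, ∃ y : O, ι y = ι d * z := by
      intro z
      have hz : z ∈ Submodule.span A (s : Set B) := by rw [hs]; trivial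
      induction hz using Submodule.span_induction with
      | mem z hz =>
        obtain ⟨y, hy⟩ := hd (algebraMap B K z) (Finset.mem_image_of_mem _ hz)
        refine ⟨y, Subtype.ext ?_⟩
        change algebraMap O K y = algebraMap O K d * z
        rw [hy, Algebra.smul_def]; rfl
      | zero => exact ⟨0, by simp⟩
      | add x y _ _ hx hy =>
        obtain ⟨x', hx⟩ := hx
        obtain ⟨y', hy⟩ := hy
        exact ⟨x' + y', by rw [map_add, hx, hy, mul_add]⟩
      | smul a x _ hx =>
        obtain ⟨x', hx⟩ := hx
        exact ⟨a • x', by rw [map_smul, hx, mul_smul_comm]⟩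
    have hle : LinearMap.range (LinearMap.mulLeft ℂ (ι d)) ≤ LinearMap.range ιC := by
      rintro _ ⟨z, rfl⟩
      obtain ⟨y, hy⟩ := hdB z
      exact ⟨y, hy⟩
    have h1 := Module.length_le_of_surjective (Submodule.factor hle) (Submodule.factor_surjective hle)
    rw [← length_quotient_span_eq, hlen _ (by rwa [map_ne_zero_iff _ hι])] at h1
    refine ne_top_of_le_ne_top ?_ h1
    rw [ne_eq, IsDiscreteValuationRing.addVal_eq_top_iff]
    rwa [map_eq_zero_iff _ hι]
  have hO : ∀ x : O, x ≠ 0 → Module.length ℂ (O ⧸ Ideal.span {x}) =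
      IsDiscreteValuationRing.addVal B (ι x) := by
    intro x hx
    have hx' : ι x ≠ 0 := by rwa [map_ne_zero_iff _ hι]
    rw [← hlen _ hx', length_quotient_span_eq, length_quotient_span_eq]
    refine length_coker_eq_of_comm ιC hι hcofin _ _ (fun y z h => mul_left_cancel₀ hx' h) ?_
    ext y
    change ((ι (x * y) : B) : K) = ((ι x * ι y : B) : K)
    rw [map_mul]
  refine ⟨fun x => IsDiscreteValuationRing.addVal B (ι x), ⟨?_, ?_, ?_, ?_⟩, ?_, ?_⟩
  · intro x y
    rw [map_mul, IsDiscreteValuationRing.addVal_mul]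
  · intro x y
    rw [map_add]
    exact IsDiscreteValuationRing.addVal_add
  · intro x y hx hxy
    rw [IsDiscreteValuationRing.addVal_eq_iff_associated] at hxy
    obtain ⟨u, hu⟩ := hxy.symm
    obtain ⟨c, hc⟩ := hres (IsLocalRing.residue B u)
    refine ⟨c, ?_⟩
    -- The scalar `c` is the residue of the unit `u = x / y`, so `u - c` has positive valuation.
    have h1 : ι (x - c • y) = (u - algebraMap ℂ B c) * ι y := by
      have : ι (c • y) = algebraMap ℂ B c * ι y := by
        rw [← Algebra.smul_def]
        exact ιC.map_smul c y
      rw [map_sub, this, ← hu]; ring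
    have h2 : (u : B) - algebraMap ℂ B c ∈ IsLocalRing.maximalIdeal B := by
      rw [← IsLocalRing.residue_eq_zero_iff, map_sub, ← hc, sub_eq_zero,
        IsScalarTower.algebraMap_apply ℂ B (IsLocalRing.ResidueField B)]
      rfl
    have h3 : IsDiscreteValuationRing.addVal B ((u : B) - algebraMap ℂ B c) ≠ 0 := by
      rw [ne_eq, IsDiscreteValuationRing.addVal_eq_zero_iff]
      exact h2
    have h4 : IsDiscreteValuationRing.addVal B (ι x) = IsDiscreteValuationRing.addVal B (ι y) := by
      rw [IsDiscreteValuationRing.addVal_eq_iff_associated]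
      exact (Associated.symm ⟨u, hu⟩)
    rw [h1, IsDiscreteValuationRing.addVal_mul, ← h4, add_comm]
    exact (ENat.add_lt_add_iff_left hx).2 (pos_iff_ne_zero.2 h3) |>.trans_eq' (add_zero _)
  · simp
  · intro x
    rw [IsDiscreteValuationRing.addVal_eq_top_iff, map_eq_zero_iff _ hι]
  · intro x hx
    change IsDiscreteValuationRing.addVal B (ι x) = _
    have hne : Module.length ℂ (O ⧸ Ideal.span {x}) ≠ ⊤ := by
      rw [hO x hx, ne_eq, IsDiscreteValuationRing.addVal_eq_top_iff, map_eq_zero_iff _ hι]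
      exact hx
    rw [← hO x hx]
    have : IsNoetherian ℂ (O ⧸ Ideal.span {x}) :=
      (isFiniteLength_iff_isNoetherian_isArtinian.1 (Module.length_ne_top_iff.1 hne)).1
    exact Module.length_eq_finrank ℂ _

noncomputable section

/-- The isomorphism of `ℂ⟦x₀, x₁⟧` with `ℂ⟦x⟧⟦y⟧` given by a choice of the variable `y`. -/
def iteratedPowerSeriesEquiv (u : Fin 2 ≃ Option Unit) :
    MvPowerSeries (Fin 2) ℂ ≃ₐ[ℂ] PowerSeries (PowerSeries ℂ) :=
  (MvPowerSeries.renameEquiv ℂ u).trans (MvPowerSeries.optionEquivLeft Unit ℂ)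

theorem iteratedPowerSeriesEquiv_X (u : Fin 2 ≃ Option Unit) (i : Fin 2) (hi : u i = some ()) :
    iteratedPowerSeriesEquiv u (MvPowerSeries.X i) = PowerSeries.C PowerSeries.X := by
  change MvPowerSeries.optionEquivLeft Unit ℂ (MvPowerSeries.rename u (MvPowerSeries.X i)) = _
  rw [MvPowerSeries.rename_X, hi]
  exact MvPowerSeries.optionEquivLeft_X_some ()

theorem X_dvd_of_map_residue_eq_zero (u : Fin 2 ≃ Option Unit) (i : Fin 2) (hi : u i = some ())
    (f : MvPowerSeries (Fin 2) ℂ)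
    (h : (iteratedPowerSeriesEquiv u f).map (IsLocalRing.residue (PowerSeries ℂ)) = 0) :
    MvPowerSeries.X i ∣ f := by
  have h1 : ∀ j, ∃ c, PowerSeries.coeff j (iteratedPowerSeriesEquiv u f) = PowerSeries.X * c := by
    intro j
    have := congrArg (PowerSeries.coeff j) h
    rw [PowerSeries.coeff_map, map_zero, IsLocalRing.residue_eq_zero_iff,
      PowerSeries.maximalIdeal_eq_span_X, Ideal.mem_span_singleton] at this
    exact this
  choose c hc using h1
  refine ⟨(iteratedPowerSeriesEquiv u).symm (PowerSeries.mk c), ?_⟩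
  apply (iteratedPowerSeriesEquiv u).injective
  rw [map_mul, iteratedPowerSeriesEquiv_X u i hi, AlgEquiv.apply_symm_apply]
  ext1 j
  rw [hc, PowerSeries.coeff_C_mul, PowerSeries.coeff_mk]

/-- If no choice of the distinguished variable worked, both variables would divide the irreducible
`f` and hence be associated. This replaces the usual linear change of coordinates before Weierstrass
preparation. -/
theorem exists_iteratedPowerSeriesEquiv (f : MvPowerSeries (Fin 2) ℂ) (hf : Irreducible f) :
    ∃ E : MvPowerSeries (Fin 2) ℂ ≃ₐ[ℂ] PowerSeries (PowerSeries ℂ),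
      (E f).map (IsLocalRing.residue (PowerSeries ℂ)) ≠ 0 := by
  by_contra! H
  have hassoc : ∀ i, ∃ u : Fin 2 ≃ Option Unit, u i = some () := by
    intro i
    refine ⟨(Fintype.equivOfCardEq (by simp : Fintype.card (Fin 2) = Fintype.card (Option Unit))).trans
      (Equiv.swap (Fintype.equivOfCardEq (by simp) i) (some ())), by simp⟩
  have hX : ∀ i : Fin 2, ¬ IsUnit (MvPowerSeries.X i : MvPowerSeries (Fin 2) ℂ) := by
    intro i h
    have := h.map (MvPowerSeries.constantCoeff (σ := Fin 2) (R := ℂ))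
    simp at this
  have hdvd : ∀ i : Fin 2, Associated (MvPowerSeries.X i) f := by
    intro i
    obtain ⟨u, hu⟩ := hassoc i
    obtain ⟨q, hq⟩ := X_dvd_of_map_residue_eq_zero u i hu f (H _)
    have := (hf.isUnit_or_isUnit hq).resolve_left (hX i)
    exact ⟨this.unit, by rw [IsUnit.unit_spec, hq]⟩
  have h01 := ((hdvd 1).trans (hdvd 0).symm).dvd
  rw [MvPowerSeries.X_dvd_iff] at h01
  have := h01 (Finsupp.single 0 1) (by simp)
  rw [MvPowerSeries.coeff_index_single_self_X] at this
  exact one_ne_zero this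

theorem exists_ringEquiv_of_isWeierstrassFactorization {A : Type*} [CommRing A] [IsLocalRing A]
    [IsAdicComplete (IsLocalRing.maximalIdeal A) A] {p : PowerSeries A} {P : Polynomial A}
    {h : PowerSeries A} (H : p.IsWeierstrassFactorization P h) :
    ∃ e : (Polynomial A ⧸ Ideal.span {P}) ≃+* (PowerSeries A ⧸ Ideal.span {p}),
      ∀ a, e (algebraMap A _ a) = Ideal.Quotient.mk _ (PowerSeries.C a) :=
  ⟨H.algEquivQuotient.toRingEquiv, fun a => H.algEquivQuotient.commutes a⟩

/-- By Weierstrass preparation the local ring of the branch is `ℂ⟦x⟧[y] / (P)` with `P` monic and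
nonconstant, a finite extension domain of `ℂ⟦x⟧`; the colength valuation of such rings applies. -/
theorem exists_branchValuation (f : MvPowerSeries (Fin 2) ℂ) (hf : Irreducible f) :
    ∃ v : MvPowerSeries (Fin 2) ℂ → ℕ∞, IsColengthValuation v ∧
      (∀ h, v h = ⊤ ↔ h ∈ Ideal.span {f}) ∧
      ∀ h, h ∉ Ideal.span {f} → v h = intersectionNumber f h := by
  obtain ⟨E, hE⟩ := exists_iteratedPowerSeriesEquiv f hf
  have hmax : IsAdicComplete (IsLocalRing.maximalIdeal (PowerSeries ℂ)) (PowerSeries ℂ) := by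
    rw [PowerSeries.maximalIdeal_eq_span_X]; infer_instance
  let J : Ideal (PowerSeries (PowerSeries ℂ)) := Ideal.span {E f}
  have hirr : Irreducible (E f) := (MulEquiv.irreducible_iff E).2 hf
  have hprime : J.IsPrime := (Ideal.span_singleton_prime hirr.ne_zero).2 hirr.prime
  obtain ⟨P, h, H⟩ := PowerSeries.exists_isWeierstrassFactorization hE
  have hPmon : P.Monic := H.isDistinguishedAt.monic
  let O := Polynomial (PowerSeries ℂ) ⧸ Ideal.span {P}
  obtain ⟨e, he⟩ := exists_ringEquiv_of_isWeierstrassFactorization H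
  let eC : O ≃ₐ[ℂ] PowerSeries (PowerSeries ℂ) ⧸ J :=
    AlgEquiv.ofRingEquiv (f := e) fun c => by
      rw [IsScalarTower.algebraMap_apply ℂ (PowerSeries ℂ) O, he,
        IsScalarTower.algebraMap_apply ℂ (PowerSeries (PowerSeries ℂ)) (_ ⧸ J),
        Ideal.Quotient.algebraMap_eq, PowerSeries.algebraMap_apply (A := PowerSeries ℂ)]
  have : IsDomain O := eC.toMulEquiv.isDomain _
  have : Module.Finite (PowerSeries ℂ) O := hPmon.finite_quotient
  have hPdeg : P.degree ≠ 0 := by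
    intro h0
    have hP1 : P = 1 := hPmon.degree_le_zero_iff_eq_one.1 h0.le
    have := H.eq_mul
    rw [hP1, Polynomial.coe_one, one_mul] at this
    exact hirr.not_isUnit (this ▸ H.isUnit)
  have : FaithfulSMul (PowerSeries ℂ) O :=
    (faithfulSMul_iff_algebraMap_injective _ _).2
      (AdjoinRoot.of.injective_of_degree_ne_zero hPdeg)
  obtain ⟨v, hv, hv0, hvlen⟩ := exists_colengthValuation O
  let q : MvPowerSeries (Fin 2) ℂ →ₐ[ℂ] O :=
    eC.symm.toAlgHom.comp ((Ideal.Quotient.mkₐ ℂ J).comp E.toAlgHom)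
  have hqe : ∀ h, eC (q h) = Ideal.Quotient.mk J (E h) := fun h => eC.apply_symm_apply _
  have hq0 : ∀ h, q h = 0 ↔ h ∈ Ideal.span {f} := by
    intro h
    rw [← map_eq_zero_iff eC eC.injective, hqe,
      Ideal.Quotient.eq_zero_iff_mem, Ideal.mem_span_singleton, Ideal.mem_span_singleton]
    exact map_dvd_iff E
  refine ⟨fun h => v (q h), ⟨?_, ?_, ?_, ?_⟩, ?_, ?_⟩
  · intro x y; rw [map_mul, hv.map_mul]
  · intro x y; rw [map_add]; exact hv.min_le_add _ _
  · intro x y hx hxy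
    obtain ⟨c, hc⟩ := hv.exists_lt_sub _ _ hx hxy
    exact ⟨c, by rwa [map_sub, map_smul]⟩
  · simp only [map_zero, hv.map_zero]
  · intro h; rw [hv0, hq0]
  · intro h hh
    change v (q h) = _
    rw [hvlen _ (by rwa [ne_eq, hq0]), intersectionNumber]
    have e1 : (MvPowerSeries (Fin 2) ℂ ⧸ Ideal.span {f, h}) ≃ₐ[ℂ]
        (PowerSeries (PowerSeries ℂ) ⧸ (J ⊔ Ideal.span {E h})) :=
      Ideal.quotientEquivAlg _ _ E (by
        rw [Ideal.map_span, ← Ideal.span_union]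
        congr 1
        ext x
        simp [eq_comm, or_comm])
    have e3 : (O ⧸ Ideal.span {q h}) ≃ₐ[ℂ]
        ((PowerSeries (PowerSeries ℂ) ⧸ J) ⧸ Ideal.span {Ideal.Quotient.mk J (E h)}) :=
      Ideal.quotientEquivAlg _ _ eC (by
        rw [Ideal.map_span, Set.image_singleton]
        congr 2
        exact (hqe h).symm)
    have e2 : ((PowerSeries (PowerSeries ℂ) ⧸ J) ⧸ Ideal.span {Ideal.Quotient.mk J (E h)}) ≃ₐ[ℂ]
        (PowerSeries (PowerSeries ℂ) ⧸ (J ⊔ Ideal.span {E h})) :=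
      (Ideal.quotientEquivAlgOfEq ℂ (by
        rw [Ideal.map_span, Set.image_singleton]; rfl)).trans
        (DoubleQuot.quotQuotEquivQuotSupₐ ℂ J (Ideal.span {E h}))
    rw [LinearEquiv.finrank_eq e1.toLinearEquiv, LinearEquiv.finrank_eq e3.toLinearEquiv,
      LinearEquiv.finrank_eq e2.toLinearEquiv]

end

/-! ### Arithmetic of minimal generators -/

section Numerics

variable {g : ℕ} {β : ℕ → ℕ} {b : ℕ → ℕ → ℕ}

theorem e_zero (β : ℕ → ℕ) : e β 0 = β 0 := by simp [e]

theorem e_succ (β : ℕ → ℕ) (i : ℕ) : e β (i + 1) = Nat.gcd (β (i + 1)) (e β i) := by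
  rw [e, Finset.range_add_one, Finset.gcd_insert]
  rfl

theorem e_dvd (β : ℕ → ℕ) {i j : ℕ} (h : j ≤ i) : e β i ∣ β j :=
  Finset.gcd_dvd (Finset.mem_range.2 (by omega))

theorem e_succ_dvd (β : ℕ → ℕ) (i : ℕ) : e β (i + 1) ∣ e β i := by
  rw [e_succ]; exact Nat.gcd_dvd_right _ _

theorem n_mul_e (β : ℕ → ℕ) (b : ℕ → ℕ → ℕ) (i : ℕ) : n β b (i + 1) * e β (i + 1) = e β i :=
  Nat.div_mul_cancel (e_succ_dvd β i)

theorem e_pos (h : 0 < β 0) (i : ℕ) : 0 < e β i := by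
  refine Nat.pos_of_ne_zero fun h0 => ?_
  have := e_dvd β (Nat.zero_le i)
  rw [h0, zero_dvd_iff] at this
  omega

theorem coprime_n (b : ℕ → ℕ → ℕ) (h : 0 < β 0) (i : ℕ) :
    Nat.Coprime (n β b (i + 1)) (β (i + 1) / e β (i + 1)) := by
  have := Nat.coprime_div_gcd_div_gcd (m := β (i + 1)) (n := e β i)
    (by rw [← e_succ]; exact e_pos h _)
  rw [← e_succ] at this
  exact this.symm

/-- If `e (i) ∣ c * β (i + 1)`, then `n (i + 1) ∣ c`. -/
theorem n_dvd_of_e_dvd_mul (b : ℕ → ℕ → ℕ) (h : 0 < β 0) {i c : ℕ} (hc : e β i ∣ c * β (i + 1)) :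
    n β b (i + 1) ∣ c := by
  have h1 : β (i + 1) = β (i + 1) / e β (i + 1) * e β (i + 1) :=
    (Nat.div_mul_cancel (e_dvd β le_rfl)).symm
  rw [← n_mul_e β b, h1, ← mul_assoc] at hc
  exact (coprime_n b h i).dvd_of_dvd_mul_right (Nat.dvd_of_mul_dvd_mul_right (e_pos h _) hc)

/-- The numerical properties of the semigroup of a plane branch. -/
structure IsBranchData (g : ℕ) (β : ℕ → ℕ) (b : ℕ → ℕ → ℕ) : Prop where
  one_le : 1 ≤ g
  pos : 0 < β 0
  lt : β 0 < β 1
  two_le : ∀ i, 1 ≤ i → i ≤ g → 2 ≤ n β b i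
  sys : IsExponentSystem g β b
  inc : ∀ i, 1 ≤ i → i < g → n β b i * β i < β (i + 1)

theorem IsMinimalGenerators.pos {Γ : Set ℕ} (hβ : IsMinimalGenerators Γ g β) {i : ℕ} (hi : i ≤ g) :
    0 < β i := by
  refine Nat.pos_of_ne_zero fun h0 => hβ.minimal i hi ?_
  rw [h0]; exact zero_mem _

theorem IsMinimalGenerators.ne_sum {Γ : Set ℕ} (hβ : IsMinimalGenerators Γ g β) {i : ℕ}
    (hi : i ≤ g) (a : ℕ → ℕ) : β i ≠ ∑ j ∈ Finset.range i, a j * β j := by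
  intro h
  refine hβ.minimal i hi ?_
  rw [h]
  refine sum_mem fun j hj => ?_
  have hj := Finset.mem_range.1 hj
  have hmem : β j ∈ AddSubmonoid.closure (β '' (Set.Iic g \ {i})) := by
    refine AddSubmonoid.subset_closure (Set.mem_image_of_mem β ⟨?_, ?_⟩)
    · simp only [Set.mem_Iic]; omega
    · simp only [Set.mem_singleton_iff]; omega
  exact nsmul_mem hmem (a j)

/-- With `n_i = 1` the exponent system would write `β_i` through the preceding generators. -/
theorem IsMinimalGenerators.two_le_n {Γ : Set ℕ} (hβ : IsMinimalGenerators Γ g β)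
    (hb : IsExponentSystem g β b) {i : ℕ} (h1 : 1 ≤ i) (hi : i ≤ g) : 2 ≤ n β b i := by
  obtain ⟨i, rfl⟩ : ∃ j, i = j + 1 := ⟨i - 1, by omega⟩
  by_contra hlt
  have h0 : n β b (i + 1) ≠ 0 := by
    intro h
    have := n_mul_e β b i
    rw [h, zero_mul] at this
    exact (e_pos (hβ.pos (Nat.zero_le g)) i).ne this
  have := (hb (i + 1) h1 hi).2
  rw [show n β b (i + 1) = 1 by omega, one_mul] at this
  exact hβ.ne_sum hi _ this

/-- A sum of generators either uses one of index above `i`, and is then at least `β (i + 1)`, or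
uses only the first `i + 1`. -/
theorem IsMinimalGenerators.le_or_eq_sum {Γ : Set ℕ} (hβ : IsMinimalGenerators Γ g β) (i : ℕ)
    {k : ℕ} (hk : k ∈ Γ) :
    (i + 1 ≤ g → β (i + 1) ≤ k) ∨ ∃ a : ℕ → ℕ, k = ∑ j ∈ Finset.range (i + 1), a j * β j := by
  rw [← hβ.generates, SetLike.mem_coe] at hk
  induction hk using AddSubmonoid.closure_induction with
  | mem x hx =>
    obtain ⟨j, hj, rfl⟩ := hx
    by_cases hji : j < i + 1
    · right
      refine ⟨Pi.single j 1, ?_⟩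
      rw [Finset.sum_eq_single_of_mem j (Finset.mem_range.2 hji)]
      · simp
      · intro c _ hc; simp [hc]
    · left
      intro hi
      exact hβ.strictMono.monotoneOn (Set.mem_Iic.2 hi) hj (by omega)
  | zero => right; exact ⟨0, by simp⟩
  | add x y _ _ hx hy =>
    rcases hx with hx | ⟨a, rfl⟩
    · left; intro hi; exact (hx hi).trans (Nat.le_add_right _ _)
    rcases hy with hy | ⟨a', rfl⟩
    · left; intro hi; exact (hy hi).trans (Nat.le_add_left _ _)
    right
    exact ⟨a + a', by simp [add_mul, Finset.sum_add_distrib]⟩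

end Numerics

/-! ### The filtration by weights of monomials -/

section WeightFiltration

variable {R : Type*} [CommRing R]

/-- The weight of the monomial with exponents `a 0, …, a (k - 1)`. -/
def weight (k : ℕ) (w a : ℕ → ℕ) : ℕ := ∑ j ∈ Finset.range k, a j * w j

/-- The monomial with exponents `a 0, …, a (k - 1)` in the elements `h 0, …, h (k - 1)`. -/
def mono (k : ℕ) (h : ℕ → R) (a : ℕ → ℕ) : R := ∏ j ∈ Finset.range k, h j ^ a j

/-- The ideal generated by the monomials of weight at least `N`. -/
def weightIdeal (k : ℕ) (w : ℕ → ℕ) (h : ℕ → R) (N : ℕ) : Ideal R :=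
  Ideal.span {z | ∃ a, N ≤ weight k w a ∧ z = mono k h a}

variable {k : ℕ} {w : ℕ → ℕ} {h : ℕ → R}

theorem weight_add (a a' : ℕ → ℕ) : weight k w (a + a') = weight k w a + weight k w a' := by
  simp [weight, add_mul, Finset.sum_add_distrib]

theorem mono_add (a a' : ℕ → ℕ) : mono k h (a + a') = mono k h a * mono k h a' := by
  simp [mono, pow_add, Finset.prod_mul_distrib]

theorem weight_single {j : ℕ} (hj : j < k) (c : ℕ) : weight k w (Pi.single j c) = c * w j := by
  rw [weight, Finset.sum_eq_single_of_mem j (Finset.mem_range.2 hj)]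
  · simp
  · intro i _ hi; simp [hi]

theorem mono_single {j : ℕ} (hj : j < k) (c : ℕ) : mono k h (Pi.single j c) = h j ^ c := by
  rw [mono, Finset.prod_eq_single_of_mem j (Finset.mem_range.2 hj)]
  · simp
  · intro i _ hi; simp [hi]

/-- The exponents `a` cut off at `k`. -/
def cut (k : ℕ) (a : ℕ → ℕ) (j : ℕ) : ℕ := if j < k then a j else 0

theorem weight_cut {k' : ℕ} (hk : k' ≤ k) (a : ℕ → ℕ) : weight k w (cut k' a) = weight k' w a := by
  rw [weight, weight, ← Finset.sum_subset (Finset.range_mono hk)]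
  · exact Finset.sum_congr rfl fun j hj => by rw [cut, if_pos (Finset.mem_range.1 hj)]
  · intro j _ hj
    rw [cut, if_neg (by simpa using hj), zero_mul]

theorem mono_cut {k' : ℕ} (hk : k' ≤ k) (a : ℕ → ℕ) : mono k h (cut k' a) = mono k' h a := by
  rw [mono, mono, ← Finset.prod_subset (Finset.range_mono hk)]
  · exact Finset.prod_congr rfl fun j hj => by rw [cut, if_pos (Finset.mem_range.1 hj)]
  · intro j _ hj
    rw [cut, if_neg (by simpa using hj), pow_zero]

theorem mono_mem {N : ℕ} {a : ℕ → ℕ} (ha : N ≤ weight k w a) : mono k h a ∈ weightIdeal k w h N :=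
  Ideal.subset_span ⟨a, ha, rfl⟩

theorem mono_mem_of_le {k' N : ℕ} (hk : k' ≤ k) {a : ℕ → ℕ} (ha : N ≤ weight k' w a) :
    mono k' h a ∈ weightIdeal k w h N := by
  rw [← mono_cut hk]; exact mono_mem (by rwa [weight_cut hk])

theorem weightIdeal_le_of_eqOn {k' : ℕ} (hk : k' ≤ k) {w' : ℕ → ℕ} {h' : ℕ → R}
    (hw : ∀ j < k', w' j = w j) (hh : ∀ j < k', h' j = h j) (N : ℕ) :
    weightIdeal k' w' h' N ≤ weightIdeal k w h N := by
  rw [weightIdeal, Ideal.span_le]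
  rintro _ ⟨a, ha, rfl⟩
  have h1 : mono k' h' a = mono k' h a :=
    Finset.prod_congr rfl fun j hj => by rw [hh j (Finset.mem_range.1 hj)]
  have h2 : weight k' w' a = weight k' w a :=
    Finset.sum_congr rfl fun j hj => by rw [hw j (Finset.mem_range.1 hj)]
  rw [h1]
  rw [h2] at ha
  exact mono_mem_of_le hk ha

theorem weightIdeal_mul_le (N N' : ℕ) :
    weightIdeal k w h N * weightIdeal k w h N' ≤ weightIdeal k w h (N + N') := by
  rw [weightIdeal, weightIdeal, Ideal.span_mul_span', Ideal.span_le]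
  rintro _ ⟨_, ⟨a, ha, rfl⟩, _, ⟨a', ha', rfl⟩, rfl⟩
  simp only [← mono_add]
  exact mono_mem (by rw [weight_add]; omega)

theorem mul_mem_weightIdeal {N N' : ℕ} {x y : R} (hx : x ∈ weightIdeal k w h N)
    (hy : y ∈ weightIdeal k w h N') : x * y ∈ weightIdeal k w h (N + N') :=
  weightIdeal_mul_le _ _ (Ideal.mul_mem_mul hx hy)

variable [Algebra ℂ R]

/-- Coefficients may be replaced by their residues in `ℂ`: the difference lies in `m` and raises the
weight by at least one. -/
theorem exists_leading_part {m : Ideal R} (hm : m ≤ weightIdeal k w h 1)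
    (hres : ∀ r : R, ∃ c : ℂ, r - algebraMap ℂ R c ∈ m) {N : ℕ} {z : R}
    (hz : z ∈ weightIdeal k w h N) :
    ∃ s ∈ Submodule.span ℂ {z | ∃ a, weight k w a = N ∧ z = mono k h a},
      z - s ∈ weightIdeal k w h (N + 1) := by
  rw [weightIdeal] at hz
  induction hz using Submodule.span_induction with
  | mem z hz =>
    obtain ⟨a, ha, rfl⟩ := hz
    rcases ha.eq_or_lt with ha | ha
    · exact ⟨_, Submodule.subset_span ⟨a, ha.symm, rfl⟩, by simp⟩
    · exact ⟨0, zero_mem _, by rw [sub_zero]; exact mono_mem ha⟩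
  | zero => exact ⟨0, zero_mem _, by simp⟩
  | add x y _ _ hx hy =>
    obtain ⟨s, hs, hs'⟩ := hx
    obtain ⟨t, ht, ht'⟩ := hy
    exact ⟨s + t, add_mem hs ht, by rw [add_sub_add_comm]; exact add_mem hs' ht'⟩
  | smul r z hz ih =>
    obtain ⟨s, hs, hs'⟩ := ih
    obtain ⟨c, hc⟩ := hres r
    refine ⟨c • s, Submodule.smul_mem _ _ hs, ?_⟩
    have h1 : r • z - c • s = (r - algebraMap ℂ R c) * z + algebraMap ℂ R c * (z - s) := by
      rw [Algebra.smul_def c s, smul_eq_mul]; ring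
    rw [h1]
    refine add_mem ?_ (Ideal.mul_mem_left _ _ hs')
    rw [add_comm N 1]
    exact mul_mem_weightIdeal (hm hc) hz

variable {v : R → ℕ∞}

theorem IsColengthValuation.map_algebraMap (hv : IsColengthValuation v) (h1 : v 1 = 0) {c : ℂ}
    (hc : c ≠ 0) : v (algebraMap ℂ R c) = 0 := by
  have : v (algebraMap ℂ R c) + v (algebraMap ℂ R c⁻¹) = 0 := by
    rw [← hv.map_mul, ← RingHom.map_mul, mul_inv_cancel₀ hc, map_one, h1]
  exact (add_eq_zero.1 this).1

theorem IsColengthValuation.map_smul (hv : IsColengthValuation v) (h1 : v 1 = 0) {c : ℂ}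
    (hc : c ≠ 0) (x : R) : v (c • x) = v x := by
  rw [Algebra.smul_def, hv.map_mul, hv.map_algebraMap h1 hc, zero_add]

theorem IsColengthValuation.map_neg (hv : IsColengthValuation v) (h1 : v 1 = 0) (x : R) :
    v (-x) = v x := by
  have := hv.map_smul h1 (c := -1) (by norm_num) x
  rwa [neg_one_smul] at this

theorem IsColengthValuation.min_le_sub (hv : IsColengthValuation v) (h1 : v 1 = 0) (x y : R) :
    min (v x) (v y) ≤ v (x - y) := by
  rw [sub_eq_add_neg, ← hv.map_neg h1 y]
  exact hv.min_le_add _ _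

theorem IsColengthValuation.map_eq_of_lt_sub (hv : IsColengthValuation v) (h1 : v 1 = 0) {x y : R}
    (h : v y < v (x - y)) : v x = v y := by
  apply le_antisymm
  · by_contra hlt
    rw [not_le] at hlt
    have := hv.min_le_sub h1 x (x - y)
    rw [sub_sub_cancel] at this
    exact absurd (lt_of_lt_of_le (lt_min hlt h) this) (lt_irrefl _)
  · have := hv.min_le_add y (x - y)
    rw [add_sub_cancel, min_eq_left h.le] at this
    exact this

theorem IsColengthValuation.map_pow (hv : IsColengthValuation v) (h1 : v 1 = 0) (x : R) (j : ℕ) :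
    v (x ^ j) = j * v x := by
  induction j with
  | zero => simp [h1]
  | succ j ih => rw [pow_succ, hv.map_mul, ih]; push_cast; ring

theorem IsColengthValuation.map_mono (hv : IsColengthValuation v) (h1 : v 1 = 0) {k : ℕ}
    (hw : ∀ j < k, v (h j) = w j) (a : ℕ → ℕ) : v (mono k h a) = weight k w a := by
  induction k with
  | zero => simp [mono, weight, h1]
  | succ k ih =>
    have := ih fun j hj => hw j (by omega)
    rw [mono, weight] at this ⊢
    rw [Finset.prod_range_succ, Finset.sum_range_succ, hv.map_mul, this, hv.map_pow h1,
      hw k (by omega)]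
    push_cast; rfl

theorem IsColengthValuation.le_map_mono (hv : IsColengthValuation v) (h1 : v 1 = 0) {k : ℕ}
    (hw : ∀ j < k, (w j : ℕ∞) ≤ v (h j)) (a : ℕ → ℕ) : (weight k w a : ℕ∞) ≤ v (mono k h a) := by
  induction k with
  | zero => simp [mono, weight]
  | succ k ih =>
    have := ih fun j hj => hw j (by omega)
    rw [mono, weight] at this ⊢
    rw [Finset.prod_range_succ, Finset.sum_range_succ, hv.map_mul, hv.map_pow h1]
    push_cast at this ⊢
    gcongr
    exact hw k (by omega)

theorem IsColengthValuation.le_of_mem (hv : IsColengthValuation v) (h1 : v 1 = 0)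
    (hw : ∀ j < k, (w j : ℕ∞) ≤ v (h j)) {N : ℕ} {z : R} (hz : z ∈ weightIdeal k w h N) :
    (N : ℕ∞) ≤ v z := by
  rw [weightIdeal] at hz
  induction hz using Submodule.span_induction with
  | mem z hz =>
    obtain ⟨a, ha, rfl⟩ := hz
    exact (Nat.cast_le.2 ha).trans (hv.le_map_mono h1 hw a)
  | zero => rw [hv.map_zero]; exact le_top
  | add x y _ _ hx hy => exact (le_min hx hy).trans (hv.min_le_add _ _)
  | smul r z _ hz =>
    rw [smul_eq_mul, hv.map_mul]
    exact hz.trans (self_le_add_left _ _)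

/-- If monomials of equal weight `N < γ` are proportional up to higher weight, an element whose
value is not the weight of a monomial of weight less than `γ` has weight at least `γ`. -/
theorem IsColengthValuation.mem_weightIdeal (hv : IsColengthValuation v) (h1 : v 1 = 0)
    {m : Ideal R} (hm : m ≤ weightIdeal k w h 1)
    (hres : ∀ r : R, ∃ c : ℂ, r - algebraMap ℂ R c ∈ m)
    (hw : ∀ j < k, (w j : ℕ∞) ≤ v (h j)) {γ : ℕ}
    (hprop : ∀ a a', weight k w a < γ → weight k w a = weight k w a' →
      ∃ c : ℂ, mono k h a - c • mono k h a' ∈ weightIdeal k w h (weight k w a + 1))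
    (hval : ∀ a, weight k w a < γ → v (mono k h a) = weight k w a)
    {z : R} (hz : ∀ a, weight k w a < γ → v z ≠ weight k w a) :
    z ∈ weightIdeal k w h γ := by
  suffices H : ∀ N, N ≤ γ → z ∈ weightIdeal k w h N from H γ le_rfl
  intro N
  induction N with
  | zero =>
    intro _
    have : (1 : R) ∈ weightIdeal k w h 0 := by
      have := mono_mem (k := k) (w := w) (h := h) (N := 0) (a := 0) (Nat.zero_le _)
      simpa [mono] using this
    rw [(Ideal.eq_top_iff_one _).2 this]
    trivial
  | succ N ih =>
    intro hN
    obtain ⟨s, hs, hs'⟩ := exists_leading_part hm hres (ih (by omega))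
    suffices hs2 : s ∈ weightIdeal k w h (N + 1) by
      have := add_mem hs' hs2
      rwa [sub_add_cancel] at this
    by_cases hex : ∃ a, weight k w a = N
    · obtain ⟨a, ha⟩ := hex
      have hsa : ∃ c : ℂ, s - c • mono k h a ∈ weightIdeal k w h (N + 1) := by
        clear hs'
        induction hs using Submodule.span_induction with
        | mem s hs =>
          obtain ⟨a', ha', rfl⟩ := hs
          have := hprop a' a (by omega) (by omega)
          rwa [ha'] at this
        | zero => exact ⟨0, by simp⟩
        | add x y _ _ hx hy =>
          obtain ⟨c, hc⟩ := hx
          obtain ⟨c', hc'⟩ := hy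
          exact ⟨c + c', by rw [add_smul, add_sub_add_comm]; exact add_mem hc hc'⟩
        | smul c x _ hx =>
          obtain ⟨c', hc'⟩ := hx
          exact ⟨c * c', by
            rw [mul_smul, ← smul_sub, Algebra.smul_def]; exact Ideal.mul_mem_left _ _ hc'⟩
      obtain ⟨c, hc⟩ := hsa
      -- Modulo higher weight the leading part is `c` times one monomial of weight `N`. If `c ≠ 0`,
      -- then `z` has value exactly `N < γ`, which is excluded.
      by_cases hc0 : c = 0
      · rwa [hc0, zero_smul, sub_zero] at hc
      exfalso
      have h2 : z - c • mono k h a ∈ weightIdeal k w h (N + 1) := by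
        have := add_mem hs' hc
        rwa [sub_add_sub_cancel] at this
      have h3 := hv.le_of_mem h1 hw h2
      have h4 : v (c • mono k h a) = N := by
        rw [hv.map_smul h1 hc0, hval a (by omega), ha]
      refine hz a (by omega) ?_
      rw [ha, ← h4]
      apply hv.map_eq_of_lt_sub h1
      rw [h4]
      exact lt_of_lt_of_le (by exact_mod_cast Nat.lt_succ_self N) h3
    · have : s = 0 := by
        have hempty : {z | ∃ a, weight k w a = N ∧ z = mono k h a} = (∅ : Set R) := by
          ext z
          simp only [Set.mem_ofPred_eq, Set.mem_empty_iff_false, iff_false]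
          rintro ⟨a, ha, _⟩
          exact hex ⟨a, ha⟩
        rw [hempty, Submodule.span_empty] at hs
        exact (Submodule.mem_bot ℂ).1 hs
      rw [this]; exact zero_mem _

end WeightFiltration

/-! ### Monomials of equal weight are proportional up to higher weight -/

section Proportional

variable {R : Type*} [CommRing R] [Algebra ℂ R] {I J : Ideal R} {x y z : R}

/-- `x` is a nonzero scalar multiple of `y` modulo `I`. -/
def Proportional (I : Ideal R) (x y : R) : Prop := ∃ c : ℂ, c ≠ 0 ∧ x - c • y ∈ I

theorem Proportional.refl (I : Ideal R) (x : R) : Proportional I x x :=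
  ⟨1, one_ne_zero, by simp⟩

theorem smul_mem_ideal (c : ℂ) (hx : x ∈ I) : c • x ∈ I := by
  rw [Algebra.smul_def]; exact Ideal.mul_mem_left _ _ hx

theorem Proportional.symm (h : Proportional I x y) : Proportional I y x := by
  obtain ⟨c, hc, h⟩ := h
  refine ⟨c⁻¹, inv_ne_zero hc, ?_⟩
  have := smul_mem_ideal (-c⁻¹) h
  rwa [smul_sub, neg_smul, neg_smul, inv_smul_smul₀ hc, sub_neg_eq_add, neg_add_eq_sub] at this

theorem Proportional.trans (h : Proportional I x y) (h' : Proportional I y z) :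
    Proportional I x z := by
  obtain ⟨c, hc, h⟩ := h
  obtain ⟨c', hc', h'⟩ := h'
  refine ⟨c * c', mul_ne_zero hc hc', ?_⟩
  have := add_mem h (smul_mem_ideal c h')
  rwa [smul_sub, sub_add_sub_cancel, smul_smul] at this

theorem Proportional.mono (h : Proportional I x y) (hIJ : I ≤ J) : Proportional J x y := by
  obtain ⟨c, hc, h⟩ := h
  exact ⟨c, hc, hIJ h⟩

theorem Proportional.mul_right {k : ℕ} {w : ℕ → ℕ} {h : ℕ → R} {N N' : ℕ}
    (hxy : Proportional (weightIdeal k w h N) x y) (hz : z ∈ weightIdeal k w h N') :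
    Proportional (weightIdeal k w h (N + N')) (x * z) (y * z) := by
  obtain ⟨c, hc, hxy⟩ := hxy
  refine ⟨c, hc, ?_⟩
  rw [← smul_mul_assoc, ← sub_mul]
  exact mul_mem_weightIdeal hxy hz

/-- Each relation trades `h_j ^ n_j` for a monomial of the same weight in earlier elements. Once the
exponent of the last element is below `n_j`, the weight determines it, and the comparison descends
to fewer elements. -/
theorem proportional_mono {k : ℕ} {w : ℕ → ℕ} {h : ℕ → R} {i : ℕ} (hik : i + 1 ≤ k)
    {n : ℕ → ℕ} {b : ℕ → ℕ → ℕ} (hn : ∀ j, 1 ≤ j → j ≤ i → 1 ≤ n j)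
    (hrel : ∀ j, 1 ≤ j → j ≤ i →
      Proportional (weightIdeal k w h (n j * w j + 1)) (h j ^ n j) (mono j h (b j)))
    (hwt : ∀ j, 1 ≤ j → j ≤ i → n j * w j = weight j w (b j))
    (h0 : 0 < w 0)
    (hcop : ∀ j, 1 ≤ j → j ≤ i → ∀ a a', weight (j + 1) w a = weight (j + 1) w a' →
      a j < n j → a' j < n j → a j = a' j) :
    ∀ j ≤ i, ∀ a a', weight (j + 1) w a = weight (j + 1) w a' →
      Proportional (weightIdeal k w h (weight (j + 1) w a + 1)) (mono (j + 1) h a)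
        (mono (j + 1) h a') := by
  intro j
  induction j with
  | zero =>
    intro _ a a' haa
    simp only [weight, zero_add, Finset.sum_range_one] at haa
    have := Nat.eq_of_mul_eq_mul_right h0 haa
    simp only [mono, zero_add, Finset.prod_range_one, this]
    exact .refl _ _
  | succ j ih =>
    intro hj a a' haa
    change weight (j + 2) w a = weight (j + 2) w a' at haa
    have hred : ∀ s, ∀ a, a (j + 1) = s → ∃ a', a' (j + 1) < n (j + 1) ∧
        weight (j + 2) w a = weight (j + 2) w a' ∧
        Proportional (weightIdeal k w h (weight (j + 2) w a + 1)) (mono (j + 2) h a)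
          (mono (j + 2) h a') := by
      intro s
      induction s using Nat.strong_induction_on with
      | _ s ihs =>
        intro a has
        by_cases hs : a (j + 1) < n (j + 1)
        · exact ⟨a, hs, rfl, .refl _ _⟩
        rw [not_lt] at hs
        have hn1 := hn (j + 1) (by omega) hj
        obtain ⟨a₁, ha₁⟩ : ∃ a₁ : ℕ → ℕ,
            a = (Pi.single (j + 1) (n (j + 1)) : ℕ → ℕ) + a₁ := by
          refine ⟨a - (Pi.single (j + 1) (n (j + 1)) : ℕ → ℕ), ?_⟩
          funext p
          change a p = (Pi.single (j + 1) (n (j + 1)) : ℕ → ℕ) p +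
            (a p - (Pi.single (j + 1) (n (j + 1)) : ℕ → ℕ) p)
          by_cases hp : p = j + 1
          · rw [hp, Pi.single_eq_same]; omega
          · rw [Pi.single_eq_of_ne hp]; omega
        have hw2 : weight (j + 2) w (cut (j + 1) (b (j + 1)) + a₁) = weight (j + 2) w a := by
          rw [ha₁, weight_add, weight_add, weight_single (by omega), weight_cut (by omega),
            hwt (j + 1) (by omega) hj]
        -- The substituted monomial does not involve `h (j + 1)`, so this exponent drops by exactly
        -- `n (j + 1) ≥ 1`.
        obtain ⟨a', h1, h2, h3⟩ := ihs ((cut (j + 1) (b (j + 1)) + a₁) (j + 1)) (by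
          rw [← has, ha₁]; simp [cut]; omega) _ rfl
        refine ⟨a', h1, hw2.symm.trans h2, ?_⟩
        rw [hw2] at h3
        refine Proportional.trans ?_ h3
        have hr := (hrel (j + 1) (by omega) hj).mul_right (z := mono (j + 2) h a₁)
          (N' := weight (j + 2) w a₁) (mono_mem_of_le (by omega) le_rfl)
        rw [mono_add, mono_cut (by omega)]
        convert! hr using 1
        · rw [ha₁, weight_add, weight_single (by omega)]; congr 1; ring
        · rw [ha₁, mono_add, mono_single (by omega)]
    obtain ⟨c, hc1, hc2, hc3⟩ := hred _ a rfl
    obtain ⟨c', hc1', hc2', hc3'⟩ := hred _ a' rfl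
    have hcc : c (j + 1) = c' (j + 1) :=
      hcop (j + 1) (by omega) hj c c'
        (show weight (j + 2) w c = weight (j + 2) w c' by omega) hc1 hc1'
    refine hc3.trans (Proportional.trans ?_ (haa ▸ hc3'.symm))
    have hwc : weight (j + 1) w c = weight (j + 1) w c' := by
      have h1 : weight (j + 2) w c = weight (j + 2) w c' := by omega
      rw [weight, weight, Finset.sum_range_succ, Finset.sum_range_succ _ (j + 1), hcc] at h1
      exact Nat.add_right_cancel h1
    have hh := (ih (by omega) c c' hwc).mul_right (z := h (j + 1) ^ c (j + 1))
      (N' := c (j + 1) * w (j + 1)) (by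
        have := mono_mem (k := k) (w := w) (h := h) (a := Pi.single (j + 1) (c (j + 1)))
          (N := c (j + 1) * w (j + 1)) (by rw [weight_single (by omega)])
        rwa [mono_single (by omega)] at this)
    have e1 : mono (j + 2) h c = mono (j + 1) h c * h (j + 1) ^ c (j + 1) :=
      Finset.prod_range_succ _ _
    have e2 : mono (j + 2) h c' = mono (j + 1) h c' * h (j + 1) ^ c (j + 1) := by
      rw [hcc]; exact Finset.prod_range_succ _ _
    have e3 : weight (j + 2) w a + 1 = weight (j + 1) w c + 1 + c (j + 1) * w (j + 1) := by
      rw [hc2]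
      have : weight (j + 2) w c = weight (j + 1) w c + c (j + 1) * w (j + 1) :=
        Finset.sum_range_succ _ _
      omega
    rw [e1, e2, e3]
    exact hh

end Proportional

/-- All weights of lower monomials are multiples of `e (j - 1)`, so `n_j` divides the difference of
the last exponents. -/
theorem eq_of_weight_eq {β : ℕ → ℕ} (b : ℕ → ℕ → ℕ) (h0 : 0 < β 0) {j : ℕ} (hj : 1 ≤ j) {a a' : ℕ → ℕ}
    (haa : weight (j + 1) β a = weight (j + 1) β a') (ha : a j < n β b j) (ha' : a' j < n β b j) :
    a j = a' j := by
  obtain ⟨i, rfl⟩ : ∃ i, j = i + 1 := ⟨j - 1, by omega⟩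
  wlog hle : a (i + 1) ≤ a' (i + 1) generalizing a a'
  · exact (this haa.symm ha' ha (by omega)).symm
  have hd : ∀ a : ℕ → ℕ, e β i ∣ weight (i + 1) β a := fun a =>
    Finset.dvd_sum fun p hp => (e_dvd β (by have := Finset.mem_range.1 hp; omega)).mul_left _
  rw [weight, weight, Finset.sum_range_succ, Finset.sum_range_succ _ (i + 1)] at haa
  obtain ⟨d, hd'⟩ := Nat.exists_eq_add_of_le hle
  have h1 : weight (i + 1) β a = weight (i + 1) β a' + d * β (i + 1) := by
    rw [hd', add_mul] at haa
    change weight (i + 1) β a + _ = weight (i + 1) β a' + _ at haa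
    omega
  have h2 : e β i ∣ d * β (i + 1) := by
    have := hd a
    rw [h1] at this
    exact (Nat.dvd_add_right (hd a')).1 this
  have h3 := n_dvd_of_e_dvd_mul b h0 h2
  have : d = 0 := Nat.eq_zero_of_dvd_of_lt h3 (by omega)
  omega

/-! ### A generating sequence of the valuation and the inequality `n_i β_i < β_{i+1}` -/

section ValueSemigroup

variable {R : Type*} [CommRing R] [Algebra ℂ R] {v : R → ℕ∞} {g : ℕ} {β : ℕ → ℕ}
  {b : ℕ → ℕ → ℕ}

/-- As long as the value is below `β (i + 1)`, it lies in the semigroup of `β 0, …, β i`, so a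
scalar multiple of a monomial of that weight can be subtracted to raise it. -/
theorem exists_approximation (hv : IsColengthValuation v) (h1 : v 1 = 0)
    (hβ : IsMinimalGenerators {k : ℕ | ∃ x, v x = k} g β) {i : ℕ} (hi : i + 1 ≤ g) {h : ℕ → R}
    (hh : ∀ j ≤ i, v (h j) = β j) {y : R} {M : ℕ} (hy : (M : ℕ∞) < v y) :
    ∃ s ∈ weightIdeal (i + 1) β h (M + 1), (M : ℕ∞) < v (y - s) ∧ (β (i + 1) : ℕ∞) ≤ v (y - s) := by
  suffices H : ∀ N ≤ β (i + 1), ∃ s ∈ weightIdeal (i + 1) β h (M + 1),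
      (M : ℕ∞) < v (y - s) ∧ (N : ℕ∞) ≤ v (y - s) from H _ le_rfl
  intro N
  induction N with
  | zero => intro _; exact ⟨0, zero_mem _, by simpa using hy, by simp⟩
  | succ N ih =>
    intro hN
    obtain ⟨s, hs, hM, hs'⟩ := ih (by omega)
    rcases hs'.eq_or_lt with heq | hlt
    · rw [← heq] at hM
      have hM' : M < N := by exact_mod_cast hM
      obtain ⟨a, ha⟩ := (hβ.le_or_eq_sum i (k := N) ⟨_, heq.symm⟩).resolve_left (by
        intro h; have := h hi; omega)
      change N = weight (i + 1) β a at ha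
      have hmono : v (mono (i + 1) h a) = N := by
        rw [ha]; exact hv.map_mono h1 (fun j hj => hh j (by omega)) a
      obtain ⟨c, hc⟩ := hv.exists_lt_sub (y - s) (mono (i + 1) h a)
        (by rw [← heq]; exact ENat.natCast_ne_top N) (by rw [← heq, hmono])
      refine ⟨s + c • mono (i + 1) h a,
        add_mem hs (smul_mem_ideal _ (mono_mem (by omega))), ?_, ?_⟩
      · rw [← sub_sub]; rw [← heq] at hc; exact hM.trans hc
      · rw [← sub_sub]; rw [← heq] at hc
        push_cast
        exact Order.add_one_le_of_lt hc
    · refine ⟨s, hs, hM, ?_⟩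
      push_cast
      exact Order.add_one_le_of_lt hlt

/-- An element of value `β (i + 1)` has no value of a monomial in `h_0, …, h_i`, hence lies in the
weight ideal of level `γ`, which forces `γ ≤ β (i + 1)`. The weight `γ` is only a lower bound for
the value of `h (i + 1)`, which makes the lemma usable before that value is known. -/
theorem next_generator (hv : IsColengthValuation v) (h1 : v 1 = 0)
    (hβ : IsMinimalGenerators {k : ℕ | ∃ x, v x = k} g β) (hb : IsExponentSystem g β b)
    {m : Ideal R} (hres : ∀ r : R, ∃ c : ℂ, r - algebraMap ℂ R c ∈ m)
    {i : ℕ} (hi : i + 1 ≤ g) {h : ℕ → R} (hh : ∀ j ≤ i, v (h j) = β j) {γ : ℕ}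
    (hγ : β (i + 1) ≤ γ) (hγv : (γ : ℕ∞) ≤ v (h (i + 1)))
    (hm : m ≤ weightIdeal (i + 2) (Function.update β (i + 1) γ) h 1)
    (hrel : ∀ j, 1 ≤ j → j ≤ i → Proportional
      (weightIdeal (i + 2) (Function.update β (i + 1) γ) h (n β b j * β j + 1))
      (h j ^ n β b j) (mono j h (b j))) :
    γ = β (i + 1) ∧ v (h (i + 1)) = β (i + 1) := by
  set w := Function.update β (i + 1) γ with hw
  have hwi : w (i + 1) = γ := Function.update_self _ _ _
  have hwj : ∀ j ≤ i, w j = β j := fun j hj => Function.update_of_ne (by omega) _ _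
  have hwt : ∀ k ≤ i + 1, ∀ a, weight k w a = weight k β a := fun k hk a =>
    Finset.sum_congr rfl fun j hj => by rw [hwj j (by have := Finset.mem_range.1 hj; omega)]
  have hβ0 : 0 < β 0 := hβ.pos (Nat.zero_le g)
  have hvw : ∀ j < i + 2, (w j : ℕ∞) ≤ v (h j) := by
    intro j hj
    rcases Nat.lt_or_ge j (i + 1) with hj' | hj'
    · rw [hwj j (by omega), hh j (by omega)]
    · rw [show j = i + 1 by omega, hwi]; exact hγv
  have hsucc : ∀ a, weight (i + 2) w a = weight (i + 1) β a + a (i + 1) * γ := by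
    intro a
    rw [← hwt (i + 1) le_rfl, ← hwi]
    exact Finset.sum_range_succ _ _
  have hsuccm : ∀ a, mono (i + 2) h a = mono (i + 1) h a * h (i + 1) ^ a (i + 1) := fun a =>
    Finset.prod_range_succ _ _
  have hlow : ∀ a, weight (i + 2) w a < γ → a (i + 1) = 0 := by
    intro a ha
    rw [hsucc] at ha
    by_contra h0
    have : γ ≤ a (i + 1) * γ := Nat.le_mul_of_pos_left _ (Nat.pos_of_ne_zero h0)
    omega
  have hprop := proportional_mono (k := i + 2) (w := w) (h := h) (i := i) (n := n β b) (b := b)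
    (by omega) (fun j hj hj' => by
      have := hβ.two_le_n hb hj (by omega); omega)
    (fun j hj hj' => by rw [hwj j hj']; exact hrel j hj hj')
    (fun j hj hj' => by
      rw [hwj j hj', hwt j (by omega)]; exact (hb j hj (by omega)).2)
    (by rw [hwj 0 (by omega)]; exact hβ0)
    (fun j hj hj' a a' haa ha ha' => by
      rw [hwt (j + 1) (by omega), hwt (j + 1) (by omega)] at haa
      exact eq_of_weight_eq b hβ0 hj haa ha ha')
  have hmem : β (i + 1) ∈ {k : ℕ | ∃ x, v x = k} := by
    rw [← hβ.generates]
    exact AddSubmonoid.subset_closure ⟨i + 1, hi, rfl⟩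
  obtain ⟨t, ht⟩ := hmem
  have htγ : t ∈ weightIdeal (i + 2) w h γ := by
    refine hv.mem_weightIdeal h1 hm hres hvw ?_ ?_ ?_
    · intro a a' ha haa
      have h0 := hlow a ha
      have h0' := hlow a' (haa ▸ ha)
      have e : ∀ a : ℕ → ℕ, a (i + 1) = 0 → weight (i + 2) w a = weight (i + 1) w a ∧
          mono (i + 2) h a = mono (i + 1) h a := by
        intro a ha
        rw [hsucc, hsuccm, ha, hwt (i + 1) le_rfl]
        simp
      obtain ⟨c, _, hc⟩ := hprop i le_rfl a a' (by rw [← (e a h0).1, ← (e a' h0').1, haa])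
      rw [← (e a h0).1, ← (e a h0).2, ← (e a' h0').2] at hc
      exact ⟨c, hc⟩
    · intro a ha
      have h0 := hlow a ha
      rw [hsuccm, hsucc, h0, pow_zero, mul_one, zero_mul, add_zero]
      exact hv.map_mono h1 (fun j hj => hh j (by omega)) a
    · intro a ha hta
      have h0 := hlow a ha
      rw [ht, hsucc, h0, zero_mul, add_zero, Nat.cast_inj] at hta
      exact hβ.ne_sum hi a hta
  have hle : γ ≤ β (i + 1) := by
    have := hv.le_of_mem h1 hvw htγ
    rw [ht] at this
    exact_mod_cast this
  have hγeq : γ = β (i + 1) := le_antisymm hle hγ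
  refine ⟨hγeq, ?_⟩
  by_contra hne
  have hlt : (γ + 1 : ℕ) ≤ v (h (i + 1)) := by
    push_cast
    refine Order.add_one_le_of_lt (lt_of_le_of_ne hγv ?_)
    rw [hγeq]; exact fun h => hne h.symm
  -- Every monomial of weight `γ = β (i + 1)` contains `h (i + 1)` by minimality of the generators.
  -- Were the value of `h (i + 1)` larger than `γ`, so would be that of `t`.
  obtain ⟨s, hs, hs'⟩ := exists_leading_part hm hres htγ
  have hvs : ((γ + 1 : ℕ) : ℕ∞) ≤ v s := by
    clear hs'
    induction hs using Submodule.span_induction with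
    | mem s hs =>
      obtain ⟨a, ha, rfl⟩ := hs
      have h0 : a (i + 1) ≠ 0 := by
        intro h0
        rw [hsucc, h0, zero_mul, add_zero, hγeq] at ha
        exact hβ.ne_sum hi a ha.symm
      obtain ⟨p, hp⟩ := Nat.exists_eq_succ_of_ne_zero h0
      rw [hsuccm, hp, pow_succ, hv.map_mul, hv.map_mul]
      exact hlt.trans ((self_le_add_left _ _).trans (self_le_add_left _ _))
    | zero => rw [hv.map_zero]; exact le_top
    | add x y _ _ hx hy => exact (le_min hx hy).trans (hv.min_le_add _ _)
    | smul c x _ hx =>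
      rw [Algebra.smul_def, hv.map_mul]; exact hx.trans (self_le_add_left _ _)
  have := (le_min (hv.le_of_mem h1 hvw hs') hvs).trans (hv.min_le_add (t - s) s)
  rw [sub_add_cancel, ht, ← hγeq] at this
  have : γ + 1 ≤ γ := by exact_mod_cast this
  omega

/-- The sequence starts with a generator of the maximal ideal of least value and the other one
corrected by powers of it. Each further element is the binomial `h_i ^ n_i - c * mono i h (b i)`,
corrected by monomials of weight above `n_i β_i`. -/
theorem exists_generating_sequence (hv : IsColengthValuation v) (h1 : v 1 = 0)
    (hβ : IsMinimalGenerators {k : ℕ | ∃ x, v x = k} g β) (hb : IsExponentSystem g β b)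
    {x y : R} (hres : ∀ r : R, ∃ c : ℂ, r - algebraMap ℂ R c ∈ Ideal.span {x, y})
    (hx : 0 < v x) (hy : 0 < v y) {i : ℕ} (hi : i + 1 ≤ g) :
    (1 ≤ i → n β b i * β i < β (i + 1)) ∧ ∃ h : ℕ → R, (∀ j ≤ i + 1, v (h j) = β j) ∧
      Ideal.span {x, y} ≤ weightIdeal (i + 2) β h 1 ∧
      ∀ j, 1 ≤ j → j ≤ i → Proportional (weightIdeal (i + 2) β h (n β b j * β j + 1))
        (h j ^ n β b j) (mono j h (b j)) := by
  have hpos : ∀ j ≤ g, 0 < β j := fun j hj => hβ.pos hj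
  induction i with
  | zero =>
    refine ⟨by omega, ?_⟩
    have hmpos : ∀ z ∈ Ideal.span {x, y}, min (v x) (v y) ≤ v z := by
      intro z hz
      obtain ⟨p, q, rfl⟩ := Ideal.mem_span_pair.1 hz
      refine le_trans (le_min ?_ ?_) (hv.min_le_add _ _)
      · rw [hv.map_mul]; exact (min_le_left _ _).trans (self_le_add_left _ _)
      · rw [hv.map_mul]; exact (min_le_right _ _).trans (self_le_add_left _ _)
    have hmin : min (v x) (v y) = β 0 := by
      apply le_antisymm
      · have hmem : β 0 ∈ {k : ℕ | ∃ x, v x = k} := by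
          rw [← hβ.generates]
          exact AddSubmonoid.subset_closure ⟨0, Nat.zero_le g, rfl⟩
        obtain ⟨t, ht⟩ := hmem
        obtain ⟨c, hc⟩ := hres t
        by_cases hc0 : c = 0
        · rw [hc0, map_zero, sub_zero] at hc
          rw [← ht]; exact hmpos _ hc
        · have h2 := hv.map_eq_of_lt_sub h1 (x := t) (y := algebraMap ℂ R c) (by
            rw [hv.map_algebraMap h1 hc0]
            exact lt_of_lt_of_le (lt_min hx hy) (hmpos _ hc))
          rw [hv.map_algebraMap h1 hc0, ht, Nat.cast_eq_zero] at h2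
          exact absurd h2 (hpos 0 (Nat.zero_le g)).ne'
      · have key : ∀ u : R, 0 < v u → (β 0 : ℕ∞) ≤ v u := by
          intro u hu
          by_cases htop : v u = ⊤
          · rw [htop]; exact le_top
          obtain ⟨k, hk⟩ := ENat.ne_top_iff_exists.1 htop
          have hkΓ : k ∈ {k : ℕ | ∃ x, v x = k} := ⟨u, hk.symm⟩
          rw [← hk] at hu ⊢
          have hu : 0 < k := by exact_mod_cast hu
          rw [Nat.cast_le]
          rcases hβ.le_or_eq_sum 0 hkΓ with h | ⟨a, rfl⟩
          · exact (hβ.strictMono (Set.mem_Iic.2 (Nat.zero_le g)) (Set.mem_Iic.2 hi)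
              Nat.zero_lt_one).le.trans (h hi)
          · rw [zero_add, Finset.sum_range_one] at hu ⊢
            exact Nat.le_mul_of_pos_left _ (Nat.pos_of_mul_pos_right hu)
        exact le_min (key x hx) (key y hy)
    obtain ⟨h₀, y₀, hspan, hh₀, hy₀⟩ : ∃ h₀ y₀, Ideal.span {x, y} = Ideal.span {h₀, y₀} ∧
        v h₀ = β 0 ∧ 0 < v y₀ := by
      rcases min_choice (v x) (v y) with h | h
      · exact ⟨x, y, rfl, by rw [← hmin, h], hy⟩
      · exact ⟨y, x, by rw [Set.pair_comm], by rw [← hmin, h], hx⟩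
    obtain ⟨s, hs, hs0, hsβ⟩ := exists_approximation hv h1 hβ hi (h := fun _ => h₀) (M := 0)
      (fun j hj => by rw [show j = 0 by omega]; exact hh₀) (by exact_mod_cast hy₀)
    let h : ℕ → R := fun j => if j = 0 then h₀ else y₀ - s
    have hm : Ideal.span {x, y} ≤ weightIdeal 2 β h 1 := by
      rw [hspan, Ideal.span_le]
      have e0 : h₀ ∈ weightIdeal 2 β h 1 := by
        have := mono_mem (k := 2) (w := β) (h := h) (N := 1) (a := Pi.single 0 1)
          (by rw [weight_single (by omega), one_mul]; exact hpos 0 (by omega))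
        rwa [mono_single (by omega), pow_one] at this
      have e1 : y₀ - s ∈ weightIdeal 2 β h 1 := by
        have := mono_mem (k := 2) (w := β) (h := h) (N := 1) (a := Pi.single 1 1)
          (by rw [weight_single (by omega), one_mul]; exact hpos 1 (by omega))
        rwa [mono_single (by omega), pow_one] at this
      have e2 : s ∈ weightIdeal 2 β h 1 :=
        weightIdeal_le_of_eqOn (by omega) (fun _ _ => rfl)
          (fun j hj => by simp [h, show j = 0 by omega]) _ hs
      rintro u (rfl | rfl)
      · exact e0
      · have := add_mem e1 e2
        rwa [sub_add_cancel] at this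
    have := next_generator (γ := β 1) hv h1 hβ hb hres hi (h := h)
      (fun j hj => by rw [show j = 0 by omega]; exact hh₀) le_rfl hsβ
      (by rwa [Function.update_eq_self]) (fun j hj hj' => by omega)
    refine ⟨h, fun j hj => ?_, hm, fun j hj hj' => by omega⟩
    rcases Nat.lt_or_ge j 1 with hj' | hj'
    · rw [show j = 0 by omega]; exact hh₀
    · rw [show j = 0 + 1 by omega]; exact this.2
  | succ i ih =>
    obtain ⟨-, h, hh, hm, hrel⟩ := ih (by omega)
    have hsys := hb (i + 1) (by omega) (by omega)
    have hval : v (h (i + 1) ^ n β b (i + 1)) = v (mono (i + 1) h (b (i + 1))) := by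
      rw [hv.map_pow h1, hh _ le_rfl, hv.map_mono h1 fun j hj => hh j (by omega)]
      exact_mod_cast hsys.2
    have hval' : v (h (i + 1) ^ n β b (i + 1)) = (n β b (i + 1) * β (i + 1) : ℕ) := by
      rw [hv.map_pow h1, hh _ le_rfl]; push_cast; rfl
    obtain ⟨c, hc⟩ := hv.exists_lt_sub _ _ (by rw [hval']; exact ENat.natCast_ne_top _) hval
    have hc0 : c ≠ 0 := by
      rintro rfl
      rw [zero_smul, sub_zero] at hc
      exact lt_irrefl _ hc
    rw [hval'] at hc
    obtain ⟨s, hs, hsM, hsβ⟩ := exists_approximation hv h1 hβ hi hh hc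
    set z := h (i + 1) ^ n β b (i + 1) - c • mono (i + 1) h (b (i + 1)) - s with hz
    let h' : ℕ → R := Function.update h (i + 2) z
    -- The value of the new element is known to be at least both numbers. That `next_generator`
    -- identifies their maximum with `β (i + 2)` is precisely the sought inequality.
    let γ := max (β (i + 2)) (n β b (i + 1) * β (i + 1) + 1)
    have hh' : ∀ j < i + 2, h j = h' j := fun j hj => (Function.update_of_ne (by omega) _ _).symm
    have hz' : h' (i + 2) = z := Function.update_self _ _ _
    have hmono : ∀ j ≤ i + 2, ∀ a, mono j h' a = mono j h a := fun j hj a =>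
      Finset.prod_congr rfl fun p hp => by rw [hh' p (by have := Finset.mem_range.1 hp; omega)]
    have hle : ∀ N, weightIdeal (i + 2) β h N ≤
        weightIdeal (i + 3) (Function.update β (i + 2) γ) h' N := fun N =>
      weightIdeal_le_of_eqOn (by omega)
        (fun j hj => (Function.update_of_ne (by omega) _ _).symm) hh' N
    have hzmem : z ∈ weightIdeal (i + 3) (Function.update β (i + 2) γ) h'
        (n β b (i + 1) * β (i + 1) + 1) := by
      have := mono_mem (k := i + 3) (w := Function.update β (i + 2) γ) (h := h')
        (N := n β b (i + 1) * β (i + 1) + 1) (a := Pi.single (i + 2) 1) (by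
          rw [weight_single (by omega), one_mul, Function.update_self]
          exact le_max_right _ _)
      rwa [mono_single (by omega), pow_one, hz'] at this
    have hrel' : ∀ j, 1 ≤ j → j ≤ i + 1 → Proportional
        (weightIdeal (i + 3) (Function.update β (i + 2) γ) h' (n β b j * β j + 1))
        (h' j ^ n β b j) (mono j h' (b j)) := by
      intro j hj hj'
      rw [hmono j (by omega), ← hh' j (by omega)]
      rcases Nat.lt_or_ge i j with hij | hij
      · rw [show j = i + 1 by omega]
        refine ⟨c, hc0, ?_⟩
        have := add_mem hzmem (hle _ hs)
        rwa [hz, sub_add_cancel] at this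
      · exact (hrel j hj hij).mono (hle _)
    have hres' := next_generator (γ := γ) hv h1 hβ hb hres hi (h := h')
      (fun j hj => by rw [← hh' j (by omega)]; exact hh j hj) (le_max_left _ _) (by
        rw [hz']
        refine (Nat.cast_le.2 (le_refl γ)).trans ?_
        rcases le_total (β (i + 2)) (n β b (i + 1) * β (i + 1) + 1) with hl | hl
        · rw [show γ = _ from max_eq_right hl]
          push_cast at hsM ⊢
          exact Order.add_one_le_of_lt hsM
        · rw [show γ = _ from max_eq_left hl]; exact hsβ)
      (hm.trans (hle 1)) hrel'
    have hγ : γ = β (i + 2) := hres'.1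
    refine ⟨fun _ => ?_, h', ?_, ?_, ?_⟩
    · have : n β b (i + 1) * β (i + 1) + 1 ≤ γ := le_max_right _ _
      change n β b (i + 1) * β (i + 1) < β (i + 2)
      omega
    · intro j hj
      rcases Nat.lt_or_ge j (i + 2) with hj' | hj'
      · rw [← hh' j hj']; exact hh j (by omega)
      · rw [show j = i + 1 + 1 by omega]; exact hres'.2
    · have := hm.trans (hle 1)
      rwa [hγ, Function.update_eq_self] at this
    · intro j hj hj'
      have := hrel' j hj hj'
      rwa [hγ, Function.update_eq_self] at this

end ValueSemigroup

theorem sub_algebraMap_constantCoeff_mem (r : MvPowerSeries (Fin 2) ℂ) :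
    r - algebraMap ℂ _ (MvPowerSeries.constantCoeff r) ∈
      Ideal.span {(MvPowerSeries.X 0 : MvPowerSeries (Fin 2) ℂ), MvPowerSeries.X 1} := by
  let p : MvPowerSeries (Fin 2) ℂ := fun d => if d 0 = 0 then MvPowerSeries.coeff d r else 0
  have hp : ∀ d, MvPowerSeries.coeff d p = if d 0 = 0 then MvPowerSeries.coeff d r else 0 :=
    fun d => rfl
  have h1 : MvPowerSeries.X 0 ∣ r - p := by
    rw [MvPowerSeries.X_dvd_iff]
    intro d hd
    rw [map_sub, hp, if_pos hd, sub_self]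
  have h2 : MvPowerSeries.X 1 ∣ p - algebraMap ℂ _ (MvPowerSeries.constantCoeff r) := by
    classical
    rw [MvPowerSeries.X_dvd_iff]
    intro d hd
    rw [map_sub, hp, MvPowerSeries.algebraMap_apply, MvPowerSeries.coeff_C]
    by_cases h0 : d 0 = 0
    · have : d = 0 := by
        ext i
        fin_cases i
        · exact h0
        · exact hd
      rw [if_pos h0, if_pos this, this]
      simp
    · have : d ≠ 0 := by rintro rfl; exact h0 rfl
      rw [if_neg h0, if_neg this, sub_zero]
  obtain ⟨q, hq⟩ := h1
  obtain ⟨q', hq'⟩ := h2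
  rw [Ideal.mem_span_pair]
  exact ⟨q, q', by rw [mul_comm q, mul_comm q', ← hq, ← hq']; ring⟩

theorem isBranchData (f : MvPowerSeries (Fin 2) ℂ) (hf : Irreducible f) {g : ℕ} (hg : 1 ≤ g)
    {β : ℕ → ℕ} (hβ : IsMinimalGenerators (branchSemigroup f) g β) {b : ℕ → ℕ → ℕ}
    (hb : IsExponentSystem g β b) : IsBranchData g β b := by
  obtain ⟨v, hv, hvtop, hvlen⟩ := exists_branchValuation f hf
  have hΓ : branchSemigroup f = {k : ℕ | ∃ x, v x = k} := by
    ext k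
    constructor
    · rintro ⟨h, hh, rfl⟩
      exact ⟨h, hvlen h hh⟩
    · rintro ⟨h, hh⟩
      have hmem : h ∉ Ideal.span {f} := by
        rw [← hvtop, hh]; exact ENat.natCast_ne_top k
      refine ⟨h, hmem, ?_⟩
      have := hvlen h hmem
      rw [hh] at this
      exact_mod_cast this
  rw [hΓ] at hβ
  have h1 : v 1 = 0 := by
    have hne : v 1 ≠ ⊤ := by
      rw [ne_eq, hvtop, ← Ideal.eq_top_iff_one, Ideal.span_singleton_eq_top]
      exact hf.not_isUnit
    have := hv.map_mul 1 1
    rw [mul_one] at this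
    obtain ⟨k, hk⟩ := ENat.ne_top_iff_exists.1 hne
    rw [← hk] at this ⊢
    have : k = k + k := by exact_mod_cast this
    have : k = 0 := by omega
    rw [this]; rfl
  have hX : ∀ i : Fin 2, 0 < v (MvPowerSeries.X i) := by
    intro i
    by_contra h0
    have h0 : v (MvPowerSeries.X i) = 0 := by simpa using h0
    obtain ⟨c, hc⟩ := hv.exists_lt_sub (MvPowerSeries.X i) 1 (by rw [h0]; simp) (by rw [h0, h1])
    rw [h0] at hc
    have hc0 : c ≠ 0 := by
      rintro rfl
      rw [zero_smul, sub_zero, h0] at hc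
      exact lt_irrefl _ hc
    -- If a variable had value zero, a unit would have positive value.
    have hu : IsUnit (MvPowerSeries.X i - c • (1 : MvPowerSeries (Fin 2) ℂ)) := by
      rw [MvPowerSeries.isUnit_iff_constantCoeff]
      simpa using hc0
    obtain ⟨q, hq⟩ := hu.exists_right_inv
    have := hv.map_mul (MvPowerSeries.X i - c • (1 : MvPowerSeries (Fin 2) ℂ)) q
    rw [hq, h1] at this
    exact hc.ne (add_eq_zero.1 this.symm).1.symm
  refine ⟨hg, hβ.pos (Nat.zero_le g), hβ.strictMono (Set.mem_Iic.2 (Nat.zero_le g))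
    (Set.mem_Iic.2 hg) Nat.zero_lt_one, fun i hi hi' => hβ.two_le_n hb hi hi', hb, ?_⟩
  intro i hi hi'
  exact (exists_generating_sequence hv h1 hβ hb
    (fun r => ⟨_, sub_algebraMap_constantCoeff_mem r⟩) (hX 0) (hX 1) hi').1 hi

/-! ### Consequences for the exponents, and the cutoff index -/

section BranchNumerics

variable {g : ℕ} {β : ℕ → ℕ} {b : ℕ → ℕ → ℕ}

namespace IsBranchData

variable (D : IsBranchData g β b)
include D

theorem e_one_pos : 0 < e β 1 := e_pos D.pos 1

omit D in
theorem n_one_mul : n β b 1 * e β 1 = β 0 := by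
  rw [← e_zero β]; exact n_mul_e β b 0

theorem n_one_mul_beta : n β b 1 * β 1 = n β b 0 * β 0 := by
  have := (D.sys 1 le_rfl D.one_le).2
  rw [Finset.sum_range_one] at this
  exact this

theorem n_zero_mul : n β b 0 * e β 1 = β 1 := by
  have h1 := D.n_one_mul_beta
  rw [← n_one_mul (β := β) (b := b)] at h1
  have h2 : 0 < n β b 1 := by have := D.two_le 1 le_rfl D.one_le; omega
  refine Nat.eq_of_mul_eq_mul_left h2 ?_
  rw [h1]; ring

theorem coprime : Nat.Coprime (n β b 0) (n β b 1) := by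
  have := coprime_n b D.pos 0
  rw [zero_add, ← D.n_zero_mul, Nat.mul_div_cancel _ D.e_one_pos] at this
  exact this.symm

theorem n_one_lt : n β b 1 < n β b 0 := by
  have := D.lt
  rw [← D.n_zero_mul, ← n_one_mul (β := β) (b := b)] at this
  exact Nat.lt_of_mul_lt_mul_right this

theorem two_le_n_one : 2 ≤ n β b 1 := D.two_le 1 le_rfl D.one_le

theorem n_pos {i : ℕ} (hi : i ≤ g) : 0 < n β b i := by
  rcases Nat.eq_zero_or_pos i with rfl | h
  · have := D.n_one_lt; omega
  · have := D.two_le i h hi; omega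

theorem lt_beta {i j : ℕ} (h1 : 1 ≤ i) (hij : i < j) (hj : j ≤ g) : n β b i * β i < β j := by
  induction j with
  | zero => omega
  | succ j ih =>
    rcases Nat.lt_succ_iff_lt_or_eq.1 hij with h | rfl
    · have h2 := ih h (by omega)
      have h3 := D.inc j (by omega) (by omega)
      have h4 := Nat.le_mul_of_pos_left (β j) (D.n_pos (i := j) (by omega))
      omega
    · exact D.inc _ h1 (by omega)

theorem n_mul_beta_lt {i j : ℕ} (h1 : 1 ≤ i) (hij : i < j) (hj : j ≤ g) :
    n β b i * β i < n β b j * β j :=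
  (D.lt_beta h1 hij hj).trans_le (Nat.le_mul_of_pos_left _ (D.n_pos hj))

theorem sum_Ico_le {r i : ℕ} (hr : 1 ≤ r) (hri : r ≤ i) (hi : i ≤ g) :
    ∑ p ∈ Finset.Ico r i, (n β b p - 1) * β p + β r ≤ β i := by
  induction i, hri using Nat.le_induction with
  | base => simp
  | succ i hri ih =>
    have h1 := ih (by omega)
    have h2 := D.inc i (by omega) (by omega)
    rw [Finset.sum_Ico_succ_top hri, Nat.sub_mul, one_mul]
    have h3 := Nat.le_mul_of_pos_left (β i) (D.n_pos (i := i) (by omega))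
    omega

/-- The factors of index at least `r` contribute at most `β i - β r`, by telescoping, while the
total is at least `2 β i`; so at least `β i + β r` is left. On jets this makes the monomials of the
later equations vanish once the cutoff is passed. -/
theorem lt_sum_range {r i : ℕ} (hr : 1 ≤ r) (hri : r < i) (hi : i ≤ g) :
    n β b r * β r < ∑ p ∈ Finset.range r, b i p * β p := by
  have h1 := (D.sys i (by omega) hi).2
  have h2 : ∑ p ∈ Finset.Ico r i, b i p * β p ≤ ∑ p ∈ Finset.Ico r i, (n β b p - 1) * β p := by
    refine Finset.sum_le_sum fun p hp => ?_
    rw [Finset.mem_Ico] at hp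
    have := (D.sys i (by omega) hi).1 p (by omega) hp.2
    exact Nat.mul_le_mul_right _ (by omega)
  have h3 := D.sum_Ico_le hr hri.le hi
  have h4 : ∑ p ∈ Finset.range r, b i p * β p + ∑ p ∈ Finset.Ico r i, b i p * β p =
      ∑ p ∈ Finset.range i, b i p * β p := Finset.sum_range_add_sum_Ico _ hri.le
  have h5 : 2 * β i ≤ n β b i * β i := Nat.mul_le_mul_right _ (D.two_le i (by omega) hi)
  have h6 := D.lt_beta hr hri hi
  omega

theorem le_sum_range {r i : ℕ} (hr : 1 ≤ r) (hri : r ≤ i) (hi : i ≤ g) :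
    n β b r * β r ≤ ∑ p ∈ Finset.range r, b i p * β p := by
  rcases hri.eq_or_lt with rfl | h
  · exact (D.sys r hr hi).2.le
  · exact (D.lt_sum_range hr h hi).le

theorem n_zero_lt {i : ℕ} (h1 : 1 < i) (hi : i ≤ g) : n β b 0 < b i 0 := by
  have := D.lt_sum_range le_rfl h1 hi
  rw [Finset.sum_range_one, D.n_one_mul_beta] at this
  exact Nat.lt_of_mul_lt_mul_right this

theorem n_zero_le {i : ℕ} (h1 : 1 ≤ i) (hi : i ≤ g) : n β b 0 ≤ b i 0 := by
  rcases h1.eq_or_lt with rfl | h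
  · exact le_rfl
  · exact (D.n_zero_lt h hi).le

omit D in
theorem e_one_eq_prod {r : ℕ} (hr : 2 ≤ r) :
    e β 1 = (∏ i ∈ Finset.Ico 2 r, n β b i) * e β (r - 1) := by
  induction r, hr using Nat.le_induction with
  | base => simp
  | succ r hr ih =>
    rw [Finset.prod_Ico_succ_top hr, ih, show r - 1 = r - 2 + 1 by omega,
      show r + 1 - 1 = r - 2 + 1 + 1 by omega, ← n_mul_e β b (r - 2 + 1),
      show r - 2 + 1 + 1 = r by omega]
    ring

/-- `k n_0 n_1 ≤ m` in terms of the generators. -/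
theorem mul_n_one_beta (k : ℕ) : k * (n β b 1 * β 1) = k * n β b 0 * n β b 1 * e β 1 := by
  rw [← D.n_zero_mul]; ring

end IsBranchData

/-- `r` is the first index with `m < k * n_r * β_r / e_1`, or `g + 1`. -/
structure IsCutoff (g : ℕ) (β : ℕ → ℕ) (b : ℕ → ℕ → ℕ) (m k r : ℕ) : Prop where
  two_le : 2 ≤ r
  le : r ≤ g + 1
  below : ∀ i, 1 ≤ i → i < r → k * (n β b i * β i) ≤ m * e β 1
  above : r ≤ g → m * e β 1 < k * (n β b r * β r)

namespace IsBranchData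

variable (D : IsBranchData g β b)
include D

theorem exists_isCutoff {m k : ℕ} (h : k * n β b 0 * n β b 1 ≤ m) :
    ∃ r, IsCutoff g β b m k r := by
  classical
  have hex : ∃ r, 1 ≤ r ∧ (r = g + 1 ∨ m * e β 1 < k * (n β b r * β r)) :=
    ⟨g + 1, by omega, Or.inl rfl⟩
  have hspec := Nat.find_spec hex
  have hmin : ∀ i, 1 ≤ i → i < Nat.find hex → ¬ (i = g + 1 ∨ m * e β 1 < k * (n β b i * β i)) :=
    fun i hi hlt h => Nat.find_min hex hlt ⟨hi, h⟩
  refine ⟨Nat.find hex, ?_, Nat.find_min' hex ⟨by omega, Or.inl rfl⟩, ?_, ?_⟩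
  · by_contra hlt
    have h1 : Nat.find hex = 1 := by omega
    rw [h1, D.mul_n_one_beta] at hspec
    have := D.one_le
    have := Nat.mul_le_mul_right (e β 1) h
    omega
  · intro i hi hlt
    have := hmin i hi hlt
    omega
  · intro hle
    exact hspec.2.resolve_left (by omega)

omit D in
theorem two_le_jIndex (hg : 1 ≤ g) (k : ℕ) :
    2 ≤ jIndex g β b k ∧ ∏ i ∈ Finset.Ico 2 (jIndex g β b k), n β b i ∣ k := by
  exact Nat.findGreatest_spec (P := fun l => 2 ≤ l ∧ ∏ i ∈ Finset.Ico 2 l, n β b i ∣ k)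
    (show 2 ≤ g + 1 by omega) ⟨le_rfl, by simp⟩

omit D in
theorem jIndex_le (k : ℕ) : jIndex g β b k ≤ g + 1 := Nat.findGreatest_le _

theorem belowBound_iff {m k : ℕ} : BelowBound g β b m k ↔
    (jIndex g β b k ≤ g → m * e β 1 < k * (n β b (jIndex g β b k) * β (jIndex g β b k))) := by
  have h1 : (0 : ℚ) < e β 1 := by exact_mod_cast D.e_one_pos
  have h2 : jIndex g β b k ≤ g + 1 := jIndex_le k
  rw [BelowBound, lt_div_iff₀ h1]
  have h3 : ((m : ℚ) * e β 1 < k * n β b (jIndex g β b k) * β (jIndex g β b k)) ↔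
      m * e β 1 < k * (n β b (jIndex g β b k) * β (jIndex g β b k)) := by
    rw [← mul_assoc]; exact_mod_cast Iff.rfl
  rw [h3]
  constructor
  · rintro (h | h) h'
    · omega
    · exact h
  · intro h
    by_cases hj : jIndex g β b k = g + 1
    · exact Or.inl hj
    · exact Or.inr (h (by omega))

/-- Below the bound, the orders `k * β_i / e_1` are multiples of `β_i / e_{r-1}`. -/
theorem exists_mul_e_eq {m k r : ℕ} (hr : IsCutoff g β b m k r) (hB : BelowBound g β b m k) :
    ∃ κ, k * e β (r - 1) = κ * e β 1 := by
  rw [D.belowBound_iff] at hB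
  obtain ⟨h2, hd⟩ := two_le_jIndex (β := β) (b := b) D.one_le k
  have hrj : r ≤ jIndex g β b k := by
    by_contra hlt
    have h3 := hB (by have := hr.le; omega)
    have := hr.below _ (by omega) (not_le.1 hlt)
    omega
  obtain ⟨κ, hκ⟩ := (Finset.prod_dvd_prod_of_subset _ _ (n β b)
    (Finset.Ico_subset_Ico_right hrj)).trans hd
  exact ⟨κ, by rw [e_one_eq_prod (b := b) hr.two_le]; nth_rewrite 1 [hκ]; ring⟩

/-- If the bound failed at `j = j(k)`, divisibility of `k β_j` by `e_1` would give `n_j ∣ k / (n_2 ⋯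
n_{j-1})`, against the maximality of `j(k)`. -/
theorem belowBound_of_dvd {m k : ℕ}
    (h : ∀ i, 1 ≤ i → i ≤ g → k * (n β b i * β i) ≤ m * e β 1 → e β 1 ∣ k * β i) :
    BelowBound g β b m k := by
  rw [D.belowBound_iff]
  intro hj
  obtain ⟨h2, hd⟩ := two_le_jIndex (β := β) (b := b) D.one_le k
  set j := jIndex g β b k with hjdef
  by_contra hlt
  have h3 := h j (by omega) hj (by omega)
  obtain ⟨k', hk'⟩ := hd
  rw [e_one_eq_prod (b := b) h2, hk', mul_assoc] at h3
  have hpos : 0 < ∏ i ∈ Finset.Ico 2 j, n β b i :=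
    Finset.prod_pos fun i hi => D.n_pos (by rw [Finset.mem_Ico] at hi; omega)
  have h4 : e β (j - 1) ∣ k' * β j := Nat.dvd_of_mul_dvd_mul_left hpos h3
  obtain ⟨i, hi⟩ : ∃ i, j = i + 1 := ⟨j - 1, by omega⟩
  rw [hi, Nat.add_sub_cancel] at h4
  have h5 := n_dvd_of_e_dvd_mul b D.pos h4
  have h6 : j + 1 ≤ jIndex g β b k := by
    refine Nat.le_findGreatest (by omega) ⟨by omega, ?_⟩
    rw [Finset.prod_Ico_succ_top h2]
    have h7 : n β b j ∣ k' := by rw [hi]; exact h5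
    exact (Nat.mul_dvd_mul_left _ h7).trans (dvd_of_eq hk'.symm)
  omega

end IsBranchData

end BranchNumerics

/-! ### Points of jet schemes as jets with coefficients in fields -/

section JetPoints

variable {S : Type} [CommRing S] [Algebra ℂ S]

/-- The evaluation of the jet coordinates at a family of power series. -/
noncomputable def jetEval {σ : Type} (m : ℕ) (x : σ → PowerSeries S) :
    MvPolynomial (σ × Fin (m + 1)) ℂ →ₐ[ℂ] S :=
  MvPolynomial.aeval fun p => PowerSeries.coeff p.2 (x p.1)

theorem jetEval_jetCoeff {σ : Type} {m : ℕ} (x : σ → PowerSeries S) (P : MvPolynomial σ ℂ) {l : ℕ}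
    (hl : l ≤ m) :
    jetEval m x (jetCoeff m P l) = PowerSeries.coeff l (MvPolynomial.aeval x P) := by
  -- The generic jet is truncated at order `m` and the series `x i` are not, so the two evaluations
  -- agree only modulo this ideal.
  let I : Ideal (PowerSeries S) := Ideal.span {PowerSeries.X ^ (m + 1)}
  let Ψ : Polynomial (MvPolynomial (σ × Fin (m + 1)) ℂ) →+* PowerSeries S :=
    (PowerSeries.map (jetEval m x : MvPolynomial (σ × Fin (m + 1)) ℂ →+* S)).comp
      Polynomial.coeToPowerSeries.ringHom
  have hΨ : ∀ p d, PowerSeries.coeff d (Ψ p) = jetEval m x (p.coeff d) := by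
    intro p d
    simp [Ψ]
  have key : ((Ideal.Quotient.mk I).comp Ψ).comp
      (MvPolynomial.aeval (genericJet σ m) :
        MvPolynomial σ ℂ →ₐ[ℂ] _).toRingHom =
      (Ideal.Quotient.mk I).comp (MvPolynomial.aeval x : MvPolynomial σ ℂ →ₐ[ℂ] _).toRingHom := by
    refine MvPolynomial.ringHom_ext (fun a => ?_) fun i => ?_
    · simp only [RingHom.comp_apply, AlgHom.toRingHom_eq_coe, RingHom.coe_coe,
        MvPolynomial.aeval_C]
      congr 1
      ext d
      rw [hΨ, PowerSeries.algebraMap_apply, Polynomial.algebraMap_apply, PowerSeries.coeff_C,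
        Polynomial.coeff_C]
      split_ifs
      · rw [AlgHom.commutes]
      · rw [map_zero]
    · simp only [RingHom.comp_apply, AlgHom.toRingHom_eq_coe, RingHom.coe_coe,
        MvPolynomial.aeval_X]
      rw [Ideal.Quotient.eq, Ideal.mem_span_singleton, PowerSeries.X_pow_dvd_iff]
      intro d hd
      rw [map_sub, hΨ, coeff_genericJet, dif_pos hd, jetEval, MvPolynomial.aeval_X, sub_self]
  have h2 := DFunLike.congr_fun key P
  simp only [RingHom.comp_apply, AlgHom.toRingHom_eq_coe, RingHom.coe_coe] at h2
  rw [Ideal.Quotient.eq, Ideal.mem_span_singleton, PowerSeries.X_pow_dvd_iff] at h2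
  have h3 := h2 l (by omega)
  rw [map_sub, hΨ, sub_eq_zero] at h3
  exact h3

/-- `x` is an `m`-jet on the monomial curve. -/
def IsJet (g : ℕ) (β : ℕ → ℕ) (b : ℕ → ℕ → ℕ) (m : ℕ) (x : ℕ → PowerSeries S) : Prop :=
  ∀ i, 1 ≤ i → i ≤ g →
    PowerSeries.X ^ (m + 1) ∣ x i ^ n β b i - ∏ p ∈ Finset.range i, x p ^ b i p

variable {g : ℕ} {β : ℕ → ℕ} {b : ℕ → ℕ → ℕ} {m : ℕ}

theorem aeval_curveEq (x : ℕ → PowerSeries S) (h : Fin g) :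
    MvPolynomial.aeval (fun i : Fin (g + 1) => x i) (curveEq g β b h) =
      x (h + 1) ^ n β b (h + 1) - ∏ p ∈ Finset.range (h + 1), x p ^ b (h + 1) p := by
  rw [curveEq, map_sub, map_pow, map_prod, Finset.prod_range]
  simp

theorem jetIdeal_le_ker_iff {x : ℕ → PowerSeries S} :
    jetIdeal (curveEq g β b) m ≤ RingHom.ker (jetEval m fun i : Fin (g + 1) => x i) ↔
      IsJet g β b m x := by
  rw [jetIdeal, Ideal.span_le]
  constructor
  · intro h i h1 hi
    rw [PowerSeries.X_pow_dvd_iff]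
    intro d hd
    have h2 := h ⟨⟨i - 1, by omega⟩, d, by omega, rfl⟩
    rw [SetLike.mem_coe, RingHom.mem_ker, jetEval_jetCoeff _ _ (by omega), aeval_curveEq] at h2
    simp only [Nat.sub_add_cancel h1] at h2
    exact h2
  · rintro h _ ⟨k, d, hd, rfl⟩
    rw [SetLike.mem_coe, RingHom.mem_ker, jetEval_jetCoeff _ _ hd, aeval_curveEq]
    exact PowerSeries.X_pow_dvd_iff.1 (h (k + 1) (by omega) (by omega)) d (by omega)

/-- The homomorphism from the coordinate ring of the jet scheme given by a jet. -/
noncomputable def jetHom (x : ℕ → PowerSeries S) (hx : IsJet g β b m x) :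
    JetRing (curveEq g β b) m →ₐ[ℂ] S :=
  Ideal.Quotient.liftₐ _ (jetEval m fun i : Fin (g + 1) => x i) fun _ ha =>
    jetIdeal_le_ker_iff.2 hx ha

theorem jetHom_coord {x : ℕ → PowerSeries S} (hx : IsJet g β b m x) (i : Fin (g + 1)) {j : ℕ}
    (hj : j ≤ m) : jetHom x hx (coord (curveEq g β b) m i j) = PowerSeries.coeff j (x i) := by
  rw [coord, coeff_genericJet, dif_pos (by omega : j < m + 1), jetHom]
  erw [Ideal.Quotient.lift_mk]
  simp [jetEval]

theorem jetRing_induction {p : JetRing (curveEq g β b) m → Prop}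
    (hC : ∀ a, p (algebraMap ℂ _ a)) (hadd : ∀ u v, p u → p v → p (u + v))
    (hmul : ∀ u i j, j ≤ m → p u → p (u * coord (curveEq g β b) m i j)) (u) : p u := by
  obtain ⟨u, rfl⟩ := Ideal.Quotient.mk_surjective u
  induction u using MvPolynomial.induction_on with
  | C a => exact hC a
  | add u v hu hv => rw [map_add]; exact hadd _ _ hu hv
  | mul_X u i hu =>
    have := hmul _ i.1 i.2 (by have := i.2.2; omega) hu
    rw [coord, coeff_genericJet, dif_pos i.2.2] at this
    rw [map_mul]
    exact this

/-- The point of the jet scheme given by a jet with coefficients in a domain. -/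
noncomputable def jetPoint [IsDomain S] (x : ℕ → PowerSeries S) (hx : IsJet g β b m x) :
    JetSpace (curveEq g β b) m :=
  ⟨RingHom.ker (jetHom x hx), RingHom.ker_isPrime _⟩

theorem mem_jetPoint [IsDomain S] {x : ℕ → PowerSeries S} (hx : IsJet g β b m x) {u} :
    u ∈ (jetPoint x hx).asIdeal ↔ jetHom x hx u = 0 := RingHom.mem_ker

theorem jetHom_eq_of_specialization {K : Type} [CommRing K] [Algebra ℂ K]
    {x : ℕ → PowerSeries S} (hx : IsJet g β b m x) {z : ℕ → PowerSeries K} (hz : IsJet g β b m z)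
    (f : S →ₐ[ℂ] K) (hf : ∀ i ≤ g, ∀ j ≤ m, f (PowerSeries.coeff j (x i)) = PowerSeries.coeff j (z i))
    (u) : jetHom z hz u = f (jetHom x hx u) := by
  induction u using jetRing_induction with
  | hC a => simp [AlgHom.commutes]
  | hadd u v hu hv => rw [map_add, map_add, map_add, hu, hv]
  | hmul u i j hj hu =>
    rw [map_mul, map_mul, map_mul, hu, jetHom_coord _ _ hj, jetHom_coord _ _ hj,
      hf i (by omega) j hj]

theorem jetPoint_le_of_specialization [IsDomain S] {K : Type} [CommRing K] [Algebra ℂ K] [IsDomain K]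
    {x : ℕ → PowerSeries S} (hx : IsJet g β b m x) {z : ℕ → PowerSeries K} (hz : IsJet g β b m z)
    (f : S →ₐ[ℂ] K)
    (hf : ∀ i ≤ g, ∀ j ≤ m, f (PowerSeries.coeff j (x i)) = PowerSeries.coeff j (z i)) :
    jetPoint x hx ≤ jetPoint z hz := by
  intro u hu
  rw [mem_jetPoint] at hu ⊢
  rw [jetHom_eq_of_specialization hx hz f hf, hu, map_zero]

/-- The coordinates evaluated in an algebraic closure of the residue field form a jet. All sets of
primes below are studied through such jets, where roots can be extracted. -/
theorem exists_jetPoint (p : JetSpace (curveEq g β b) m) :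
    ∃ (K : Type) (_ : Field K) (_ : Algebra ℂ K) (_ : IsAlgClosed K) (x : ℕ → PowerSeries K)
      (hx : IsJet g β b m x), p = jetPoint x hx := by
  let A := JetRing (curveEq g β b) m ⧸ p.asIdeal
  let K := AlgebraicClosure (FractionRing A)
  let ψ : JetRing (curveEq g β b) m →ₐ[ℂ] K :=
    ((IsScalarTower.toAlgHom ℂ (FractionRing A) K).comp
      (IsScalarTower.toAlgHom ℂ A (FractionRing A))).comp (Ideal.Quotient.mkₐ ℂ p.asIdeal)
  have hψ : RingHom.ker ψ = p.asIdeal := by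
    ext u
    rw [RingHom.mem_ker]
    simp only [ψ, AlgHom.comp_apply, IsScalarTower.coe_toAlgHom']
    rw [map_eq_zero, map_eq_zero_iff _ (IsFractionRing.injective A (FractionRing A))]
    exact Ideal.Quotient.eq_zero_iff_mem
  let x : ℕ → PowerSeries K := fun i => PowerSeries.mk fun j =>
    if h : i < g + 1 then ψ (coord (curveEq g β b) m ⟨i, h⟩ j) else 0
  have hev : jetEval m (fun i : Fin (g + 1) => x i) =
      ψ.comp (Ideal.Quotient.mkₐ ℂ (jetIdeal (curveEq g β b) m)) := by
    refine MvPolynomial.algHom_ext fun i => ?_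
    rw [jetEval, MvPolynomial.aeval_X, PowerSeries.coeff_mk, dif_pos i.1.2, coord,
      coeff_genericJet, dif_pos i.2.2]
    rfl
  have hx : IsJet g β b m x := by
    rw [← jetIdeal_le_ker_iff, hev]
    intro u hu
    rw [RingHom.mem_ker, AlgHom.comp_apply, Ideal.Quotient.mkₐ_eq_mk,
      Ideal.Quotient.eq_zero_iff_mem.2 hu, map_zero]
  refine ⟨K, inferInstance, inferInstance, inferInstance, x, hx, ?_⟩
  have hj : jetHom x hx = ψ := by
    refine Ideal.Quotient.algHom_ext _ ?_
    rw [← hev]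
    ext1 i
    rfl
  ext1
  change p.asIdeal = RingHom.ker (jetHom x hx)
  rw [hj, hψ]

end JetPoints

/-! ### Orders of the coordinates and the decomposition of the fiber -/

section Strata

theorem truncHom_coord {σ ι : Type} (F : ι → MvPolynomial σ ℂ) {p m : ℕ} (h : p ≤ m) (i : σ) {j : ℕ}
    (hj : j ≤ p) : truncHom F h (coord F p i j) = coord F m i j := by
  rw [coord, coord, coeff_genericJet, coeff_genericJet, dif_pos (by omega : j < p + 1),
    dif_pos (by omega : j < m + 1), truncHom, Ideal.quotientMap_mk]
  congr 1
  simp [polyTrunc]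

variable {g : ℕ} {β : ℕ → ℕ} {b : ℕ → ℕ → ℕ} {m k l : ℕ}
variable {K : Type} [CommRing K] [IsDomain K] [Algebra ℂ K] {x : ℕ → PowerSeries K}

theorem jetPoint_mem_fiberZero (hx : IsJet g β b m x) :
    jetPoint x hx ∈ fiberZero (curveEq g β b) m ↔ ∀ i ≤ g, PowerSeries.coeff 0 (x i) = 0 := by
  rw [fiberZero, Set.mem_preimage, PrimeSpectrum.mem_zeroLocus, truncMap, Set.range_subset_iff]
  have h1 : ∀ i : Fin (g + 1), coord (curveEq g β b) 0 i 0 ∈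
      ((PrimeSpectrum.comap (truncHom (curveEq g β b) (Nat.zero_le m))) (jetPoint x hx)).asIdeal ↔
      PowerSeries.coeff 0 (x i) = 0 := by
    intro i
    rw [PrimeSpectrum.comap_asIdeal, Ideal.mem_comap, truncHom_coord _ _ _ le_rfl, mem_jetPoint,
      jetHom_coord hx _ (Nat.zero_le m)]
  exact ⟨fun h i hi => (h1 ⟨i, by omega⟩).1 (h _), fun h i => (h1 i).2 (h i (by omega))⟩

theorem coord_zero_mem_truncMap (hx : IsJet g β b m x) {p j : ℕ} (h : p ≤ m) (hj : j ≤ p) :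
    coord (curveEq g β b) p 0 j ∈ (truncMap (curveEq g β b) h (jetPoint x hx)).asIdeal ↔
      PowerSeries.coeff j (x 0) = 0 := by
  rw [truncMap, PrimeSpectrum.comap_asIdeal, Ideal.mem_comap, truncHom_coord _ _ _ hj, mem_jetPoint,
    jetHom_coord hx _ (hj.trans h)]
  rfl

theorem mul_n_one_le (hD : IsBranchData g β b) (k : ℕ) :
    k * n β b 1 ≤ k * n β b 0 * n β b 1 :=
  Nat.mul_le_mul_right _ (Nat.le_mul_of_pos_right _ (hD.n_pos (Nat.zero_le g)))

theorem jetPoint_mem_D (hD : IsBranchData g β b) (hx : IsJet g β b m x)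
    (h : k * n β b 0 * n β b 1 ≤ m) :
    jetPoint x hx ∈ D g β b m k h ↔ (x 0).order = (k * n β b 1 : ℕ) := by
  have h1 := mul_n_one_le hD k
  rw [D, Set.mem_preimage, Set.mem_inter_iff, Set.mem_compl_iff, PrimeSpectrum.mem_zeroLocus,
    PrimeSpectrum.mem_zeroLocus, Set.singleton_subset_iff, SetLike.mem_coe,
    coord_zero_mem_truncMap hx h h1, PowerSeries.order_eq_nat, and_comm]
  refine and_congr_right' ⟨fun h2 j hj => ?_, ?_⟩
  · exact (coord_zero_mem_truncMap hx h (by omega)).1 (h2 ⟨j, hj, rfl⟩)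
  · rintro h2 _ ⟨j, hj, rfl⟩
    exact (coord_zero_mem_truncMap hx h (by omega)).2 (h2 j hj)

theorem jetPoint_mem_B (hD : IsBranchData g β b) (hx : IsJet g β b m x)
    (h : l * n β b 0 * n β b 1 ≤ m) :
    jetPoint x hx ∈ B g β b m l h ↔ ∀ j ≤ l * n β b 1, PowerSeries.coeff j (x 0) = 0 := by
  have h1 := mul_n_one_le hD l
  rw [B, Set.mem_preimage, PrimeSpectrum.mem_zeroLocus]
  refine ⟨fun h2 j hj => ?_, ?_⟩
  · exact (coord_zero_mem_truncMap hx h (by omega)).1 (h2 ⟨j, hj, rfl⟩)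
  · rintro h2 _ ⟨j, hj, rfl⟩
    exact (coord_zero_mem_truncMap hx h (by omega)).2 (h2 j hj)

omit [IsDomain K] [Algebra ℂ K] in
theorem IsJet.coeff_eq (hx : IsJet g β b m x) {i d : ℕ} (h1 : 1 ≤ i) (hi : i ≤ g) (hd : d ≤ m) :
    PowerSeries.coeff d (x i ^ n β b i) =
      PowerSeries.coeff d (∏ p ∈ Finset.range i, x p ^ b i p) := by
  have := PowerSeries.X_pow_dvd_iff.1 (hx i h1 hi) d (by omega)
  rwa [map_sub, sub_eq_zero] at this

omit [Algebra ℂ K] in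
theorem IsJet.order_pow_eq (hx : IsJet g β b m x) {i A : ℕ} (h1 : 1 ≤ i) (hi : i ≤ g) (hA : A ≤ m)
    (h : (∏ p ∈ Finset.range i, x p ^ b i p).order = A) :
    n β b i • (x i).order = A := by
  rw [← PowerSeries.order_pow]
  rw [PowerSeries.order_eq_nat] at h ⊢
  refine ⟨?_, fun d hd => ?_⟩
  · rw [hx.coeff_eq h1 hi hA]; exact h.1
  · rw [hx.coeff_eq h1 hi (by omega)]; exact h.2 d hd

theorem order_eq_of_nsmul {R : Type*} [Semiring R] {f : PowerSeries R} {n A : ℕ}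
    (hn : n ≠ 0) (h : n • f.order = (A : ℕ∞)) : ∃ a : ℕ, f.order = a ∧ n * a = A := by
  have h1 : f.order ≠ ⊤ := by
    intro h2
    rw [h2, nsmul_eq_mul, ENat.mul_top (by exact_mod_cast hn)] at h
    exact ENat.top_ne_natCast A h
  obtain ⟨a, ha⟩ := ENat.ne_top_iff_exists.1 h1
  refine ⟨a, ha.symm, ?_⟩
  rw [← ha, nsmul_eq_mul] at h
  exact_mod_cast h

omit [Algebra ℂ K] in
/-- The orders of the coordinates of a jet in `D_{m,k}`. -/
theorem IsJet.exists_order (hD : IsBranchData g β b) (hx : IsJet g β b m x)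
    (h0 : (x 0).order = (k * n β b 1 : ℕ)) (i : ℕ) (hi : i ≤ g)
    (hk : 1 ≤ i → k * (n β b i * β i) ≤ m * e β 1) :
    ∃ a : ℕ, (x i).order = a ∧ a * e β 1 = k * β i := by
  induction i using Nat.strong_induction_on with
  | _ i ih =>
  rcases Nat.eq_zero_or_pos i with rfl | h1
  · exact ⟨_, h0, by rw [mul_assoc, IsBranchData.n_one_mul]⟩
  have h2 : ∀ p, ∃ a : ℕ, p < i → (x p).order = a ∧ a * e β 1 = k * β p := by
    intro p
    by_cases hp : p < i
    -- The numbers `n_p β_p` increase for `p ≥ 1`, so the precision condition passes to smaller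
    -- indices.
    · obtain ⟨a, ha⟩ := ih p hp (by omega) fun hp1 =>
        (Nat.mul_le_mul_left k (hD.n_mul_beta_lt hp1 hp hi).le).trans (hk h1)
      exact ⟨a, fun _ => ha⟩
    · exact ⟨0, fun h => absurd h hp⟩
  choose a ha using h2
  have h3 : (∏ p ∈ Finset.range i, x p ^ b i p).order =
      (∑ p ∈ Finset.range i, b i p * a p : ℕ) := by
    rw [PowerSeries.order_prod]
    push_cast
    refine Finset.sum_congr rfl fun p hp => ?_
    rw [PowerSeries.order_pow, (ha p (Finset.mem_range.1 hp)).1, nsmul_eq_mul]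
  have h4 : (∑ p ∈ Finset.range i, b i p * a p) * e β 1 = k * (n β b i * β i) := by
    rw [(hD.sys i h1 hi).2, Finset.sum_mul, Finset.mul_sum]
    refine Finset.sum_congr rfl fun p hp => ?_
    rw [mul_assoc, (ha p (Finset.mem_range.1 hp)).2]
    ring
  have h5 : ∑ p ∈ Finset.range i, b i p * a p ≤ m := by
    refine Nat.le_of_mul_le_mul_right ?_ hD.e_one_pos
    rw [h4]; exact hk h1
  obtain ⟨c, hc, hc'⟩ := order_eq_of_nsmul (hD.n_pos hi).ne' (hx.order_pow_eq h1 hi h5 h3)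
  refine ⟨c, hc, Nat.eq_of_mul_eq_mul_left (hD.n_pos hi) ?_⟩
  rw [← mul_assoc, hc', h4]
  ring

-- The orders `k β_i / e_1` are integers wherever the equations determine them, so nonemptiness of
-- the stratum already implies the bound.
omit [Algebra ℂ K] in
theorem IsJet.belowBound (hD : IsBranchData g β b) (hx : IsJet g β b m x)
    (h0 : (x 0).order = (k * n β b 1 : ℕ)) : BelowBound g β b m k := by
  refine hD.belowBound_of_dvd fun i _ hi hk => ?_
  obtain ⟨a, -, ha⟩ := hx.exists_order hD h0 i hi fun _ => hk
  exact ⟨a, by rw [← ha, mul_comm]⟩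

omit [Algebra ℂ K] in
theorem IsJet.coeff_zero_eq_zero (hD : IsBranchData g β b) (hx : IsJet g β b m x)
    (h0 : PowerSeries.coeff 0 (x 0) = 0) {i : ℕ} (hi : i ≤ g) : PowerSeries.coeff 0 (x i) = 0 := by
  rcases Nat.eq_zero_or_pos i with rfl | h1
  · exact h0
  have h2 := hx.coeff_eq h1 hi (Nat.zero_le m)
  simp only [PowerSeries.coeff_zero_eq_constantCoeff, map_pow, map_prod] at h0 h2 ⊢
  rw [Finset.prod_eq_zero (Finset.mem_range.2 h1)] at h2
  · exact eq_zero_of_pow_eq_zero h2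
  · rw [h0, zero_pow]
    have := hD.n_zero_le h1 hi
    have := hD.n_pos (Nat.zero_le g)
    omega

-- The first equation gives `n_1 ord x_1 = n_0 c`, and `n_0`, `n_1` are coprime.
omit [Algebra ℂ K] in
theorem IsJet.n_one_dvd_order (hD : IsBranchData g β b) (hx : IsJet g β b m x) {c : ℕ}
    (h0 : (x 0).order = c) (hc : n β b 0 * c ≤ m) : n β b 1 ∣ c := by
  have h1 : (∏ p ∈ Finset.range 1, x p ^ b 1 p).order = (n β b 0 * c : ℕ) := by
    rw [Finset.prod_range_one, PowerSeries.order_pow, h0, nsmul_eq_mul]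
    rfl
  obtain ⟨a, -, ha⟩ := order_eq_of_nsmul (hD.n_pos hD.one_le).ne'
    (hx.order_pow_eq le_rfl hD.one_le hc h1)
  exact hD.coprime.symm.dvd_of_dvd_mul_left ⟨a, ha.symm⟩

theorem D_subset_fiberZero (hD : IsBranchData g β b) (hk : 1 ≤ k)
    (h : k * n β b 0 * n β b 1 ≤ m) : D g β b m k h ⊆ fiberZero (curveEq g β b) m := by
  intro p hp
  obtain ⟨K, _, _, _, x, hx, rfl⟩ := exists_jetPoint p
  rw [jetPoint_mem_D hD, PowerSeries.order_eq_nat] at hp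
  rw [jetPoint_mem_fiberZero]
  exact fun i hi => hx.coeff_zero_eq_zero hD
    (hp.2 0 (Nat.mul_pos hk (hD.n_pos hD.one_le))) hi

theorem B_subset_fiberZero (hD : IsBranchData g β b) (h : l * n β b 0 * n β b 1 ≤ m) :
    B g β b m l h ⊆ fiberZero (curveEq g β b) m := by
  intro p hp
  obtain ⟨K, _, _, _, x, hx, rfl⟩ := exists_jetPoint p
  rw [jetPoint_mem_B hD] at hp
  rw [jetPoint_mem_fiberZero]
  exact fun i hi => hx.coeff_zero_eq_zero hD (hp 0 (Nat.zero_le _)) hi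

theorem fiberZero_subset (hD : IsBranchData g β b) (hlm : l * n β b 0 * n β b 1 < m)
    {p : JetSpace (curveEq g β b) m} (hp : p ∈ fiberZero (curveEq g β b) m) :
    p ∈ B g β b m l hlm.le ∨ ∃ k, ∃ h : k * n β b 0 * n β b 1 ≤ m, 1 ≤ k ∧ k ≤ l ∧
      BelowBound g β b m k ∧ p ∈ D g β b m k h := by
  obtain ⟨K, _, _, _, x, hx, rfl⟩ := exists_jetPoint p
  rw [jetPoint_mem_fiberZero] at hp
  rw [jetPoint_mem_B hD]
  by_contra! hne
  obtain ⟨⟨j, hj, hj0⟩, hne⟩ := hne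
  obtain ⟨c, hc⟩ := ENat.ne_top_iff_exists.1
    (show (x 0).order ≠ ⊤ from fun h => by
      rw [PowerSeries.order_eq_top] at h; rw [h, map_zero] at hj0; exact hj0 rfl)
  have hcj : c ≤ j := by
    have := PowerSeries.order_le j hj0
    rw [← hc] at this
    exact_mod_cast this
  have h1 : n β b 0 * c ≤ m := by
    refine le_trans ?_ hlm.le
    rw [mul_comm l, mul_assoc]
    exact Nat.mul_le_mul_left _ (hcj.trans hj)
  obtain ⟨k, hk⟩ := hx.n_one_dvd_order hD hc.symm h1
  have hkl : k ≤ l := by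
    refine Nat.le_of_mul_le_mul_left ?_ (hD.n_pos hD.one_le)
    rw [← hk, mul_comm _ l]; exact hcj.trans hj
  have h2 : k * n β b 0 * n β b 1 ≤ m :=
    (Nat.mul_le_mul_right _ (Nat.mul_le_mul_right _ hkl)).trans hlm.le
  have h3 : (x 0).order = (k * n β b 1 : ℕ) := by rw [← hc, hk, mul_comm]
  have hk1 : 1 ≤ k := by
    by_contra h0
    obtain rfl : k = 0 := by omega
    rw [zero_mul, PowerSeries.order_eq_nat] at h3
    exact h3.1 (hp 0 (Nat.zero_le g))
  exact hne k h2 hk1 hkl (hx.belowBound hD h3) ((jetPoint_mem_D hD hx h2).2 h3)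

end Strata

/-! ### Extracting a common root of the leading units -/

section Roots

theorem exists_pow_eq_of_coprime {K : Type*} [Field K] {ζ : K} {n w : ℕ} (hn : 0 < n)
    (hζ : ζ ^ n = 1) (hw : Nat.Coprime w n) : ∃ ξ : K, ξ ^ n = 1 ∧ ξ ^ w = ζ := by
  rcases Nat.eq_or_lt_of_le (Nat.succ_le_of_lt hn) with h1 | h1
  · rw [← h1] at hζ
    have : ζ = 1 := by simpa using hζ
    exact ⟨1, one_pow _, by rw [one_pow, this]⟩
  obtain ⟨c, -, hc⟩ := Nat.exists_mul_mod_eq_one_of_coprime hw h1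
  refine ⟨ζ ^ c, by rw [← pow_mul, mul_comm, pow_mul, hζ, one_pow], ?_⟩
  rw [← pow_mul, mul_comm, ← Nat.div_add_mod (w * c) n, hc, pow_add, pow_mul, hζ, one_pow, one_mul,
    pow_one]

/-- A point of the curve `u ^ n = v ^ w` is of the form `(ε ^ w, ε ^ n)`. -/
theorem exists_pow_eq_and_pow_eq {K : Type*} [Field K] [IsAlgClosed K] {u v : K} {n w : ℕ}
    (hn : 0 < n) (hw0 : 0 < w) (h : u ^ n = v ^ w) (hw : Nat.Coprime w n) :
    ∃ ε : K, u = ε ^ w ∧ v = ε ^ n := by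
  by_cases hv : v = 0
  · rw [hv, zero_pow hw0.ne'] at h
    exact ⟨0, by rw [eq_zero_of_pow_eq_zero h, zero_pow hw0.ne'], by rw [hv, zero_pow hn.ne']⟩
  obtain ⟨s, hs⟩ := IsAlgClosed.exists_pow_nat_eq v hn
  have hs0 : s ≠ 0 := by rintro rfl; rw [zero_pow hn.ne'] at hs; exact hv hs.symm
  obtain ⟨ξ, h1, h2⟩ := exists_pow_eq_of_coprime (ζ := u / s ^ w) hn
    (by rw [div_pow, h, ← hs, ← pow_mul, ← pow_mul, mul_comm, div_self (pow_ne_zero _ hs0)]) hw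
  refine ⟨ξ * s, ?_, ?_⟩
  · rw [mul_pow, h2, div_mul_cancel₀ _ (pow_ne_zero _ hs0)]
  · rw [mul_pow, h1, hs, one_mul]

variable {K : Type*} [Field K]

theorem dvd_sub_iff_mk {R : Type*} [CommRing R] {d u v : R} :
    d ∣ u - v ↔ Ideal.Quotient.mk (Ideal.span {d}) u = Ideal.Quotient.mk (Ideal.span {d}) v := by
  rw [Ideal.Quotient.eq, Ideal.mem_span_singleton]

theorem dvd_prod_sub_prod {R ι : Type*} [CommRing R] {d : R} (s : Finset ι) {u v : ι → R}
    (a : ι → ℕ) (h : ∀ i ∈ s, d ∣ u i - v i) : d ∣ ∏ i ∈ s, u i ^ a i - ∏ i ∈ s, v i ^ a i := by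
  rw [dvd_sub_iff_mk, map_prod, map_prod]
  refine Finset.prod_congr rfl fun i hi => ?_
  rw [map_pow, map_pow, dvd_sub_iff_mk.1 (h i hi)]

/-- Newton's method: the derivative `n s₀ ^ (n - 1)` is nonzero, so one more coefficient can always
be corrected. -/
theorem exists_X_pow_dvd_pow_sub [IsAlgClosed K] [CharZero K] {v : PowerSeries K}
    (hv : PowerSeries.constantCoeff v ≠ 0) {n : ℕ} (hn : 0 < n) (N : ℕ) :
    ∃ s : PowerSeries K, PowerSeries.constantCoeff s ^ n = PowerSeries.constantCoeff v ∧
      PowerSeries.X ^ N ∣ s ^ n - v := by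
  induction N with
  | zero =>
    obtain ⟨s, hs⟩ := IsAlgClosed.exists_pow_nat_eq (PowerSeries.constantCoeff v) hn
    exact ⟨PowerSeries.C s, by simpa using hs, by simp⟩
  | succ N ih =>
    rcases Nat.eq_zero_or_pos N with rfl | hN
    · obtain ⟨s, hs⟩ := IsAlgClosed.exists_pow_nat_eq (PowerSeries.constantCoeff v) hn
      refine ⟨PowerSeries.C s, by simpa using hs, ?_⟩
      rw [zero_add, pow_one, PowerSeries.X_dvd_iff]
      simp [hs]
    obtain ⟨s, hs, q, hq⟩ := ih
    have hs0 : PowerSeries.constantCoeff s ≠ 0 := by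
      intro h; rw [h, zero_pow hn.ne'] at hs; exact hv hs.symm
    set s₀ := PowerSeries.constantCoeff s with hs₀
    have h2 : (n : K) * s₀ ^ (n - 1) ≠ 0 :=
      mul_ne_zero (by exact_mod_cast hn.ne') (pow_ne_zero _ hs0)
    obtain ⟨c, hc⟩ : ∃ c : K, n * s₀ ^ (n - 1) * c = -PowerSeries.constantCoeff q :=
      ⟨_, mul_div_cancel₀ _ h2⟩
    refine ⟨s + PowerSeries.X ^ N * PowerSeries.C c, ?_, ?_⟩
    · simp [← hs₀, hN.ne', hs]
    obtain ⟨r, hr⟩ := Polynomial.powAddExpansion s (PowerSeries.X ^ N * PowerSeries.C c) n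
    have h1 : (s + PowerSeries.X ^ N * PowerSeries.C c) ^ n - v =
        PowerSeries.X ^ N * (q + (n : PowerSeries K) * s ^ (n - 1) * PowerSeries.C c +
          PowerSeries.X ^ N * (r * PowerSeries.C c ^ 2)) := by
      rw [hr, show v = s ^ n - PowerSeries.X ^ N * q by rw [← hq]; ring]
      ring
    rw [h1, pow_succ]
    refine mul_dvd_mul_left _ ?_
    rw [PowerSeries.X_dvd_iff]
    simp only [map_add, map_mul, map_pow, PowerSeries.constantCoeff_X, PowerSeries.constantCoeff_C,
      map_natCast, zero_pow hN.ne', zero_mul, add_zero, ← hs₀, hc]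
    exact add_neg_cancel _

/-- With `ζ` the quotient of the constant terms and `z = ζ v`, the cofactor of `u - z` in `u ^ n - z
^ n` has constant term `n u₀ ^ (n - 1)`, a unit. -/
theorem exists_root_of_unity_mul [CharZero K] {u v : PowerSeries K} {n N : ℕ} (hn : 0 < n)
    (hN : 0 < N) (hv : PowerSeries.constantCoeff v ≠ 0) (h : PowerSeries.X ^ N ∣ u ^ n - v ^ n) :
    ∃ ζ : K, ζ ^ n = 1 ∧ PowerSeries.X ^ N ∣ u - PowerSeries.C ζ * v := by
  set u₀ := PowerSeries.constantCoeff u with hu₀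
  set v₀ := PowerSeries.constantCoeff v with hv₀
  have h0 : u₀ ^ n = v₀ ^ n := by
    have := (dvd_pow_self PowerSeries.X hN.ne').trans h
    rw [PowerSeries.X_dvd_iff, map_sub, map_pow, map_pow, sub_eq_zero] at this
    exact this
  have hζ : (u₀ / v₀) ^ n = 1 := by rw [div_pow, h0, div_self (pow_ne_zero _ hv)]
  have hu0 : u₀ ≠ 0 := by
    intro h1
    rw [h1, zero_pow hn.ne'] at h0
    exact pow_ne_zero _ hv h0.symm
  refine ⟨u₀ / v₀, hζ, ?_⟩
  set z := PowerSeries.C (u₀ / v₀) * v with hz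
  have hz0 : PowerSeries.constantCoeff z = u₀ := by
    rw [hz, map_mul, PowerSeries.constantCoeff_C, ← hv₀, div_mul_cancel₀ _ hv]
  have h1 : z ^ n = v ^ n := by rw [hz, mul_pow, ← map_pow, hζ, map_one, one_mul]
  rw [← h1, ← geom_sum₂_mul] at h
  refine (IsUnit.dvd_mul_left ?_).1 h
  rw [PowerSeries.isUnit_iff_constantCoeff, map_sum, isUnit_iff_ne_zero]
  have h2 : ∀ i ∈ Finset.range n, PowerSeries.constantCoeff (u ^ i * z ^ (n - 1 - i)) =
      u₀ ^ (n - 1) := by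
    intro i hi
    rw [map_mul, map_pow, map_pow, hz0, ← hu₀, ← pow_add]
    congr 1
    have := Finset.mem_range.1 hi
    omega
  rw [Finset.sum_congr rfl h2, Finset.sum_const, Finset.card_range, nsmul_eq_mul]
  exact mul_ne_zero (by exact_mod_cast hn.ne') (pow_ne_zero _ hu0)

variable {g : ℕ} {β : ℕ → ℕ} {b : ℕ → ℕ → ℕ}

/-- Units satisfying the equations of the curve up to decreasing orders are, to these orders, the
powers of one unit. -/
theorem IsBranchData.exists_common_root [IsAlgClosed K] [CharZero K] (D : IsBranchData g β b)
    {v : ℕ → PowerSeries K} {N : ℕ → ℕ} (r : ℕ) (hr : r ≤ g)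
    (hv : ∀ i ≤ r, PowerSeries.constantCoeff (v i) ≠ 0)
    (hN : ∀ i ≤ r, ∀ p ≤ i, N i ≤ N p)
    (h : ∀ i, 1 ≤ i → i ≤ r → PowerSeries.X ^ N i ∣
      v i ^ n β b i - ∏ p ∈ Finset.range i, v p ^ b i p) :
    ∃ s : PowerSeries K, PowerSeries.constantCoeff s ≠ 0 ∧
      ∀ i ≤ r, PowerSeries.X ^ N i ∣ s ^ (β i / e β r) - v i := by
  induction r with
  | zero =>
    refine ⟨v 0, hv 0 le_rfl, fun i hi => ?_⟩
    obtain rfl : i = 0 := by omega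
    rw [e_zero, Nat.div_self D.pos, pow_one, sub_self]
    exact dvd_zero _
  | succ r ih =>
    obtain ⟨s', hs'0, hs'⟩ := ih (by omega) (fun i hi => hv i (by omega))
      (fun i hi => hN i (by omega)) (fun i h1 hi => h i h1 (by omega))
    have hn : 0 < n β b (r + 1) := D.n_pos hr
    have hw : ∀ i ≤ r, β i / e β (r + 1) = n β b (r + 1) * (β i / e β r) := by
      intro i hi
      obtain ⟨c, hc⟩ := e_dvd β hi
      rw [hc, Nat.mul_div_cancel_left _ (e_pos D.pos r), ← n_mul_e β b r,
        mul_right_comm, Nat.mul_div_cancel _ (e_pos D.pos _)]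
    -- Passing from `r` to `r + 1` multiplies the exponents `β i / e` by `n (r + 1)`, so a root of
    -- the old unit is needed; `N 0` is the largest of the precisions.
    obtain ⟨s, hs0, hs⟩ := exists_X_pow_dvd_pow_sub hs'0 hn (N 0)
    have hs1 : PowerSeries.constantCoeff s ≠ 0 := by
      intro h1; rw [h1, zero_pow hn.ne'] at hs0; exact hs'0 hs0.symm
    -- any `n`-th root of `s'` does the job for the first units
    have key : ∀ z : PowerSeries K, z ^ n β b (r + 1) = s ^ n β b (r + 1) → ∀ i ≤ r,
        PowerSeries.X ^ N i ∣ z ^ (β i / e β (r + 1)) - v i := by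
      intro z hz i hi
      rw [hw i hi, pow_mul, hz]
      have h1 : PowerSeries.X ^ N i ∣ (s ^ n β b (r + 1)) ^ (β i / e β r) - s' ^ (β i / e β r) :=
        (pow_dvd_pow _ (hN i (by omega) 0 (by omega))).trans
          (hs.trans (sub_dvd_pow_sub_pow _ _ _))
      simpa using dvd_add h1 (hs' i hi)
    rcases Nat.eq_zero_or_pos (N (r + 1)) with hN0 | hN0
    · refine ⟨s, hs1, fun i hi => ?_⟩
      rcases Nat.lt_or_ge r i with h1 | h1
      · obtain rfl : i = r + 1 := by omega
        simp [hN0]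
      · exact key s rfl i h1
    set w := β (r + 1) / e β (r + 1) with hwdef
    have hsum : ∑ p ∈ Finset.range (r + 1), (β p / e β (r + 1)) * b (r + 1) p =
        w * n β b (r + 1) := by
      refine Nat.eq_of_mul_eq_mul_right (e_pos D.pos (r + 1)) ?_
      rw [mul_right_comm, hwdef, Nat.div_mul_cancel (e_dvd β le_rfl), mul_comm (β (r + 1)),
        (D.sys (r + 1) (by omega) hr).2, Finset.sum_mul]
      refine Finset.sum_congr rfl fun p hp => ?_
      rw [mul_right_comm, Nat.div_mul_cancel (e_dvd β (by have := Finset.mem_range.1 hp; omega)),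
        mul_comm]
    have h1 : PowerSeries.X ^ N (r + 1) ∣
        v (r + 1) ^ n β b (r + 1) - (s ^ w) ^ n β b (r + 1) := by
      have h2 : PowerSeries.X ^ N (r + 1) ∣ ∏ p ∈ Finset.range (r + 1),
          (s ^ (β p / e β (r + 1))) ^ b (r + 1) p - ∏ p ∈ Finset.range (r + 1), v p ^ b (r + 1) p :=
        dvd_prod_sub_prod _ _ fun p hp => by
          have := Finset.mem_range.1 hp
          exact (pow_dvd_pow _ (hN (r + 1) le_rfl p (by omega))).trans (key s rfl p (by omega))
      rw [← pow_mul, ← hsum, ← Finset.prod_pow_eq_pow_sum]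
      simp only [pow_mul]
      have := dvd_sub (h (r + 1) (by omega) le_rfl) h2
      simpa using this
    obtain ⟨ζ, hζ, h2⟩ := exists_root_of_unity_mul hn hN0
      (by rw [map_pow]; exact pow_ne_zero _ hs1) h1
    -- Multiplying `s` by `ξ` keeps `s ^ n (r + 1)`, hence the earlier congruences, and `ξ ^ w = ζ`
    -- adjusts the last one.
    obtain ⟨ξ, hξ, hξw⟩ := exists_pow_eq_of_coprime hn hζ (coprime_n b D.pos r).symm
    refine ⟨PowerSeries.C ξ * s, ?_, fun i hi => ?_⟩
    · rw [map_mul, PowerSeries.constantCoeff_C]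
      refine mul_ne_zero ?_ hs1
      rintro rfl
      rw [zero_pow hn.ne'] at hξ
      exact zero_ne_one hξ
    rcases Nat.lt_or_ge r i with h3 | h3
    · obtain rfl : i = r + 1 := by omega
      rw [mul_pow, ← map_pow, hξw, dvd_sub_comm]
      exact h2
    · refine key _ ?_ i h3
      rw [mul_pow, ← map_pow, hξ, map_one, one_mul]

end Roots

/-! ### Generic jets and their specializations -/

section Generic

/-- The indices of the coefficients of order at least `T i` of the coordinates of a jet. -/
abbrev freeIndex (g m : ℕ) (T : ℕ → ℕ) : Finset (Σ _ : ℕ, ℕ) :=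
  (Finset.range (g + 1)).sigma fun i => Finset.Ico (T i) (m + 1)

/-- The family of series agreeing with `y i` up to order `T i`, and with independent coefficients
from there on. -/
noncomputable def genericSeries {σ : Type} (g m : ℕ) (T : ℕ → ℕ)
    (y : ℕ → PowerSeries (MvPolynomial σ ℂ)) (i : ℕ) :
    PowerSeries (MvPolynomial (σ ⊕ freeIndex g m T) ℂ) :=
  PowerSeries.mk fun j => if h : (⟨i, j⟩ : Σ _ : ℕ, ℕ) ∈ freeIndex g m T then
    MvPolynomial.X (Sum.inr ⟨_, h⟩) else MvPolynomial.rename Sum.inl (PowerSeries.coeff j (y i))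

variable {σ : Type} {g m : ℕ} {T : ℕ → ℕ} {y : ℕ → PowerSeries (MvPolynomial σ ℂ)}

theorem X_pow_dvd_genericSeries_sub (i : ℕ) :
    PowerSeries.X ^ T i ∣ genericSeries g m T y i - PowerSeries.map
      (MvPolynomial.rename Sum.inl : MvPolynomial σ ℂ →ₐ[ℂ] _).toRingHom (y i) := by
  rw [PowerSeries.X_pow_dvd_iff]
  intro d hd
  rw [map_sub, genericSeries, PowerSeries.coeff_mk, dif_neg, PowerSeries.coeff_map, sub_eq_zero]
  · rfl
  · simp only [Finset.mem_sigma, Finset.mem_Ico]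
    omega

/-- The coefficients from order `T i` on are independent variables, so only those below need to
match. -/
theorem exists_specialization {K : Type} [CommRing K] [Algebra ℂ K] {x : ℕ → PowerSeries K}
    (θ : σ → K) (h : ∀ i ≤ g, PowerSeries.X ^ T i ∣
      x i - PowerSeries.map (MvPolynomial.aeval θ : MvPolynomial σ ℂ →ₐ[ℂ] K).toRingHom (y i)) :
    ∃ f : MvPolynomial (σ ⊕ freeIndex g m T) ℂ →ₐ[ℂ] K, ∀ i ≤ g, ∀ j ≤ m,
      f (PowerSeries.coeff j (genericSeries g m T y i)) = PowerSeries.coeff j (x i) := by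
  refine ⟨MvPolynomial.aeval (Sum.elim θ fun p => PowerSeries.coeff p.1.2 (x p.1.1)),
    fun i hi j hj => ?_⟩
  rw [genericSeries, PowerSeries.coeff_mk]
  split_ifs with hmem
  · rw [MvPolynomial.aeval_X]
    rfl
  · rw [MvPolynomial.aeval_rename, Sum.elim_comp_inl]
    have hlt : j < T i := by
      simp only [Finset.mem_sigma, Finset.mem_range, Finset.mem_Ico] at hmem
      omega
    have := PowerSeries.X_pow_dvd_iff.1 (h i hi) j hlt
    rw [map_sub, PowerSeries.coeff_map, sub_eq_zero] at this
    exact this.symm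

theorem card_freeIndex : (freeIndex g m T).card = ∑ i ∈ Finset.range (g + 1), (m + 1 - T i) := by
  rw [Finset.card_sigma]
  simp

/-- Specialization of coefficients gives inclusion of kernels, so a jet in `Z` which specializes to
all jets in `Z` is a generic point of its closure. This is the source of every irreducibility
statement about strata. -/
theorem closure_eq_of_specialization {b : ℕ → ℕ → ℕ} {β : ℕ → ℕ} {S : Type} [CommRing S] [IsDomain S]
    [Algebra ℂ S] {X : ℕ → PowerSeries S} (hX : IsJet g β b m X)
    {Z : Set (JetSpace (curveEq g β b) m)} (hmem : jetPoint X hX ∈ Z)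
    (h : ∀ (K : Type) [Field K] [Algebra ℂ K] [IsAlgClosed K] (x : ℕ → PowerSeries K)
      (hx : IsJet g β b m x), jetPoint x hx ∈ Z → ∃ f : S →ₐ[ℂ] K, ∀ i ≤ g, ∀ j ≤ m,
        f (PowerSeries.coeff j (X i)) = PowerSeries.coeff j (x i)) :
    closure Z = closure {jetPoint X hX} := by
  refine Set.Subset.antisymm (closure_minimal ?_ isClosed_closure)
    (closure_mono (Set.singleton_subset_iff.2 hmem))
  intro p hp
  obtain ⟨K, _, _, _, x, hx, rfl⟩ := exists_jetPoint p
  obtain ⟨f, hf⟩ := h K x hx hp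
  rw [PrimeSpectrum.closure_singleton, PrimeSpectrum.mem_zeroLocus]
  exact jetPoint_le_of_specialization hX hx f hf

end Generic

theorem X_pow_dvd_iff_le_order {R : Type*} [CommSemiring R] {f : PowerSeries R} {d : ℕ} :
    PowerSeries.X ^ d ∣ f ↔ (d : ℕ∞) ≤ f.order := by
  rw [PowerSeries.X_pow_dvd_iff]
  exact ⟨fun h => PowerSeries.nat_le_order _ _ h, fun h i hi =>
    PowerSeries.coeff_of_lt_order _ ((by exact_mod_cast hi : (i : ℕ∞) < d).trans_le h)⟩

theorem X_pow_dvd_pow_iff {R : Type*} [CommRing R] [IsDomain R] {f : PowerSeries R} {n d : ℕ}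
    (hn : 0 < n) : PowerSeries.X ^ (d + 1) ∣ f ^ n ↔ PowerSeries.X ^ (d / n + 1) ∣ f := by
  rw [X_pow_dvd_iff_le_order, X_pow_dvd_iff_le_order, PowerSeries.order_pow, nsmul_eq_mul]
  induction f.order with
  | top => simp [ENat.mul_top (by exact_mod_cast hn.ne' : (n : ℕ∞) ≠ 0)]
  | coe c =>
    norm_cast
    rw [Nat.add_one_le_iff, Nat.add_one_le_iff, Nat.div_lt_iff_lt_mul hn, mul_comm]

theorem dvd_prod_pow {R ι : Type*} [CommRing R] (t : R) (s : Finset ι) {x : ι → R} (a c : ι → ℕ)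
    (h : ∀ i ∈ s, t ^ a i ∣ x i) : t ^ (∑ i ∈ s, c i * a i) ∣ ∏ i ∈ s, x i ^ c i := by
  rw [← Finset.prod_pow_eq_pow_sum]
  refine Finset.prod_dvd_prod_of_dvd _ _ fun i hi => ?_
  rw [mul_comm, pow_mul]
  exact pow_dvd_pow_of_dvd (h i hi) _

/-! ### Precisions on the strata `D_{m,k}` -/

section StratumNumerics

/-- `r` is the cutoff index of `k`, and `k e_{r-1} = κ e_1`. -/
structure IsParam (g : ℕ) (β : ℕ → ℕ) (b : ℕ → ℕ → ℕ) (m k r κ : ℕ) : Prop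
    extends IsCutoff g β b m k r where
  eq : k * e β (r - 1) = κ * e β 1

/-- The order `k β_i / e_1` of the coordinate `x_i` on `D_{m,k}`. -/
def stratumOrder (β : ℕ → ℕ) (r κ i : ℕ) : ℕ := κ * (β i / e β (r - 1))

/-- The precision to which `x_i`, divided by its leading power of `t`, is determined by the
preceding coordinates on `D_{m,k}`. -/
def slack (β : ℕ → ℕ) (b : ℕ → ℕ → ℕ) (m r κ i : ℕ) : ℕ :=
  -- No equation has `x_0` as its leading variable. The factor `1` makes its order plus slack equal
  -- to `m + 1`, so all its coefficients are carried by the common unit.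
  m + 1 - (if i = 0 then 1 else n β b i) * stratumOrder β r κ i

/-- The order from which the coefficients of `x_i` are free on `D_{m,k}`. -/
def freeFrom (β : ℕ → ℕ) (b : ℕ → ℕ → ℕ) (m r κ i : ℕ) : ℕ :=
  if i < r then stratumOrder β r κ i + slack β b m r κ i else m / n β b i + 1

variable {g : ℕ} {β : ℕ → ℕ} {b : ℕ → ℕ → ℕ} {m k r κ : ℕ}

namespace IsParam

variable (P : IsParam g β b m k r κ) (hD : IsBranchData g β b)
include P

theorem order_mul_e {i : ℕ} (hi : i < r) : stratumOrder β r κ i * e β 1 = k * β i := by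
  rw [stratumOrder, mul_right_comm, ← P.eq, mul_assoc, Nat.mul_div_cancel' (e_dvd β (by omega))]

theorem index_le {i : ℕ} (hi : i < r) : i ≤ g := by have := P.le; omega

include hD

theorem order_zero : stratumOrder β r κ 0 = k * n β b 1 := by
  refine Nat.eq_of_mul_eq_mul_right hD.e_one_pos ?_
  rw [P.order_mul_e (by have := P.two_le; omega), mul_assoc, IsBranchData.n_one_mul]

theorem order_one : stratumOrder β r κ 1 = k * n β b 0 := by
  refine Nat.eq_of_mul_eq_mul_right hD.e_one_pos ?_
  rw [P.order_mul_e (by have := P.two_le; omega), mul_assoc, hD.n_zero_mul]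

theorem n_mul_order_le {i : ℕ} (h1 : 1 ≤ i) (hi : i < r) :
    n β b i * stratumOrder β r κ i ≤ m := by
  refine Nat.le_of_mul_le_mul_right ?_ hD.e_one_pos
  rw [mul_assoc, P.order_mul_e hi, mul_left_comm]
  exact P.below i h1 hi

theorem n_mul_order_mono {i j : ℕ} (h1 : 1 ≤ i) (hij : i ≤ j) (hj : j < r) :
    n β b i * stratumOrder β r κ i ≤ n β b j * stratumOrder β r κ j := by
  rcases hij.eq_or_lt with rfl | h
  · exact le_rfl
  refine Nat.le_of_mul_le_mul_right ?_ hD.e_one_pos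
  rw [mul_assoc, mul_assoc, P.order_mul_e hj, P.order_mul_e (by omega), mul_left_comm,
    mul_left_comm _ k]
  exact Nat.mul_le_mul_left _ (hD.n_mul_beta_lt h1 h (P.index_le hj)).le

theorem order_zero_le {i : ℕ} (h1 : 1 ≤ i) (hi : i < r) :
    stratumOrder β r κ 0 ≤ n β b i * stratumOrder β r κ i := by
  refine le_trans ?_ (P.n_mul_order_mono hD le_rfl h1 hi)
  rw [P.order_zero hD, P.order_one hD, mul_comm]
  exact Nat.mul_le_mul_left _ (Nat.le_mul_of_pos_right _ (hD.n_pos (Nat.zero_le g)))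

theorem order_zero_le_m : stratumOrder β r κ 0 ≤ m :=
  (P.order_zero_le hD le_rfl P.two_le).trans (P.n_mul_order_le hD le_rfl P.two_le)

theorem slack_zero_pos : 0 < slack β b m r κ 0 := by
  rw [slack, if_pos rfl, one_mul]
  have := P.order_zero_le_m hD
  omega

theorem order_add_slack_zero : stratumOrder β r κ 0 + slack β b m r κ 0 = m + 1 := by
  rw [slack, if_pos rfl, one_mul]
  have := P.order_zero_le_m hD
  omega

theorem n_mul_order_add_slack {i : ℕ} (h1 : 1 ≤ i) (hi : i < r) :
    n β b i * stratumOrder β r κ i + slack β b m r κ i = m + 1 := by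
  rw [slack, if_neg (by omega)]
  have := P.n_mul_order_le hD h1 hi
  omega

theorem slack_anti {p i : ℕ} (hpi : p ≤ i) (hi : i < r) :
    slack β b m r κ i ≤ slack β b m r κ p := by
  rcases Nat.eq_zero_or_pos i with rfl | h1
  · rw [Nat.le_zero.1 hpi]
  rw [slack, slack, if_neg (by omega : i ≠ 0)]
  refine Nat.sub_le_sub_left ?_ _
  split_ifs with hp
  · rw [hp, one_mul]; exact P.order_zero_le hD h1 hi
  · exact P.n_mul_order_mono hD (by omega) hpi hi

theorem sum_mul_div {i : ℕ} (h1 : 1 ≤ i) (hi : i < r) :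
    ∑ p ∈ Finset.range i, b i p * (β p / e β (r - 1)) = n β b i * (β i / e β (r - 1)) := by
  refine Nat.eq_of_mul_eq_mul_right (e_pos hD.pos (r - 1)) ?_
  rw [mul_assoc, Nat.div_mul_cancel (e_dvd β (by omega)), (hD.sys i h1 (P.index_le hi)).2,
    Finset.sum_mul]
  refine Finset.sum_congr rfl fun p hp => ?_
  rw [mul_assoc, Nat.div_mul_cancel (e_dvd β (by have := Finset.mem_range.1 hp; omega))]

theorem sum_mul_order {i : ℕ} (h1 : 1 ≤ i) (hi : i < r) :
    ∑ p ∈ Finset.range i, b i p * stratumOrder β r κ p = n β b i * stratumOrder β r κ i := by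
  simp only [stratumOrder, mul_left_comm _ κ]
  rw [← Finset.mul_sum, P.sum_mul_div hD h1 hi]

/-- From the cutoff on, the first `r` factors of the monomial already have total order above `m`;
the equation reduces to the vanishing of `x_i ^ n_i`. -/
theorem lt_sum_mul_order {i : ℕ} (hi : r ≤ i) (hig : i ≤ g) :
    m + 1 ≤ ∑ p ∈ Finset.range r, b i p * stratumOrder β r κ p := by
  refine Nat.succ_le_of_lt (Nat.lt_of_mul_lt_mul_right (a := e β 1) ?_)
  refine (P.above (hi.trans hig)).trans_le ?_
  refine (Nat.mul_le_mul_left k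
    (hD.le_sum_range (by have := P.two_le; omega) hi hig)).trans (le_of_eq ?_)
  rw [Finset.mul_sum, Finset.sum_mul]
  refine Finset.sum_congr rfl fun p hp => ?_
  rw [mul_assoc, P.order_mul_e (Finset.mem_range.1 hp)]
  ring

end IsParam

theorem X_pow_dvd_pow_of_dvd {S : Type*} [CommRing S] {f : PowerSeries S} {d N : ℕ} (hN : 0 < N)
    (h : PowerSeries.X ^ (d / N + 1) ∣ f) : PowerSeries.X ^ (d + 1) ∣ f ^ N := by
  refine dvd_trans ?_ (pow_dvd_pow_of_dvd h N)
  rw [← pow_mul, mul_comm]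
  exact pow_dvd_pow _ (Nat.lt_mul_div_succ d hN)

variable {S : Type} [CommRing S] {x : ℕ → PowerSeries S}

theorem IsParam.dvd_prod (P : IsParam g β b m k r κ) (hD : IsBranchData g β b)
    (h : ∀ i < r, PowerSeries.X ^ stratumOrder β r κ i ∣ x i) {i : ℕ} (hi : r ≤ i) (hig : i ≤ g) :
    PowerSeries.X ^ (m + 1) ∣ ∏ p ∈ Finset.range i, x p ^ b i p := by
  rw [← Finset.prod_range_mul_prod_Ico _ hi]
  refine Dvd.dvd.mul_right ?_ _
  refine (pow_dvd_pow _ (P.lt_sum_mul_order hD hi hig)).trans ?_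
  exact dvd_prod_pow _ _ _ _ fun p hp => h p (Finset.mem_range.1 hp)

/-- Dividing the equations of the curve by their leading powers of `t`. -/
theorem IsParam.eq_factor (P : IsParam g β b m k r κ) (hD : IsBranchData g β b)
    {v : ℕ → PowerSeries S} (h : ∀ i < r, x i = PowerSeries.X ^ stratumOrder β r κ i * v i)
    {i : ℕ} (h1 : 1 ≤ i) (hi : i < r) :
    x i ^ n β b i - ∏ p ∈ Finset.range i, x p ^ b i p =
      PowerSeries.X ^ (n β b i * stratumOrder β r κ i) *
        (v i ^ n β b i - ∏ p ∈ Finset.range i, v p ^ b i p) := by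
  have h2 : ∏ p ∈ Finset.range i, x p ^ b i p =
      PowerSeries.X ^ (n β b i * stratumOrder β r κ i) * ∏ p ∈ Finset.range i, v p ^ b i p := by
    rw [← P.sum_mul_order hD h1 hi, ← Finset.prod_pow_eq_pow_sum, ← Finset.prod_mul_distrib]
    refine Finset.prod_congr rfl fun p hp => ?_
    rw [h p (by have := Finset.mem_range.1 hp; omega), mul_pow, ← pow_mul, mul_comm (b i p)]
  rw [h2, h i hi, mul_pow, ← pow_mul, mul_comm (stratumOrder _ _ _ _), mul_sub]

/-- Powers `(t ^ κ s) ^ (β_i / e_{r-1})` satisfy the first equations exactly, and changing `x_i`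
from order `freeFrom` on affects them only beyond `t ^ m`. -/
theorem IsParam.isJet_of_dvd (P : IsParam g β b m k r κ) (hD : IsBranchData g β b)
    (s : PowerSeries S)
    (hlow : ∀ i < r, PowerSeries.X ^ freeFrom β b m r κ i ∣
      x i - (PowerSeries.X ^ κ * s) ^ (β i / e β (r - 1)))
    (hhigh : ∀ i, r ≤ i → i ≤ g → PowerSeries.X ^ freeFrom β b m r κ i ∣ x i) :
    IsJet g β b m x := by
  have h1 : ∀ i, ∃ v, i < r → x i = PowerSeries.X ^ stratumOrder β r κ i * v ∧
      PowerSeries.X ^ slack β b m r κ i ∣ v - s ^ (β i / e β (r - 1)) := by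
    intro i
    by_cases hi : i < r
    · obtain ⟨q, hq⟩ := hlow i hi
      rw [freeFrom, if_pos hi] at hq
      refine ⟨s ^ (β i / e β (r - 1)) + PowerSeries.X ^ slack β b m r κ i * q, fun _ => ⟨?_, ?_⟩⟩
      · rw [sub_eq_iff_eq_add'.1 hq, mul_pow, ← pow_mul, stratumOrder, pow_add]
        ring
      · simp
    · exact ⟨0, fun h => absurd h hi⟩
  choose v hv using h1
  intro i hi1 hig
  rcases Nat.lt_or_ge i r with hi | hi
  · rw [P.eq_factor hD (fun i hi => (hv i hi).1) hi1 hi, ← P.n_mul_order_add_slack hD hi1 hi, pow_add]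
    refine mul_dvd_mul_left _ ?_
    have h2 := ((hv i hi).2).trans (sub_dvd_pow_sub_pow _ _ (n β b i))
    have h3 : PowerSeries.X ^ slack β b m r κ i ∣ ∏ p ∈ Finset.range i, v p ^ b i p -
        ∏ p ∈ Finset.range i, (s ^ (β p / e β (r - 1))) ^ b i p :=
      dvd_prod_sub_prod _ _ fun p hp => by
        have hp := Finset.mem_range.1 hp
        exact (pow_dvd_pow _ (P.slack_anti hD hp.le hi)).trans (hv p (by omega)).2
    have h4 : (s ^ (β i / e β (r - 1))) ^ n β b i =
        ∏ p ∈ Finset.range i, (s ^ (β p / e β (r - 1))) ^ b i p := by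
      simp only [← pow_mul]
      rw [Finset.prod_pow_eq_pow_sum, mul_comm, ← P.sum_mul_div hD hi1 hi]
      simp only [mul_comm]
    rw [← h4] at h3
    have := dvd_sub h2 h3
    simpa using this
  · refine dvd_sub ?_ (P.dvd_prod hD (fun i hi => ⟨_, (hv i hi).1⟩) hi hig)
    have h2 := hhigh i hi hig
    rw [freeFrom, if_neg (by omega)] at h2
    exact X_pow_dvd_pow_of_dvd (hD.n_pos hig) h2

end StratumNumerics

/-! ### The generic jet of `D_{m,k}` -/

section StratumGeneric

theorem order_eq_of_dvd_sub {R : Type*} [CommRing R] {u v : PowerSeries R} {d c : ℕ}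
    (h : PowerSeries.X ^ d ∣ u - v) (hc : c < d) (hv : v.order = c) : u.order = c := by
  have h1 : ∀ i < d, PowerSeries.coeff i u = PowerSeries.coeff i v := fun i hi => by
    have := PowerSeries.X_pow_dvd_iff.1 h i hi
    rwa [map_sub, sub_eq_zero] at this
  rw [PowerSeries.order_eq_nat] at hv ⊢
  refine ⟨by rw [h1 c hc]; exact hv.1, fun i hi => by rw [h1 i (hi.trans hc)]; exact hv.2 i hi⟩

theorem exists_eq_X_pow_mul {R : Type*} [CommRing R] {f : PowerSeries R} {a : ℕ}
    (h : f.order = a) : ∃ v, f = PowerSeries.X ^ a * v ∧ PowerSeries.constantCoeff v ≠ 0 := by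
  obtain ⟨v, hv⟩ := X_pow_dvd_iff_le_order.2 h.ge
  refine ⟨v, hv, ?_⟩
  have := (PowerSeries.order_eq_nat.1 h).1
  rwa [hv, PowerSeries.coeff_X_pow_mul', if_pos le_rfl, Nat.sub_self,
    PowerSeries.coeff_zero_eq_constantCoeff] at this

/-- The generic polynomial in `t` with `N` coefficients. -/
noncomputable def genericUnit (N : ℕ) : PowerSeries (MvPolynomial (Fin N) ℂ) :=
  PowerSeries.mk fun j => if h : j < N then MvPolynomial.X ⟨j, h⟩ else 0

/-- The coordinates of the generic point of `D_{m,k}`, up to free coefficients. -/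
noncomputable def stratumSeries (β : ℕ → ℕ) (r κ N i : ℕ) : PowerSeries (MvPolynomial (Fin N) ℂ) :=
  if i < r then (PowerSeries.X ^ κ * genericUnit N) ^ (β i / e β (r - 1)) else 0

variable {g : ℕ} {β : ℕ → ℕ} {b : ℕ → ℕ → ℕ} {m k r κ : ℕ}

variable (g β b m r κ) in
/-- The generic jet of `D_{m,k}`. -/
noncomputable def stratumJet : ℕ → PowerSeries (MvPolynomial
    (Fin (slack β b m r κ 0) ⊕ freeIndex g m (freeFrom β b m r κ)) ℂ) :=
  genericSeries g m (freeFrom β b m r κ) (stratumSeries β r κ (slack β b m r κ 0))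

namespace IsParam

variable (P : IsParam g β b m k r κ) (hD : IsBranchData g β b)
include P hD

theorem isJet_stratumJet : IsJet g β b m (stratumJet g β b m r κ) := by
  have h1 := X_pow_dvd_genericSeries_sub (g := g) (m := m) (T := freeFrom β b m r κ)
    (y := stratumSeries β r κ (slack β b m r κ 0))
  refine P.isJet_of_dvd hD (PowerSeries.map (MvPolynomial.rename Sum.inl :
    MvPolynomial (Fin (slack β b m r κ 0)) ℂ →ₐ[ℂ] _).toRingHom (genericUnit _))
    (fun i hi => ?_) (fun i hi _ => ?_)
  · have h2 := h1 i
    rw [stratumSeries, if_pos hi, map_pow, map_mul, map_pow, PowerSeries.map_X] at h2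
    exact h2
  · have h2 := h1 i
    rw [stratumSeries, if_neg (by omega), map_zero, sub_zero] at h2
    exact h2

theorem order_stratumJet : (stratumJet g β b m r κ 0).order = (k * n β b 1 : ℕ) := by
  have hr := P.two_le
  have h1 := X_pow_dvd_genericSeries_sub (g := g) (m := m) (T := freeFrom β b m r κ)
    (y := stratumSeries β r κ (slack β b m r κ 0)) 0
  refine order_eq_of_dvd_sub h1 ?_ ?_
  · rw [freeFrom, if_pos (by omega), P.order_add_slack_zero hD, ← P.order_zero hD]
    have := P.order_zero_le_m hD
    omega
  · rw [stratumSeries, if_pos (by omega), map_pow, map_mul, map_pow, PowerSeries.map_X,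
      PowerSeries.order_pow, PowerSeries.order_mul, PowerSeries.order_X_pow, ← P.order_zero hD,
      stratumOrder]
    have h2 : (PowerSeries.map (MvPolynomial.rename Sum.inl :
        MvPolynomial (Fin (slack β b m r κ 0)) ℂ →ₐ[ℂ] MvPolynomial (Fin (slack β b m r κ 0) ⊕
          freeIndex g m (freeFrom β b m r κ)) ℂ).toRingHom (genericUnit _)).order = (0 : ℕ) := by
      rw [PowerSeries.order_eq_nat]
      refine ⟨?_, fun i hi => absurd hi (Nat.not_lt_zero i)⟩
      rw [PowerSeries.coeff_map, genericUnit, PowerSeries.coeff_mk, dif_pos (P.slack_zero_pos hD)]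
      change (MvPolynomial.rename Sum.inl) (MvPolynomial.X _) ≠ 0
      rw [MvPolynomial.rename_X]
      exact MvPolynomial.X_ne_zero _
    rw [h2, Nat.cast_zero, add_zero, nsmul_eq_mul]
    push_cast
    rw [mul_comm]

/-- The units left after removing the leading powers of `t` have a common root `s` to the precisions
`slack`; the coefficients of `s` are substituted for those of `genericUnit`. -/
theorem exists_specialization_stratumJet {K : Type} [Field K] [Algebra ℂ K] [IsAlgClosed K]
    {x : ℕ → PowerSeries K} (hx : IsJet g β b m x) (h0 : (x 0).order = (k * n β b 1 : ℕ)) :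
    ∃ f : MvPolynomial (Fin (slack β b m r κ 0) ⊕ freeIndex g m (freeFrom β b m r κ)) ℂ →ₐ[ℂ] K,
      ∀ i ≤ g, ∀ j ≤ m, f (PowerSeries.coeff j (stratumJet g β b m r κ i)) =
        PowerSeries.coeff j (x i) := by
  have hK : CharZero K := charZero_of_injective_algebraMap (algebraMap ℂ K).injective
  have h1 : ∀ i, ∃ v, i < r → x i = PowerSeries.X ^ stratumOrder β r κ i * v ∧
      PowerSeries.constantCoeff v ≠ 0 := by
    intro i
    by_cases hi : i < r
    · obtain ⟨a, ha, hae⟩ := hx.exists_order hD h0 i (P.index_le hi)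
        fun h1 => P.below i h1 hi
      obtain rfl : a = stratumOrder β r κ i :=
        Nat.eq_of_mul_eq_mul_right hD.e_one_pos (by rw [hae, P.order_mul_e hi])
      obtain ⟨v, hv⟩ := exists_eq_X_pow_mul ha
      exact ⟨v, fun _ => hv⟩
    · exact ⟨0, fun h => absurd h hi⟩
  choose v hv using h1
  have hr := P.two_le
  have hrg := P.le
  obtain ⟨s, -, hs⟩ := hD.exists_common_root (v := v) (N := slack β b m r κ) (r - 1) (by omega)
    (fun i hi => (hv i (by omega)).2) (fun i hi p hp => P.slack_anti hD hp (by omega))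
    (fun i hi1 hi => by
      have hi : i < r := by omega
      have h2 := hx i hi1 (by omega)
      rw [P.eq_factor hD (fun i hi => (hv i hi).1) hi1 hi, ← P.n_mul_order_add_slack hD hi1 hi,
        pow_add] at h2
      exact (mul_dvd_mul_iff_left (pow_ne_zero _ PowerSeries.X_ne_zero)).1 h2)
  refine exists_specialization (fun j => PowerSeries.coeff j s) fun i hi => ?_
  rw [stratumSeries]
  split_ifs with hir
  · rw [map_pow, map_mul, map_pow, PowerSeries.map_X]
    set s' := PowerSeries.map (MvPolynomial.aeval (fun j : Fin (slack β b m r κ 0) =>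
      PowerSeries.coeff j s) : MvPolynomial _ ℂ →ₐ[ℂ] K).toRingHom (genericUnit _) with hs'
    have h2 : PowerSeries.X ^ slack β b m r κ 0 ∣ s' - s := by
      rw [PowerSeries.X_pow_dvd_iff]
      intro d hd
      rw [map_sub, hs', PowerSeries.coeff_map, genericUnit, PowerSeries.coeff_mk, dif_pos hd]
      simp
    rw [freeFrom, if_pos hir, (hv i hir).1, mul_pow, ← pow_mul, pow_add, ← stratumOrder, ← mul_sub]
    refine mul_dvd_mul_left _ ?_
    have h3 := (pow_dvd_pow _ (P.slack_anti hD (Nat.zero_le i) hir)).trans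
      (h2.trans (sub_dvd_pow_sub_pow _ _ (β i / e β (r - 1))))
    rw [dvd_sub_comm]
    simpa using dvd_add h3 (hs i (by omega))
  · rw [map_zero, sub_zero, freeFrom, if_neg hir, ← X_pow_dvd_pow_iff (hD.n_pos hi)]
    have h2 := hx i (by omega) hi
    exact (dvd_sub_left (P.dvd_prod hD (fun i hi => ⟨_, (hv i hi).1⟩) (by omega) hi)).1 h2

theorem closure_D (h : k * n β b 0 * n β b 1 ≤ m) :
    closure (D g β b m k h) = closure {jetPoint _ (P.isJet_stratumJet hD)} := by
  refine closure_eq_of_specialization _ ((jetPoint_mem_D hD _ h).2 (P.order_stratumJet hD)) ?_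
  intro K _ _ _ x hx hmem
  exact P.exists_specialization_stratumJet hD hx ((jetPoint_mem_D hD hx h).1 hmem)

end IsParam

end StratumGeneric

/-! ### A linear space inside `B_m` -/

section LinearSpace

variable {g : ℕ} {β : ℕ → ℕ} {b : ℕ → ℕ → ℕ} {m l : ℕ}

variable (β b m) in
/-- The least order of the coordinate `x_i` for which `x_i ^ n_i` vanishes modulo `t ^ (m + 1)`. -/
def vanishingOrder (i : ℕ) : ℕ := m / n β b i + 1

theorem dvd_prod_of_dvd_pow {S : Type} [CommRing S]
    {x : ℕ → PowerSeries S} {d c i : ℕ} (hi : 1 ≤ i) (hc : c ≤ b i 0)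
    (h : PowerSeries.X ^ d ∣ x 0 ^ c) :
    PowerSeries.X ^ d ∣ ∏ p ∈ Finset.range i, x p ^ b i p :=
  h.trans ((pow_dvd_pow _ hc).trans
    (Finset.dvd_prod_of_mem (fun p => x p ^ b i p) (Finset.mem_range.2 hi)))

/-- Both terms of every equation vanish separately: the monomial because `b_{i0} ≥ n_0` and `x_0 ^
n_0` vanishes modulo `t ^ (m + 1)`. -/
theorem isJet_of_forall_dvd (hD : IsBranchData g β b) {S : Type} [CommRing S]
    {x : ℕ → PowerSeries S} (h : ∀ i ≤ g, PowerSeries.X ^ vanishingOrder β b m i ∣ x i) :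
    IsJet g β b m x := fun i h1 hi =>
  dvd_sub (X_pow_dvd_pow_of_dvd (hD.n_pos hi) (h i hi))
    (dvd_prod_of_dvd_pow h1 (hD.n_zero_le h1 hi)
      (X_pow_dvd_pow_of_dvd (hD.n_pos (Nat.zero_le g)) (h 0 (Nat.zero_le g))))

variable (g β b m) in
/-- The generic jet all of whose coordinates have order at least `vanishingOrder`. -/
noncomputable def linearJet : ℕ → PowerSeries (MvPolynomial
    (Empty ⊕ freeIndex g m (vanishingOrder β b m)) ℂ) :=
  genericSeries g m (vanishingOrder β b m) 0

theorem X_pow_dvd_linearJet (i : ℕ) :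
    PowerSeries.X ^ vanishingOrder β b m i ∣ linearJet g β b m i := by
  have := X_pow_dvd_genericSeries_sub (g := g) (m := m) (T := vanishingOrder β b m)
    (y := (0 : ℕ → PowerSeries (MvPolynomial Empty ℂ))) i
  rwa [Pi.zero_apply, map_zero, sub_zero] at this

theorem isJet_linearJet (hD : IsBranchData g β b) : IsJet g β b m (linearJet g β b m) :=
  isJet_of_forall_dvd hD fun i _ => X_pow_dvd_linearJet i

/-- The free coefficients are themselves coordinates of the jet, so the closure of this point is an
affine space of known dimension. -/
theorem jetHom_linearJet_surjective (hD : IsBranchData g β b) :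
    Function.Surjective (jetHom _ (isJet_linearJet (m := m) hD)) := by
  rw [← AlgHom.range_eq_top, eq_top_iff, ← MvPolynomial.adjoin_range_X, Algebra.adjoin_le_iff]
  rintro _ ⟨e | ⟨⟨i, j⟩, h⟩, rfl⟩
  · exact e.elim
  · have h' := h
    simp only [Finset.mem_sigma, Finset.mem_range, Finset.mem_Ico] at h'
    refine ⟨coord (curveEq g β b) m ⟨i, h'.1⟩ j, ?_⟩
    change jetHom _ _ _ = _
    rw [jetHom_coord _ _ (by omega), linearJet, genericSeries, PowerSeries.coeff_mk, dif_pos h]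

theorem mul_n_one_lt_vanishingOrder (hD : IsBranchData g β b) (hlm : l * n β b 0 * n β b 1 < m) :
    l * n β b 1 < vanishingOrder β b m 0 := by
  refine Nat.lt_succ_of_le ((Nat.le_div_iff_mul_le (hD.n_pos (Nat.zero_le g))).2 ?_)
  rw [mul_right_comm]
  exact hlm.le

theorem linearJet_mem_B (hD : IsBranchData g β b) (hlm : l * n β b 0 * n β b 1 < m) :
    jetPoint _ (isJet_linearJet hD) ∈ B g β b m l hlm.le := by
  rw [jetPoint_mem_B hD]
  intro j hj
  exact PowerSeries.X_pow_dvd_iff.1 (X_pow_dvd_linearJet 0) j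
    (hj.trans_lt (mul_n_one_lt_vanishingOrder hD hlm))

theorem isClosed_B (h : l * n β b 0 * n β b 1 ≤ m) : IsClosed (B g β b m l h) := by
  rw [B]
  exact (PrimeSpectrum.isClosed_zeroLocus _).preimage (PrimeSpectrum.continuous_comap _)

end LinearSpace

/-! ### Irreducibility of `B_m` -/

section IrreducibleB

variable {g : ℕ} {β : ℕ → ℕ} {b : ℕ → ℕ → ℕ} {m l : ℕ}

theorem X_pow_mul_dvd_pow_iff {R : Type*} [CommRing R] [IsDomain R] {f : PowerSeries R} {N c : ℕ}
    (hN : 0 < N) : PowerSeries.X ^ (N * c) ∣ f ^ N ↔ PowerSeries.X ^ c ∣ f := by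
  rw [X_pow_dvd_iff_le_order, X_pow_dvd_iff_le_order, PowerSeries.order_pow, nsmul_eq_mul]
  induction f.order with
  | top => simp [ENat.mul_top (by exact_mod_cast hN.ne' : (N : ℕ∞) ≠ 0)]
  | coe a =>
    norm_cast
    exact Nat.mul_le_mul_left_iff hN

theorem X_pow_succ_dvd_sub {R : Type*} [CommRing R] {f v : PowerSeries R} {c : ℕ}
    (h : f = PowerSeries.X ^ c * v) :
    PowerSeries.X ^ (c + 1) ∣ f - PowerSeries.X ^ c *
      PowerSeries.C (PowerSeries.constantCoeff v) := by
  rw [h, ← mul_sub, pow_succ]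
  refine mul_dvd_mul_left _ ?_
  rw [PowerSeries.X_dvd_iff, map_sub, PowerSeries.constantCoeff_C, sub_self]

/-- A jet in `B_m` either has `x_0 ^ n_0 = 0`, or has order `m / n_0` in `x_0`. -/
theorem IsJet.dvd_or_order_eq (hD : IsBranchData g β b) {K : Type} [Field K]
    {x : ℕ → PowerSeries K} (hx : IsJet g β b m x) (hml : m ≤ (l + 1) * n β b 0 * n β b 1)
    (h : ∀ j ≤ l * n β b 1, PowerSeries.coeff j (x 0) = 0) :
    PowerSeries.X ^ (m + 1) ∣ x 0 ^ n β b 0 ∨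
      m = (l + 1) * n β b 0 * n β b 1 ∧ (x 0).order = ((l + 1) * n β b 1 : ℕ) := by
  have hn := hD.n_pos (Nat.zero_le g)
  by_cases htop : (x 0).order = ⊤
  · left
    rw [PowerSeries.order_eq_top] at htop
    rw [htop, zero_pow hn.ne']
    exact dvd_zero _
  obtain ⟨c, hc⟩ := ENat.ne_top_iff_exists.1 htop
  rcases Nat.lt_or_ge m (n β b 0 * c) with h1 | h1
  · left
    rw [X_pow_dvd_iff_le_order, PowerSeries.order_pow, ← hc, nsmul_eq_mul]
    exact_mod_cast h1
  right
  obtain ⟨c', rfl⟩ := hx.n_one_dvd_order hD hc.symm h1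
  have h2 : l < c' := by
    by_contra hle
    refine (PowerSeries.order_eq_nat.1 hc.symm).1 (h _ ?_)
    rw [mul_comm]
    exact Nat.mul_le_mul_right _ (not_lt.1 hle)
  have h3 : n β b 0 * (n β b 1 * c') = c' * n β b 0 * n β b 1 := by ring
  have h4 : (l + 1) * n β b 0 * n β b 1 ≤ c' * n β b 0 * n β b 1 :=
    Nat.mul_le_mul_right _ (Nat.mul_le_mul_right _ h2)
  have h5 : (l + 1) * n β b 0 * n β b 1 = c' * n β b 0 * n β b 1 := by omega
  have h6 : l + 1 = c' :=
    Nat.eq_of_mul_eq_mul_right hn (Nat.eq_of_mul_eq_mul_right (hD.n_pos hD.one_le) h5)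
  refine ⟨by omega, ?_⟩
  rw [← hc, h6, mul_comm]

theorem IsJet.dvd_of_dvd_pow (hD : IsBranchData g β b) {K : Type} [Field K]
    {x : ℕ → PowerSeries K} (hx : IsJet g β b m x) {c i : ℕ} (hi : i ≤ g)
    (hc : 1 ≤ i → c ≤ b i 0) (hc0 : i = 0 → c = n β b 0)
    (h : PowerSeries.X ^ (m + 1) ∣ x 0 ^ c) : PowerSeries.X ^ vanishingOrder β b m i ∣ x i := by
  rw [vanishingOrder, ← X_pow_dvd_pow_iff (hD.n_pos hi)]
  rcases Nat.eq_zero_or_pos i with rfl | h1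
  · rw [← hc0 rfl]; exact h
  · exact (dvd_sub_left (dvd_prod_of_dvd_pow h1 (hc h1) h)).1 (hx i h1 hi)

/-- For `m < (l + 1) n_0 n_1` every jet in `B_m` has `x_0 ^ n_0 = 0` modulo `t ^ (m + 1)`, so `B_m`
is the linear space. -/
theorem isIrreducible_B_of_ne (hD : IsBranchData g β b) (hlm : l * n β b 0 * n β b 1 < m)
    (hml : m < (l + 1) * n β b 0 * n β b 1) : IsIrreducible (B g β b m l hlm.le) := by
  rw [← (isClosed_B hlm.le).closure_eq,
    closure_eq_of_specialization (isJet_linearJet hD) (linearJet_mem_B hD hlm)]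
  · exact isIrreducible_singleton.closure
  intro K _ _ _ x hx hmem
  rw [jetPoint_mem_B hD] at hmem
  have h0 := (hx.dvd_or_order_eq hD hml.le hmem).resolve_right fun h => hml.ne h.1
  refine exists_specialization (fun e => e.elim) fun i hi => ?_
  rw [Pi.zero_apply, map_zero, sub_zero]
  exact hx.dvd_of_dvd_pow hD hi (fun h1 => hD.n_zero_le h1 hi) (fun _ => rfl) h0

variable (β b l) in
/-- The leading terms of the generic jet of `B_m`, when `m = (l + 1) n_0 n_1`. -/
noncomputable def leadingSeries (i : ℕ) : PowerSeries (MvPolynomial Unit ℂ) :=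
  if i = 0 then PowerSeries.X ^ ((l + 1) * n β b 1) *
    PowerSeries.C (MvPolynomial.X () ^ n β b 1)
  else if i = 1 then PowerSeries.X ^ ((l + 1) * n β b 0) *
    PowerSeries.C (MvPolynomial.X () ^ n β b 0)
  else 0

theorem map_leadingSeries {S : Type} [CommRing S] [Algebra ℂ S] (f : MvPolynomial Unit ℂ →ₐ[ℂ] S)
    (i : ℕ) : PowerSeries.map f.toRingHom (leadingSeries β b l i) =
      if i = 0 then PowerSeries.X ^ ((l + 1) * n β b 1) *
        PowerSeries.C (f (MvPolynomial.X ()) ^ n β b 1)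
      else if i = 1 then PowerSeries.X ^ ((l + 1) * n β b 0) *
        PowerSeries.C (f (MvPolynomial.X ()) ^ n β b 0)
      else 0 := by
  rw [leadingSeries]
  split_ifs <;> simp

theorem vanishingOrder_zero (hD : IsBranchData g β b) (hm : m = (l + 1) * n β b 0 * n β b 1) :
    vanishingOrder β b m 0 = (l + 1) * n β b 1 + 1 := by
  rw [vanishingOrder, hm, mul_right_comm, Nat.mul_div_cancel _ (hD.n_pos (Nat.zero_le g))]

theorem vanishingOrder_one (hD : IsBranchData g β b) (hm : m = (l + 1) * n β b 0 * n β b 1) :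
    vanishingOrder β b m 1 = (l + 1) * n β b 0 + 1 := by
  rw [vanishingOrder, hm, Nat.mul_div_cancel _ (hD.n_pos hD.one_le)]

theorem lt_mul_of_two_le (hD : IsBranchData g β b) (hm : m = (l + 1) * n β b 0 * n β b 1) :
    m + 1 ≤ (l + 1) * n β b 1 * (n β b 0 + 1) := by
  have h1 : (l + 1) * n β b 1 * (n β b 0 + 1) = m + (l + 1) * n β b 1 := by rw [hm]; ring
  rw [h1]
  exact Nat.add_le_add_left (Nat.mul_pos (Nat.succ_pos l) (hD.n_pos hD.one_le)) _

/-- Both terms of the first equation start at `t ^ m`, with the same coefficient `ε ^ (n_0 n_1)`.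
The monomials of the later ones vanish, because `b_{i0} > n_0` for `i ≥ 2`. -/
theorem isJet_of_leading (hD : IsBranchData g β b) (hm : m = (l + 1) * n β b 0 * n β b 1)
    {S : Type} [CommRing S] {x : ℕ → PowerSeries S} (ε : S)
    (h0 : PowerSeries.X ^ ((l + 1) * n β b 1 + 1) ∣
      x 0 - PowerSeries.X ^ ((l + 1) * n β b 1) * PowerSeries.C (ε ^ n β b 1))
    (h1 : PowerSeries.X ^ ((l + 1) * n β b 0 + 1) ∣
      x 1 - PowerSeries.X ^ ((l + 1) * n β b 0) * PowerSeries.C (ε ^ n β b 0))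
    (h : ∀ i, 2 ≤ i → i ≤ g → PowerSeries.X ^ vanishingOrder β b m i ∣ x i) :
    IsJet g β b m x := by
  have key : ∀ {f : PowerSeries S} {c : ℕ} {u : S},
      PowerSeries.X ^ (c + 1) ∣ f - PowerSeries.X ^ c * PowerSeries.C u →
      ∃ v, f = PowerSeries.X ^ c * v ∧ PowerSeries.constantCoeff v = u := by
    rintro f c u ⟨q, hq⟩
    refine ⟨PowerSeries.C u + PowerSeries.X * q, ?_, by simp⟩
    rw [sub_eq_iff_eq_add'.1 hq]
    ring
  obtain ⟨v₀, hv₀, hv₀'⟩ := key h0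
  obtain ⟨v₁, hv₁, hv₁'⟩ := key h1
  intro i hi1 hi
  rcases hi1.eq_or_lt with rfl | hi2
  · have h2 : x 1 ^ n β b 1 - x 0 ^ b 1 0 =
        PowerSeries.X ^ m * (v₁ ^ n β b 1 - v₀ ^ n β b 0) := by
      rw [hv₀, hv₁, mul_pow, mul_pow, ← pow_mul, ← pow_mul, ← hm, mul_sub]
      congr 3
      rw [hm, mul_right_comm]
      rfl
    rw [Finset.prod_range_one, h2, pow_succ]
    refine mul_dvd_mul_left _ ?_
    rw [PowerSeries.X_dvd_iff, map_sub, map_pow, map_pow, hv₀', hv₁', ← pow_mul, ← pow_mul,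
      mul_comm, sub_self]
  · refine dvd_sub (X_pow_dvd_pow_of_dvd (hD.n_pos hi) (h i hi2 hi))
      (dvd_prod_of_dvd_pow hi1 (hD.n_zero_lt hi2 hi) ?_)
    rw [hv₀, mul_pow, ← pow_mul]
    exact Dvd.dvd.mul_right (pow_dvd_pow _ (lt_mul_of_two_le hD hm)) _

theorem IsJet.exists_leading (hD : IsBranchData g β b) (hm : m = (l + 1) * n β b 0 * n β b 1)
    {K : Type} [Field K] [IsAlgClosed K] {x : ℕ → PowerSeries K} (hx : IsJet g β b m x)
    (h : ∀ j ≤ l * n β b 1, PowerSeries.coeff j (x 0) = 0) :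
    ∃ ε : K, PowerSeries.X ^ ((l + 1) * n β b 1 + 1) ∣
        x 0 - PowerSeries.X ^ ((l + 1) * n β b 1) * PowerSeries.C (ε ^ n β b 1) ∧
      PowerSeries.X ^ ((l + 1) * n β b 0 + 1) ∣
        x 1 - PowerSeries.X ^ ((l + 1) * n β b 0) * PowerSeries.C (ε ^ n β b 0) ∧
      ∀ i, 2 ≤ i → i ≤ g → PowerSeries.X ^ vanishingOrder β b m i ∣ x i := by
  have hn0 := hD.n_pos (Nat.zero_le g)
  have hn1 := hD.n_pos hD.one_le
  have hm0 : n β b 0 * ((l + 1) * n β b 1) = m := by rw [hm]; ring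
  have hm1 : n β b 1 * ((l + 1) * n β b 0) = m := by rw [hm]; ring
  have h0 : PowerSeries.X ^ ((l + 1) * n β b 1) ∣ x 0 := by
    rcases hx.dvd_or_order_eq hD hm.le h with h1 | h1
    · rw [← X_pow_mul_dvd_pow_iff hn0, hm0]
      exact (pow_dvd_pow _ (Nat.le_succ m)).trans h1
    · exact X_pow_dvd_iff_le_order.2 h1.2.ge
  obtain ⟨v₀, hv₀⟩ := h0
  have hjet : PowerSeries.X ^ (m + 1) ∣ x 1 ^ n β b 1 - x 0 ^ n β b 0 := by
    have := hx 1 le_rfl hD.one_le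
    rwa [Finset.prod_range_one] at this
  have h1 : PowerSeries.X ^ ((l + 1) * n β b 0) ∣ x 1 := by
    rw [← X_pow_mul_dvd_pow_iff hn1, hm1]
    refine (dvd_sub_left ?_).1 ((pow_dvd_pow _ (Nat.le_succ m)).trans hjet)
    rw [hv₀, mul_pow, ← pow_mul, mul_comm _ (n β b 0), hm0]
    exact dvd_mul_right _ _
  obtain ⟨v₁, hv₁⟩ := h1
  have h2 : PowerSeries.constantCoeff v₁ ^ n β b 1 = PowerSeries.constantCoeff v₀ ^ n β b 0 := by
    rw [hv₀, hv₁, mul_pow, mul_pow, ← pow_mul, ← pow_mul, mul_comm ((l + 1) * n β b 1),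
      mul_comm ((l + 1) * n β b 0), hm0, hm1, ← mul_sub, pow_succ,
      mul_dvd_mul_iff_left (pow_ne_zero _ PowerSeries.X_ne_zero), PowerSeries.X_dvd_iff,
      map_sub, map_pow, map_pow, sub_eq_zero] at hjet
    exact hjet
  -- The leading coefficients lie on the curve `u ^ n_1 = v ^ n_0`, which `ε` parametrizes; they may
  -- both be zero.
  obtain ⟨ε, hε1, hε0⟩ := exists_pow_eq_and_pow_eq hn1 hn0 h2 hD.coprime
  refine ⟨ε, ?_, ?_, fun i hi2 hi => ?_⟩
  · rw [← hε0]; exact X_pow_succ_dvd_sub hv₀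
  · rw [← hε1]; exact X_pow_succ_dvd_sub hv₁
  · refine hx.dvd_of_dvd_pow (c := n β b 0 + 1) hD hi (fun h1 => hD.n_zero_lt hi2 hi)
      (fun h1 => by omega) ?_
    rw [hv₀, mul_pow, ← pow_mul]
    exact Dvd.dvd.mul_right (pow_dvd_pow _ (lt_mul_of_two_le hD hm)) _

theorem isIrreducible_B_of_eq (hD : IsBranchData g β b) (hlm : l * n β b 0 * n β b 1 < m)
    (hm : m = (l + 1) * n β b 0 * n β b 1) : IsIrreducible (B g β b m l hlm.le) := by
  have hT0 := vanishingOrder_zero hD hm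
  have hT1 := vanishingOrder_one hD hm
  have hX : IsJet g β b m (genericSeries g m (vanishingOrder β b m) (leadingSeries β b l)) := by
    have h1 := X_pow_dvd_genericSeries_sub (g := g) (m := m) (T := vanishingOrder β b m)
      (y := leadingSeries β b l)
    simp only [map_leadingSeries] at h1
    refine isJet_of_leading hD hm (MvPolynomial.rename Sum.inl (MvPolynomial.X ())) ?_ ?_
      fun i hi _ => ?_
    · have := h1 0
      rwa [if_pos rfl, hT0] at this
    · have := h1 1
      rwa [if_neg one_ne_zero, if_pos rfl, hT1] at this
    · have := h1 i
      rwa [if_neg (by omega), if_neg (by omega), sub_zero] at this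
  have hmem : jetPoint _ hX ∈ B g β b m l hlm.le := by
    rw [jetPoint_mem_B hD]
    intro j hj
    have h1 := X_pow_dvd_genericSeries_sub (g := g) (m := m) (T := vanishingOrder β b m)
      (y := leadingSeries β b l) 0
    rw [map_leadingSeries, if_pos rfl, hT0] at h1
    have h2 := (dvd_sub_left (dvd_mul_right (PowerSeries.X ^ ((l + 1) * n β b 1)) _)).1
      ((pow_dvd_pow _ (Nat.le_succ _)).trans h1)
    refine PowerSeries.X_pow_dvd_iff.1 h2 j (hj.trans_lt ?_)
    exact Nat.mul_lt_mul_of_pos_right (Nat.lt_succ_self l) (hD.n_pos hD.one_le)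
  rw [← (isClosed_B hlm.le).closure_eq, closure_eq_of_specialization hX hmem]
  · exact isIrreducible_singleton.closure
  intro K _ _ _ x hx hxB
  rw [jetPoint_mem_B hD] at hxB
  obtain ⟨ε, h0, h1, h2⟩ := hx.exists_leading hD hm hxB
  refine exists_specialization (fun _ => ε) fun i hi => ?_
  rw [map_leadingSeries, MvPolynomial.aeval_X]
  split_ifs with hi0 hi1
  · rw [hi0, hT0]; exact h0
  · rw [hi1, hT1]; exact h1
  · rw [sub_zero]; exact h2 i (by omega) hi

theorem isIrreducible_B (hD : IsBranchData g β b) (hlm : l * n β b 0 * n β b 1 < m)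
    (hml : m ≤ (l + 1) * n β b 0 * n β b 1) : IsIrreducible (B g β b m l hlm.le) := by
  rcases hml.lt_or_eq with h | h
  · exact isIrreducible_B_of_ne hD hlm h
  · exact isIrreducible_B_of_eq hD hlm h

end IrreducibleB

/-! ### Dimensions of closures of points -/

section Dimension

theorem ringKrullDim_le_of_isIntegral {R A : Type*} [CommRing R] [CommRing A] [Algebra R A]
    [Algebra.IsIntegral R A] : ringKrullDim A ≤ ringKrullDim R := by
  refine Order.krullDim_le_of_strictMono (PrimeSpectrum.comap (algebraMap R A)) fun I J h => ?_
  exact Ideal.IsIntegral.comap_lt_comap (R := R) (I := I.asIdeal) (J := J.asIdeal) h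

theorem ringKrullDim_mvPolynomial_field (k : Type*) [Field k] (τ : Type*) [Finite τ] :
    ringKrullDim (MvPolynomial τ k) = Nat.card τ := by
  rw [MvPolynomial.ringKrullDim_of_isNoetherianRing, ringKrullDim_eq_zero_of_field, zero_add]

/-- A finitely generated subalgebra of a polynomial ring has dimension at most the number of
variables. -/
theorem ringKrullDim_le_of_injective_mvPolynomial {k A τ : Type} [Field k] [CommRing A]
    [Nontrivial A] [Algebra k A] [Algebra.FiniteType k A] [Finite τ]
    (f : A →ₐ[k] MvPolynomial τ k) (hf : Function.Injective f) : ringKrullDim A ≤ Nat.card τ := by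
  -- Noether normalization bounds the dimension of `A` by `s`, and transcendence degree bounds `s`
  -- by the number of variables.
  obtain ⟨s, φ, hφ, hint⟩ := exists_integral_inj_algHom_of_fg k A
  algebraize [φ.toRingHom]
  have h1 : Algebra.IsIntegral (MvPolynomial (Fin s) k) A := ⟨hint⟩
  refine (ringKrullDim_le_of_isIntegral (R := MvPolynomial (Fin s) k)).trans ?_
  rw [ringKrullDim_mvPolynomial_field, Nat.card_fin]
  have h2 := trdeg_le_of_injective (f.comp φ) (hf.comp hφ)
  rw [MvPolynomial.trdeg_of_isDomain, MvPolynomial.trdeg_of_isDomain, Cardinal.lift_id,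
    Cardinal.lift_id, Cardinal.mk_fin, ← Nat.cast_card (α := τ)] at h2
  exact_mod_cast h2

theorem topologicalKrullDim_closure_singleton {A : Type*} [CommRing A] (P : PrimeSpectrum A) :
    topologicalKrullDim (closure {P} : Set (PrimeSpectrum A)) = ringKrullDim (A ⧸ P.asIdeal) := by
  have h1 := PrimeSpectrum.isClosedEmbedding_comap_of_surjective _ (Ideal.Quotient.mk P.asIdeal)
    Ideal.Quotient.mk_surjective
  have h2 : Set.range (PrimeSpectrum.comap (Ideal.Quotient.mk P.asIdeal)) = closure {P} := by
    rw [range_comap_of_surjective _ _ Ideal.Quotient.mk_surjective, Ideal.mk_ker,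
      PrimeSpectrum.closure_singleton]
  rw [← h2, ← PrimeSpectrum.topologicalKrullDim_eq_ringKrullDim]
  exact (h1.isEmbedding.toHomeomorph.isHomeomorph.topologicalKrullDim_eq).symm

theorem ringKrullDim_quotient_succ_le {A : Type*} [CommRing A] {P Q : PrimeSpectrum A}
    (h : P < Q) : ringKrullDim (A ⧸ Q.asIdeal) + 1 ≤ ringKrullDim (A ⧸ P.asIdeal) := by
  obtain ⟨hle, r, hrQ, hrP⟩ := SetLike.lt_iff_le_and_exists.1
    (show P.asIdeal < Q.asIdeal from h)
  refine ringKrullDim_succ_le_of_surjective (Ideal.Quotient.factor hle)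
    (Ideal.Quotient.factor_surjective hle) (r := Ideal.Quotient.mk _ r) ?_ ?_
  · rw [mem_nonZeroDivisors_iff_ne_zero, Ne, Ideal.Quotient.eq_zero_iff_mem]
    exact hrP
  · rw [Ideal.Quotient.factor_mk, Ideal.Quotient.eq_zero_iff_mem]
    exact hrQ

variable {g : ℕ} {β : ℕ → ℕ} {b : ℕ → ℕ → ℕ} {m : ℕ} {τ : Type} [Finite τ]
  {x : ℕ → PowerSeries (MvPolynomial τ ℂ)}

theorem ringKrullDim_jetPoint_le (hx : IsJet g β b m x) :
    ringKrullDim (JetRing (curveEq g β b) m ⧸ (jetPoint x hx).asIdeal) ≤ Nat.card τ := by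
  have hft : Algebra.FiniteType ℂ (JetRing (curveEq g β b) m) :=
    Algebra.FiniteType.of_surjective (Ideal.Quotient.mkₐ ℂ (jetIdeal (curveEq g β b) m))
      Ideal.Quotient.mk_surjective
  let I : Ideal (JetRing (curveEq g β b) m) := RingHom.ker (jetHom x hx)
  have hprime : I.IsPrime := (jetPoint x hx).isPrime
  have hnt : Nontrivial (JetRing (curveEq g β b) m ⧸ I) :=
    Ideal.Quotient.nontrivial_iff.2 hprime.ne_top
  have hft' : Algebra.FiniteType ℂ (JetRing (curveEq g β b) m ⧸ I) :=
    Algebra.FiniteType.of_surjective (Ideal.Quotient.mkₐ ℂ I) Ideal.Quotient.mk_surjective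
  exact ringKrullDim_le_of_injective_mvPolynomial (A := JetRing (curveEq g β b) m ⧸ I)
    (Ideal.kerLiftAlg (jetHom x hx)) (Ideal.kerLiftAlg_injective _)

theorem ringKrullDim_jetPoint_eq (hx : IsJet g β b m x)
    (hs : Function.Surjective (jetHom x hx)) :
    ringKrullDim (JetRing (curveEq g β b) m ⧸ (jetPoint x hx).asIdeal) = Nat.card τ := by
  rw [← ringKrullDim_mvPolynomial_field ℂ τ]
  exact ringKrullDim_eq_of_ringEquiv (Ideal.quotientKerAlgEquivOfSurjective hs).toRingEquiv

end Dimension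

/-! ### Comparing `D_{m,k}` with `B_m` -/

section StratumDimension

variable {g : ℕ} {β : ℕ → ℕ} {b : ℕ → ℕ → ℕ} {m k r κ l : ℕ}

/-- The defect of `D_{m,k}` with respect to the number of the free coefficients of the linear
space contained in `B_m`, in the first two coordinates. -/
theorem IsBranchData.first_two_le (hD : IsBranchData g β b) {ρ : ℕ} (hρ : 1 ≤ ρ) :
    ρ / n β b 0 + ρ / n β b 1 + 1 ≤ ρ := by
  have h1 := hD.two_le_n_one
  have h2 : 3 ≤ n β b 0 := by have := hD.n_one_lt; omega
  have h3 : ρ / n β b 0 ≤ ρ / 3 := Nat.div_le_div_left h2 (by norm_num)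
  have h4 : ρ / n β b 1 ≤ ρ / 2 := Nat.div_le_div_left h1 (by norm_num)
  omega

/-- For `i ≥ 2` the coefficients of `x_i` become free no earlier on `D_{m,k}` than in the linear
space. With `ρ = m - k n_0 n_1`, the first two coordinates give the linear space `ρ - 1 - ⌊ρ / n_0⌋
- ⌊ρ / n_1⌋ ≥ 0` more parameters. -/
theorem IsParam.sum_free_le (P : IsParam g β b m k r κ) (hD : IsBranchData g β b)
    (h : k * n β b 0 * n β b 1 < m) :
    slack β b m r κ 0 + ∑ i ∈ Finset.range (g + 1), (m + 1 - freeFrom β b m r κ i) ≤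
      ∑ i ∈ Finset.range (g + 1), (m + 1 - vanishingOrder β b m i) := by
  have hg := hD.one_le
  have hr := P.two_le
  obtain ⟨g', rfl⟩ : ∃ g', g = g' + 1 := ⟨g - 1, by omega⟩
  rw [Finset.sum_range_succ', Finset.sum_range_succ', Finset.sum_range_succ',
    Finset.sum_range_succ']
  have hrest : ∑ i ∈ Finset.range g', (m + 1 - freeFrom β b m r κ (i + 1 + 1)) ≤
      ∑ i ∈ Finset.range g', (m + 1 - vanishingOrder β b m (i + 1 + 1)) := by
    refine Finset.sum_le_sum fun i hi => Nat.sub_le_sub_left ?_ _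
    have hi := Finset.mem_range.1 hi
    rw [freeFrom]
    split_ifs with hir
    · have h1 := P.n_mul_order_add_slack hD (i := i + 1 + 1) (by omega) hir
      have h2 : 2 ≤ n β b (i + 1 + 1) := hD.two_le _ (by omega) (by omega)
      rw [vanishingOrder, Nat.add_one_le_iff, Nat.div_lt_iff_lt_mul (by omega)]
      set a := stratumOrder β r κ (i + 1 + 1)
      set s := slack β b m r κ (i + 1 + 1)
      calc m < n β b (i + 1 + 1) * a + s := by omega
        _ ≤ (a + s) * n β b (i + 1 + 1) := by nlinarith
    · exact le_rfl
  have h0 : freeFrom β b m r κ 0 = m + 1 := by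
    rw [freeFrom, if_pos (by omega), P.order_add_slack_zero hD]
  have hs0 := P.order_add_slack_zero hD
  have hs1 := P.n_mul_order_add_slack hD le_rfl hr
  have h1 : freeFrom β b m r κ (0 + 1) = stratumOrder β r κ 1 + slack β b m r κ 1 := by
    rw [freeFrom, if_pos (by omega)]
  rw [P.order_zero hD] at hs0
  rw [P.order_one hD] at hs1 h1
  obtain ⟨ρ, hρ, hρ1⟩ : ∃ ρ, m = k * n β b 0 * n β b 1 + ρ ∧ 1 ≤ ρ :=
    ⟨m - k * n β b 0 * n β b 1, by omega, by omega⟩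
  have hv0 : vanishingOrder β b m 0 = k * n β b 1 + ρ / n β b 0 + 1 := by
    rw [vanishingOrder, hρ, show k * n β b 0 * n β b 1 + ρ = ρ + n β b 0 * (k * n β b 1) by ring,
      Nat.add_mul_div_left _ _ (hD.n_pos (Nat.zero_le _)), add_comm (ρ / _)]
  have hv1 : vanishingOrder β b m (0 + 1) = k * n β b 0 + ρ / n β b 1 + 1 := by
    rw [zero_add, vanishingOrder, hρ,
      show k * n β b 0 * n β b 1 + ρ = ρ + n β b 1 * (k * n β b 0) by ring,
      Nat.add_mul_div_left _ _ (hD.n_pos hg), add_comm (ρ / _)]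
  have hfirst := hD.first_two_le hρ1
  have hk0 : n β b 1 * (k * n β b 0) = k * n β b 0 * n β b 1 := by ring
  have hk1 : k * n β b 1 ≤ k * n β b 0 * n β b 1 := mul_n_one_le hD k
  have hk2 : k * n β b 0 ≤ k * n β b 0 * n β b 1 :=
    Nat.le_mul_of_pos_right _ (hD.n_pos hg)
  rw [h0, h1, hv0, hv1]
  omega

theorem IsParam.ringKrullDim_le (P : IsParam g β b m k r κ) (hD : IsBranchData g β b)
    (h : k * n β b 0 * n β b 1 < m) :
    ringKrullDim (JetRing (curveEq g β b) m ⧸ (jetPoint _ (P.isJet_stratumJet hD)).asIdeal) ≤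
      ringKrullDim (JetRing (curveEq g β b) m ⧸
        (jetPoint _ (isJet_linearJet (m := m) hD)).asIdeal) := by
  refine (ringKrullDim_jetPoint_le _).trans ?_
  rw [ringKrullDim_jetPoint_eq _ (jetHom_linearJet_surjective hD)]
  rw [Nat.card_sum, Nat.card_sum, Nat.card_eq_fintype_card, Nat.card_eq_fintype_card,
    Nat.card_eq_fintype_card, Nat.card_eq_fintype_card, Fintype.card_fin, Fintype.card_coe,
    Fintype.card_coe, Fintype.card_empty, card_freeIndex, card_freeIndex, zero_add]
  exact_mod_cast P.sum_free_le hD h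

theorem IsParam.topologicalKrullDim_closure_D_le (P : IsParam g β b m k r κ)
    (hD : IsBranchData g β b) (hlm : l * n β b 0 * n β b 1 < m)
    (h : k * n β b 0 * n β b 1 < m) :
    topologicalKrullDim (closure (D g β b m k h.le)) ≤ topologicalKrullDim (B g β b m l hlm.le) := by
  rw [P.closure_D hD, topologicalKrullDim_closure_singleton]
  refine (P.ringKrullDim_le hD h).trans ?_
  rw [← topologicalKrullDim_closure_singleton]
  exact (Topology.IsInducing.subtypeVal.of_comp
    (f := Set.inclusion (closure_minimal
      (Set.singleton_subset_iff.2 (linearJet_mem_B hD hlm)) (isClosed_B hlm.le)))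
    (continuous_inclusion _) continuous_subtype_val).topologicalKrullDim_le

theorem IsParam.not_mem_B (P : IsParam g β b m k r κ) (hD : IsBranchData g β b) (hkl : k ≤ l)
    (hlm : l * n β b 0 * n β b 1 ≤ m) : jetPoint _ (P.isJet_stratumJet hD) ∉ B g β b m l hlm := by
  rw [jetPoint_mem_B hD]
  exact fun h => (PowerSeries.order_eq_nat.1 (P.order_stratumJet hD)).1
    (h _ (Nat.mul_le_mul_right _ hkl))

/-- The generic point of the linear space would be a strict specialization of that of `D_{m,k}`, so
of strictly smaller dimension, against the parameter count. -/
theorem IsParam.not_B_subset (P : IsParam g β b m k r κ) (hD : IsBranchData g β b)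
    (hlm : l * n β b 0 * n β b 1 < m) (hkl : k ≤ l) (h : k * n β b 0 * n β b 1 ≤ m) :
    ¬ B g β b m l hlm.le ⊆ closure (D g β b m k h) := by
  intro hsub
  have h1 := hsub (linearJet_mem_B hD hlm)
  have h2 : k * n β b 0 * n β b 1 < m :=
    (Nat.mul_le_mul_right _ (Nat.mul_le_mul_right _ hkl)).trans_lt hlm
  rw [P.closure_D hD, PrimeSpectrum.closure_singleton, PrimeSpectrum.mem_zeroLocus] at h1
  have h3 : jetPoint _ (P.isJet_stratumJet hD) < jetPoint _ (isJet_linearJet hD) := by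
    refine lt_of_le_of_ne h1 fun heq => ?_
    refine P.not_mem_B hD hkl hlm.le ?_
    rw [heq]
    exact linearJet_mem_B hD hlm
  have h4 := (ringKrullDim_quotient_succ_le h3).trans (P.ringKrullDim_le hD h2)
  rw [ringKrullDim_jetPoint_eq _ (jetHom_linearJet_surjective hD)] at h4
  norm_cast at h4
  omega

theorem IsParam.not_closure_D_subset_B (P : IsParam g β b m k r κ) (hD : IsBranchData g β b)
    (hlm : l * n β b 0 * n β b 1 ≤ m) (hkl : k ≤ l) (h : k * n β b 0 * n β b 1 ≤ m) :
    ¬ closure (D g β b m k h) ⊆ B g β b m l hlm := by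
  intro hsub
  refine P.not_mem_B hD hkl hlm (hsub ?_)
  rw [P.closure_D hD]
  exact subset_closure rfl

end StratumDimension

/-! ### Separating the strata by a Wronskian -/

section Wronskian

variable {g : ℕ} {β : ℕ → ℕ} {b : ℕ → ℕ → ℕ} {m k k' r κ r' κ' : ℕ}

variable (g β b m) in
/-- The coefficient of `t ^ q` in `n_1 t x_1' x_0 - n_0 t x_0' x_1`. -/
noncomputable def wronskianCoeff (hg : 1 ≤ g) (q : ℕ) : JetRing (curveEq g β b) m :=
  ∑ p ∈ Finset.HasAntidiagonal.antidiagonal q, ((n β b 1 * p.1 : JetRing (curveEq g β b) m) - n β b 0 * p.2) *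
    (coord (curveEq g β b) m ⟨1, by omega⟩ p.1 * coord (curveEq g β b) m 0 p.2)

theorem jetHom_wronskianCoeff (hg : 1 ≤ g) {q : ℕ} (hq : q ≤ m) {S : Type} [CommRing S]
    [Algebra ℂ S] {x : ℕ → PowerSeries S} (hx : IsJet g β b m x) :
    jetHom x hx (wronskianCoeff g β b m hg q) = ∑ p ∈ Finset.HasAntidiagonal.antidiagonal q,
      ((n β b 1 * p.1 : S) - n β b 0 * p.2) *
        (PowerSeries.coeff p.1 (x 1) * PowerSeries.coeff p.2 (x 0)) := by
  rw [wronskianCoeff, map_sum]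
  refine Finset.sum_congr rfl fun p hp => ?_
  have hp := Finset.HasAntidiagonal.mem_antidiagonal.1 hp
  rw [map_mul, map_mul, jetHom_coord _ _ (by omega), jetHom_coord _ _ (by omega)]
  simp

open PowerSeries in
theorem coeff_wronskian {S : Type*} [CommRing S] (u v : PowerSeries S) (c d q : ℕ) :
    coeff q ((c : PowerSeries S) * (X * derivative S u) * v - (d : PowerSeries S) * (X * derivative S v) * u) =
      ∑ p ∈ Finset.HasAntidiagonal.antidiagonal q, ((c * p.1 : S) - d * p.2) * (coeff p.1 u * coeff p.2 v) := by
  have h : ∀ (w : PowerSeries S) (i : ℕ), coeff i (X * derivative S w) = i * coeff i w := by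
    intro w i
    rcases i with _ | i
    · simp
    · rw [coeff_succ_X_mul, coeff_derivative]
      push_cast
      ring
  have h' : (c : PowerSeries S) * (X * derivative S u) * v -
      (d : PowerSeries S) * (X * derivative S v) * u =
      c • (X * derivative S u * v) - d • (u * (X * derivative S v)) := by
    simp only [nsmul_eq_mul]; ring
  rw [h', map_sub, map_nsmul, map_nsmul, coeff_mul, coeff_mul, nsmul_eq_mul, nsmul_eq_mul,
    Finset.mul_sum, Finset.mul_sum, ← Finset.sum_sub_distrib]
  refine Finset.sum_congr rfl fun p _ => ?_
  rw [h, h]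
  ring

-- Apply `t d/dt` to `u ^ c - v ^ d`, which stays divisible by `X ^ M`, multiply by `u v`, and
-- replace `u ^ c` by `v ^ d`. The operator `t d/dt` is used because it does not lower orders.
open PowerSeries in
theorem dvd_pow_mul_wronskian {S : Type*} [CommRing S] {u v : PowerSeries S} {c d M i j : ℕ}
    (hc : 0 < c) (hd : 0 < d) (h : X ^ M ∣ u ^ c - v ^ d) (hu : X ^ i ∣ u) (hv : X ^ j ∣ v) :
    X ^ (M + (i + j)) ∣
      v ^ d * ((c : PowerSeries S) * (X * derivative S u) * v - (d : PowerSeries S) * (X * derivative S v) * u) := by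
  obtain ⟨f, hf⟩ := h
  have h1 : X * derivative S (u ^ c - v ^ d) = X ^ M * ((M : PowerSeries S) * f + X * derivative S f) := by
    rw [hf, Derivation.leibniz, Derivation.leibniz_pow]
    rcases M with _ | M
    · simp
    · simp only [smul_eq_mul, nsmul_eq_mul, derivative_X]
      push_cast
      ring
  rw [map_sub, Derivation.leibniz_pow, Derivation.leibniz_pow] at h1
  simp only [smul_eq_mul, nsmul_eq_mul] at h1
  obtain ⟨c, rfl⟩ : ∃ a, c = a + 1 := ⟨c - 1, by omega⟩
  obtain ⟨d, rfl⟩ : ∃ a, d = a + 1 := ⟨d - 1, by omega⟩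
  simp only [Nat.add_sub_cancel] at h1
  have h2 : v ^ (d + 1) * (((c + 1 : ℕ) : PowerSeries S) * (X * derivative S u) * v -
      ((d + 1 : ℕ) : PowerSeries S) * (X * derivative S v) * u) =
      X ^ M * (((M : PowerSeries S) * f + X * derivative S f) * (u * v) -
        ((c + 1 : ℕ) : PowerSeries S) * f * (X * derivative S u * v)) := by
    have h3 : v ^ (d + 1) = u ^ (c + 1) - X ^ M * f := by rw [← hf]; ring
    have h4 : X ^ M * (((M : PowerSeries S) * f + X * derivative S f) * (u * v)) =
      (X ^ M * ((M : PowerSeries S) * f + X * derivative S f)) * (u * v) := by ring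
    rw [mul_sub (X ^ M), h4, ← h1, mul_sub (v ^ (d + 1))]
    have h5 : v ^ (d + 1) * (((c + 1 : ℕ) : PowerSeries S) * (X * derivative S u) * v) =
        (u ^ (c + 1) - X ^ M * f) * (((c + 1 : ℕ) : PowerSeries S) * (X * derivative S u) * v) := by
      rw [h3]
    rw [h5]
    ring
  have hdu : X ^ i ∣ X * derivative S u := by
    obtain ⟨w, rfl⟩ := hu
    rw [Derivation.leibniz, Derivation.leibniz_pow]
    rcases i with _ | i
    · simp
    · simp only [smul_eq_mul, nsmul_eq_mul, derivative_X, Nat.add_sub_cancel]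
      exact ⟨X * derivative S w + ((i + 1 : ℕ) : PowerSeries S) * w, by ring⟩
  rw [h2, pow_add]
  refine mul_dvd_mul_left _ (dvd_sub ?_ ?_)
  · rw [pow_add]
    exact Dvd.dvd.mul_left (mul_dvd_mul hu hv) _
  · rw [pow_add]
    exact Dvd.dvd.mul_left (mul_dvd_mul hdu hv) _

theorem IsBranchData.add_lt_mul (hD : IsBranchData g β b) :
    n β b 0 + n β b 1 < n β b 0 * n β b 1 := by
  have h1 := hD.two_le_n_one
  have h2 := hD.n_one_lt
  nlinarith

/-- After division by `x_0 ^ n_0`, of order `k n_0 n_1`, the Wronskian has order at least `m + 1 + k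
n_0 + k n_1 - k n_0 n_1`. -/
theorem IsJet.wronskian_eq_zero (hD : IsBranchData g β b) {S : Type} [CommRing S] [IsDomain S]
    [Algebra ℂ S] {x : ℕ → PowerSeries S} (hx : IsJet g β b m x)
    (h0 : (x 0).order = (k * n β b 1 : ℕ)) (hk : k * n β b 0 * n β b 1 ≤ m) {q : ℕ} (hq : q ≤ m)
    (hlt : q + k * n β b 0 * n β b 1 < m + 1 + (k * n β b 0 + k * n β b 1)) :
    jetHom x hx (wronskianCoeff g β b m hD.one_le q) = 0 := by
  rw [jetHom_wronskianCoeff _ hq, ← coeff_wronskian]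
  obtain ⟨a, ha, hae⟩ := hx.exists_order hD h0 1 hD.one_le fun _ => by
    rw [hD.mul_n_one_beta]; exact Nat.mul_le_mul_right _ hk
  obtain rfl : a = k * n β b 0 :=
    Nat.eq_of_mul_eq_mul_right hD.e_one_pos (by rw [hae, mul_assoc, hD.n_zero_mul])
  have h1 := dvd_pow_mul_wronskian (hD.n_pos hD.one_le) (hD.n_pos (Nat.zero_le g))
    (show PowerSeries.X ^ (m + 1) ∣ x 1 ^ n β b 1 - x 0 ^ n β b 0 by
      have := hx 1 le_rfl hD.one_le
      rwa [Finset.prod_range_one] at this)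
    (X_pow_dvd_iff_le_order.2 ha.ge) (X_pow_dvd_iff_le_order.2 h0.ge)
  rw [X_pow_dvd_iff_le_order, PowerSeries.order_mul, PowerSeries.order_pow, h0] at h1
  by_contra hne
  have h2 := PowerSeries.order_le _ hne
  have h3 := h1.trans (add_le_add_right h2 _)
  rw [nsmul_eq_mul] at h3
  norm_cast at h3
  have h4 : n β b 0 * (k * n β b 1) = k * n β b 0 * n β b 1 := by ring
  omega

namespace IsParam

variable (P : IsParam g β b m k r κ) (hD : IsBranchData g β b)
include P hD

/-- The specialization `x_0 = t ^ (k n_1)`, `x_1 = t ^ (k n_0) (1 + t ^ N)`,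
`N = m + 1 - k n_0 n_1`, of the generic jet of `D_{m,k}`. -/
theorem exists_separating_specialization :
    ∃ f : MvPolynomial (Fin (slack β b m r κ 0) ⊕ freeIndex g m (freeFrom β b m r κ)) ℂ →ₐ[ℂ] ℂ,
      (∀ j ≤ m, f (PowerSeries.coeff j (stratumJet g β b m r κ 0)) =
        if j = k * n β b 1 then 1 else 0) ∧
      (∀ j ≤ m, f (PowerSeries.coeff j (stratumJet g β b m r κ 1)) =
        (if j = k * n β b 0 then 1 else 0) +
          if j = k * n β b 0 + slack β b m r κ 1 then 1 else 0) := by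
  have hr := P.two_le
  set θ : Fin (slack β b m r κ 0) → ℂ := fun j => if (j : ℕ) = 0 then 1 else 0 with hθ
  have hunit : PowerSeries.map (MvPolynomial.aeval θ : MvPolynomial _ ℂ →ₐ[ℂ] ℂ).toRingHom
      (genericUnit (slack β b m r κ 0)) = 1 := by
    ext d
    rw [PowerSeries.coeff_map, genericUnit, PowerSeries.coeff_mk, PowerSeries.coeff_one]
    split_ifs with h1 h2 h2
    · simp [hθ, h2]
    · simp [hθ, h2]
    · exact absurd (P.slack_zero_pos hD) (by omega)
    · simp
  have hy : ∀ i < r, PowerSeries.map (MvPolynomial.aeval θ : MvPolynomial _ ℂ →ₐ[ℂ] ℂ).toRingHom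
      (stratumSeries β r κ (slack β b m r κ 0) i) = PowerSeries.X ^ stratumOrder β r κ i := by
    intro i hi
    rw [stratumSeries, if_pos hi, map_pow, map_mul, map_pow, PowerSeries.map_X, hunit, mul_one,
      ← pow_mul, stratumOrder]
  obtain ⟨f, hf⟩ := exists_specialization (g := g) (m := m) (T := freeFrom β b m r κ)
    (y := stratumSeries β r κ (slack β b m r κ 0)) (x := fun i =>
      PowerSeries.map (MvPolynomial.aeval θ : MvPolynomial _ ℂ →ₐ[ℂ] ℂ).toRingHom
        (stratumSeries β r κ (slack β b m r κ 0) i) +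
        if i = 1 then PowerSeries.X ^ freeFrom β b m r κ 1 else 0) θ
    (fun i _ => by
      rw [add_sub_cancel_left]
      split_ifs with h
      · rw [h]
      · exact dvd_zero _)
  refine ⟨f, fun j hj => ?_, fun j hj => ?_⟩
  · rw [stratumJet, hf 0 (Nat.zero_le g) j hj, hy 0 (by omega), if_neg zero_ne_one, add_zero,
      PowerSeries.coeff_X_pow, P.order_zero hD]
  · rw [stratumJet, hf 1 hD.one_le j hj, hy 1 hr, if_pos rfl, map_add, PowerSeries.coeff_X_pow,
      PowerSeries.coeff_X_pow, freeFrom, if_pos (by omega : 1 < r), P.order_one hD]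

/-- The bound of `IsJet.wronskian_eq_zero` is attained on `D_{m,k}`, and at an index at most `m`
because `n_0 + n_1 < n_0 n_1`; it suffices to look at one specialization. -/
theorem wronskian_ne_zero (hk : 1 ≤ k) :
    k * n β b 1 + (k * n β b 0 + slack β b m r κ 1) ≤ m ∧
    jetHom _ (P.isJet_stratumJet hD) (wronskianCoeff g β b m hD.one_le
      (k * n β b 1 + (k * n β b 0 + slack β b m r κ 1))) ≠ 0 := by
  have h1 := P.n_mul_order_add_slack hD le_rfl P.two_le
  have h2 := P.n_mul_order_le hD le_rfl P.two_le
  rw [P.order_one hD] at h1 h2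
  have h3 : k * (n β b 0 + n β b 1) < k * (n β b 0 * n β b 1) :=
    Nat.mul_lt_mul_of_pos_left hD.add_lt_mul hk
  have h4 : n β b 1 * (k * n β b 0) = k * (n β b 0 * n β b 1) := by ring
  rw [mul_add] at h3
  have hle : k * n β b 1 + (k * n β b 0 + slack β b m r κ 1) ≤ m := by omega
  refine ⟨hle, fun h0 => ?_⟩
  obtain ⟨f, hf0, hf1⟩ := P.exists_separating_specialization hD
  have h5 := congrArg f h0
  rw [jetHom_wronskianCoeff _ hle, map_zero, map_sum,
    -- The surviving factor is `n_1 (k n_0 + N) - n_0 k n_1 = n_1 N`, with `N` the slack of `x_1`,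
    -- which is positive.
    Finset.sum_eq_single (k * n β b 0 + slack β b m r κ 1, k * n β b 1)] at h5
  · simp only [map_mul, map_sub, map_natCast] at h5
    rw [hf0 _ (by omega), hf1 _ (by omega), if_pos rfl, if_pos rfl,
      if_neg (by omega : ¬ k * n β b 0 + slack β b m r κ 1 = k * n β b 0)] at h5
    have h6 : (n β b 1 : ℂ) * slack β b m r κ 1 = 0 := by
      rw [← h5]
      push_cast
      ring
    have h7 : n β b 1 * slack β b m r κ 1 = 0 := by exact_mod_cast h6
    have := hD.n_pos hD.one_le
    rcases Nat.mul_eq_zero.1 h7 with h | h <;> omega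
  · rintro ⟨i, j⟩ hij hne
    have hij := Finset.HasAntidiagonal.mem_antidiagonal.1 hij
    simp only at hij
    rw [map_mul, map_mul, hf0 j (by omega), if_neg, mul_zero, mul_zero]
    rintro rfl
    exact hne (by rw [Prod.mk.injEq]; omega)
  · intro h
    exact absurd (Finset.HasAntidiagonal.mem_antidiagonal.2 (by simp only; omega)) h

end IsParam

/-- The first nonzero Wronskian coefficient on `D_{m,k'}` has index `m + 1 - k' (n_0 n_1 - n_0 -
n_1)`, below the order to which the Wronskian vanishes on `D_{m,k}`. -/
theorem IsParam.not_closure_D_subset_of_gt (P : IsParam g β b m k r κ)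
    (P' : IsParam g β b m k' r' κ') (hD : IsBranchData g β b) (hkk : k < k')
    (h : k * n β b 0 * n β b 1 ≤ m) (h' : k' * n β b 0 * n β b 1 ≤ m) :
    ¬ closure (D g β b m k' h') ⊆ closure (D g β b m k h) := by
  rw [P.closure_D hD, P'.closure_D hD]
  intro hsub
  have h1 := hsub (subset_closure rfl)
  rw [PrimeSpectrum.closure_singleton, PrimeSpectrum.mem_zeroLocus] at h1
  obtain ⟨hle, hne⟩ := P'.wronskian_ne_zero hD (by omega)
  have h2 := P'.n_mul_order_add_slack hD le_rfl P'.two_le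
  rw [P'.order_one hD] at h2
  have h3 : (k' - k) * (n β b 0 + n β b 1) < (k' - k) * (n β b 0 * n β b 1) :=
    Nat.mul_lt_mul_of_pos_left hD.add_lt_mul (by omega)
  refine hne ((mem_jetPoint (P'.isJet_stratumJet hD)).1 (h1 ?_))
  refine (mem_jetPoint (P.isJet_stratumJet hD)).2
    ((P.isJet_stratumJet hD).wronskian_eq_zero hD (P.order_stratumJet hD) h hle ?_)
  obtain ⟨d, rfl⟩ := Nat.exists_eq_add_of_lt hkk
  have h4 : k + d + 1 - k = d + 1 := by omega
  rw [h4] at h3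
  nlinarith

theorem IsParam.not_closure_D_subset_of_lt (P : IsParam g β b m k r κ)
    (P' : IsParam g β b m k' r' κ') (hD : IsBranchData g β b) (hkk : k < k')
    (h : k * n β b 0 * n β b 1 ≤ m) (h' : k' * n β b 0 * n β b 1 ≤ m) :
    ¬ closure (D g β b m k h) ⊆ closure (D g β b m k' h') := by
  rw [P.closure_D hD, P'.closure_D hD]
  intro hsub
  have h1 := hsub (subset_closure rfl)
  rw [PrimeSpectrum.closure_singleton, PrimeSpectrum.mem_zeroLocus] at h1
  have hm : k * n β b 1 ≤ m := (mul_n_one_le hD k).trans h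
  have h2 : coord (curveEq g β b) m 0 (k * n β b 1) ∈
      (jetPoint _ (P'.isJet_stratumJet hD)).asIdeal := by
    rw [mem_jetPoint, jetHom_coord _ _ hm]
    exact (PowerSeries.order_eq_nat.1 (P'.order_stratumJet hD)).2 _
      (Nat.mul_lt_mul_of_pos_right hkk (hD.n_pos hD.one_le))
  have h3 := h1 h2
  rw [SetLike.mem_coe, mem_jetPoint, jetHom_coord _ _ hm] at h3
  exact (PowerSeries.order_eq_nat.1 (P.order_stratumJet hD)).1 h3

end Wronskian

/-! ### Irreducible components from an irredundant finite closed cover -/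

section Components

theorem isIrreducible_preimage_val {X : Type} [TopologicalSpace X] {S T : Set X}
    (hT : IsIrreducible T) (hTS : T ⊆ S) : IsIrreducible ((↑) ⁻¹' T : Set S) := by
  have h1 : IrreducibleSpace T := isIrreducible_iff_irreducibleSpace.1 hT
  have h2 := (IrreducibleSpace.isIrreducible_univ T).image (Set.inclusion hTS)
    (continuous_inclusion hTS).continuousOn
  rwa [Set.image_univ, Set.range_inclusion] at h2

/-- If `S` is the union of finitely many closed irreducible sets, none of which is contained in
another one, then these are its components. -/
theorem componentsOf_eq_of_sUnion {X : Type} [TopologicalSpace X] {S : Set X} {F : Set (Set X)}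
    (hfin : F.Finite) (hclosed : ∀ T ∈ F, IsClosed T) (hirr : ∀ T ∈ F, IsIrreducible T)
    (hS : S = ⋃₀ F) (hmax : ∀ T ∈ F, ∀ T' ∈ F, T ⊆ T' → T = T') : componentsOf S = F := by
  have hsub : ∀ T ∈ F, T ⊆ S := fun T hT => hS ▸ Set.subset_sUnion_of_mem hT
  have hex : ∀ Z : Set S, IsIrreducible Z → ∃ T ∈ F, (Subtype.val '' Z : Set X) ⊆ T := by
    intro Z hZ
    obtain ⟨T, hT, hZT⟩ := isIrreducible_iff_sUnion_isClosed.1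
      (hZ.image Subtype.val continuous_subtype_val.continuousOn) hfin.toFinset
      (fun T hT => hclosed T (hfin.mem_toFinset.1 hT))
      (by
        rw [hfin.coe_toFinset, ← hS]
        exact Subtype.coe_image_subset S Z)
    exact ⟨T, hfin.mem_toFinset.1 hT, hZT⟩
  have himage : ∀ T ∈ F, (Subtype.val '' ((↑) ⁻¹' T : Set S) : Set X) = T := fun T hT => by
    rw [Subtype.image_preimage_coe, Set.inter_eq_right]
    exact hsub T hT
  refine Set.Subset.antisymm ?_ fun T hT => ?_
  · rintro _ ⟨Z, hZ, rfl⟩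
    obtain ⟨T, hT, hZT⟩ := hex Z hZ.1
    have h1 : Z ≤ ((↑) ⁻¹' T : Set S) := Set.image_subset_iff.1 hZT
    have h2 := hZ.2 (isIrreducible_preimage_val (hirr T hT) (hsub T hT)) h1
    change (Subtype.val '' Z : Set X) ∈ F
    rw [le_antisymm h1 h2, himage T hT]
    exact hT
  · refine ⟨(↑) ⁻¹' T, ⟨isIrreducible_preimage_val (hirr T hT) (hsub T hT), fun Z hZ hTZ => ?_⟩,
      himage T hT⟩
    obtain ⟨T', hT', hZT'⟩ := hex Z hZ
    have h1 : T ⊆ T' := by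
      rw [← himage T hT]
      exact (Set.image_mono hTZ).trans hZT'
    rw [hmax T hT T' hT' h1]
    exact Set.image_subset_iff.1 hZT'

end Components

/-! ### The components of the fiber -/

section Fiber

variable {g : ℕ} {β : ℕ → ℕ} {b : ℕ → ℕ → ℕ} {m k k' l : ℕ}

theorem IsBranchData.exists_isParam (hD : IsBranchData g β b) (h : k * n β b 0 * n β b 1 ≤ m)
    (hB : BelowBound g β b m k) : ∃ r κ, IsParam g β b m k r κ := by
  obtain ⟨r, hr⟩ := hD.exists_isCutoff h
  obtain ⟨κ, hκ⟩ := hD.exists_mul_e_eq hr hB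
  exact ⟨r, κ, hr, hκ⟩

theorem isClosed_fiberZero {σ ι : Type} (F : ι → MvPolynomial σ ℂ) (m : ℕ) :
    IsClosed (fiberZero F m) :=
  (PrimeSpectrum.isClosed_zeroLocus _).preimage (PrimeSpectrum.continuous_comap _)

variable (g β b m l) in
/-- The closures of the strata `D_{m,k}`. -/
def stratumClosures : Set (Set (JetSpace (curveEq g β b) m)) :=
  {Z | ∃ k, ∃ h : k * n β b 0 * n β b 1 ≤ m,
    1 ≤ k ∧ k ≤ l ∧ BelowBound g β b m k ∧ Z = closure (D g β b m k h)}

theorem finite_stratumClosures : (stratumClosures g β b m l).Finite := by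
  classical
  refine ((Finset.range (l + 1)).finite_toSet.image fun k =>
    if h : k * n β b 0 * n β b 1 ≤ m then closure (D g β b m k h) else ∅).subset ?_
  rintro _ ⟨k, h, -, hkl, -, rfl⟩
  exact ⟨k, by simpa using by omega, dif_pos h⟩

theorem closure_D_subset_iff (hD : IsBranchData g β b) (h : k * n β b 0 * n β b 1 ≤ m)
    (h' : k' * n β b 0 * n β b 1 ≤ m) (hB : BelowBound g β b m k) (hB' : BelowBound g β b m k') :
    closure (D g β b m k h) ⊆ closure (D g β b m k' h') ↔ k = k' := by
  obtain ⟨r, κ, P⟩ := hD.exists_isParam h hB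
  obtain ⟨r', κ', P'⟩ := hD.exists_isParam h' hB'
  constructor
  · intro hsub
    rcases lt_trichotomy k k' with hlt | heq | hgt
    · exact absurd hsub (P.not_closure_D_subset_of_lt P' hD hlt h h')
    · exact heq
    · exact absurd hsub (P'.not_closure_D_subset_of_gt P hD hgt h' h)
  · rintro rfl
    exact Set.Subset.rfl

theorem componentsOf_fiberZero (hD : IsBranchData g β b) (hlm : l * n β b 0 * n β b 1 < m)
    (hml : m ≤ (l + 1) * n β b 0 * n β b 1) :
    componentsOf (fiberZero (curveEq g β b) m) =
      stratumClosures g β b m l ∪ {B g β b m l hlm.le} := by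
  refine componentsOf_eq_of_sUnion (finite_stratumClosures.union (Set.finite_singleton _))
    ?_ ?_ ?_ ?_
  · rintro T (⟨k, h, -, -, -, rfl⟩ | rfl)
    · exact isClosed_closure
    · exact isClosed_B hlm.le
  · rintro T (⟨k, h, -, -, hB, rfl⟩ | rfl)
    · obtain ⟨r, κ, P⟩ := hD.exists_isParam h hB
      rw [P.closure_D hD]
      exact isIrreducible_singleton.closure
    · exact isIrreducible_B hD hlm hml
  · refine Set.Subset.antisymm (fun p hp => ?_) (Set.sUnion_subset ?_)
    · rcases fiberZero_subset hD hlm hp with hB | ⟨k, h, hk1, hkl, hB, hpD⟩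
      · exact ⟨_, Or.inr rfl, hB⟩
      · exact ⟨_, Or.inl ⟨k, h, hk1, hkl, hB, rfl⟩, subset_closure hpD⟩
    · rintro T (⟨k, h, hk1, -, -, rfl⟩ | rfl)
      · exact closure_minimal (D_subset_fiberZero hD hk1 h) (isClosed_fiberZero _ _)
      · exact B_subset_fiberZero hD hlm.le
  · rintro T (⟨k, h, -, hkl, hB, rfl⟩ | rfl) T' (⟨k', h', -, hkl', hB', rfl⟩ | rfl) hsub
    · obtain rfl := (closure_D_subset_iff hD h h' hB hB').1 hsub
      rfl
    · obtain ⟨r, κ, P⟩ := hD.exists_isParam h hB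
      exact absurd hsub (P.not_closure_D_subset_B hD hlm.le hkl h)
    · obtain ⟨r, κ, P⟩ := hD.exists_isParam h' hB'
      exact absurd hsub (P.not_B_subset hD hlm hkl' h')
    · rfl

end Fiber

end SpaceMonomialCurve

open SpaceMonomialCurve in
theorem mainTheorem1
    (f : MvPowerSeries (Fin 2) ℂ) (hf : Irreducible f)
    (g : ℕ) (hg : 1 ≤ g) (β : ℕ → ℕ) (hβ : IsMinimalGenerators (branchSemigroup f) g β)
    (b : ℕ → ℕ → ℕ) (hb : IsExponentSystem g β b)
    (m l : ℕ) (hm : 1 ≤ m) (hlm : l * n β b 0 * n β b 1 < m)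
    (hml : m ≤ (l + 1) * n β b 0 * n β b 1) :
    componentsOf (fiberZero (curveEq g β b) m) =
        {Z | ∃ k, ∃ h : k * n β b 0 * n β b 1 ≤ m,
          1 ≤ k ∧ k ≤ l ∧ BelowBound g β b m k ∧ Z = closure (D g β b m k h)} ∪
        {B g β b m l hlm.le} ∧
      (∀ k k' (h : k * n β b 0 * n β b 1 ≤ m) (h' : k' * n β b 0 * n β b 1 ≤ m),
        1 ≤ k → k < k' → k' ≤ l → BelowBound g β b m k → BelowBound g β b m k' →
          closure (D g β b m k h) ≠ closure (D g β b m k' h')) ∧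
      (∀ k (h : k * n β b 0 * n β b 1 ≤ m), 1 ≤ k → k ≤ l → BelowBound g β b m k →
        closure (D g β b m k h) ≠ B g β b m l hlm.le) ∧
      (∀ Z ∈ componentsOf (fiberZero (curveEq g β b) m),
        topologicalKrullDim Z ≤ topologicalKrullDim (B g β b m l hlm.le)) := by
  have hD : IsBranchData g β b := isBranchData f hf hg hβ hb
  refine ⟨componentsOf_fiberZero hD hlm hml, ?_, ?_, ?_⟩
  · intro k k' h h' _ hkk _ hB hB' heq
    exact hkk.ne ((closure_D_subset_iff hD h h' hB hB').1 heq.subset)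
  · intro k h _ hkl hB heq
    obtain ⟨r, κ, P⟩ := hD.exists_isParam h hB
    exact P.not_closure_D_subset_B hD hlm.le hkl h heq.subset
  · intro Z hZ
    rw [componentsOf_fiberZero hD hlm hml] at hZ
    rcases hZ with ⟨k, h, -, hkl, hB, rfl⟩ | rfl
    · obtain ⟨r, κ, P⟩ := hD.exists_isParam h hB
      exact P.topologicalKrullDim_closure_D_le hD hlm
        ((Nat.mul_le_mul_right _ (Nat.mul_le_mul_right _ hkl)).trans_lt hlm)
    · exact le_rfl
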